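/- All functions are $C^\infty$; $(t,\xi,\eta)$ are real independent variables, $z=x+iy$ is complex-valued, subscripts denote partial derivatives and the bar complex conjugation. Consider the system $$ z_\xi = i z_{tt},\qquad \tfrac{i}{2}\,(z_\xi \bar z_\eta-\bar z_\xi z_\eta)=1 \tag{S}$$ and the following three systems, in each of which all denominators that occur are required to be nonzero: (A) $z_\xi=iz_{tt}$, $\ \bar z_\xi=-i\bar z_{tt}$, $\ \bar z_\eta=\dfrac{-z_\eta\bar z_{tt}-2}{z_{tt}}$, $\ z_{tt\eta}=0$, $\ z_{ttt}=0$, $\ \bar z_{ttt}=0$; (B) $z_\xi=iz_{tt}$, $\ \bar z_\xi=-i\bar z_{tt}$, $\ z_{ttt}=iNz_{tt}$, $\ \bar z_{ttt}=-iN\bar z_{tt}$, $\ z_{t\eta}=iNz_\eta-iN^{-2}N_\eta z_{tt}$, $\ \bar z_\eta=\dfrac{-z_\eta\bar z_{tt}-2}{z_{tt}}$, where $N=N(\eta)$ is an arbitrary nowhere vanishing smooth real function; (C) $z_\xi=iz_{tt}$, $\ \bar z_\xi=-i\bar z_{tt}$, $\ z_{tttt}=2ikz_{ttt}+(k^2+m)z_{tt}$,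 $\ \bar z_{tttt}=-2ik\bar z_{ttt}+(k^2+m)\bar z_{tt}$, $\ \bar z_\eta=\dfrac{-z_\eta\bar z_{tt}-2}{z_{tt}}$, $$z_{t\eta}=\frac{z_\eta z_{ttt}}{z_{tt}}-2i\,\frac{z_{ttt}^2-2ikz_{tt}z_{ttt}-(k^2+m)z_{tt}^2}{z_{tt}\,\bigl(iz_{tt}\bar z_{ttt}-i\bar z_{tt}z_{ttt}-2kz_{tt}\bar z_{tt}\bigr)},$$ where $k,m$ are arbitrary real constants. **Theorem.** (1) Locally, in general position, the solution set of (S) is the union of the solution sets of (A), (B) (over all $N$) and (C) (over all $k,m$). Precisely: a smooth function $z$ on an open set $U\subseteq\mathbb R^3$ satisfies (S) on $U$ if and only if there is an open dense subset $V$ of $U$ such that every point of $V$ has an open neighbourhood $W\subseteq V$ on which $z$ satisfies (A), or (B) for some $N$, or (C) for some $k,m$. (In particular, every solution of (A), (B) or (C) on $U$ is a solution of (S) on $U$.) (2) The systems (A), (B) (for each $N$) and (C) (for each $k,m$) are passive. Here $z$ and $\bar z$ are regarded as two independent unknowns, the equations as solved for the derivatives on their left-hand sides; these derivatives and all their derivatives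 are called principal, all other derivatives of $z,\bar z$ parametric. Passive means that the compatibility conditions are consequences of the equations, i.e. that no relations between parametric derivatives arise: at a base point, for arbitrarily prescribed complex values of all parametric derivatives for which the denominators do not vanish (in (B), $N$ being any formal real power series in $\eta-\eta_0$ with nonzero constant term), there is exactly one formal power series solution $(z,\bar z)$ with these values. -/

import Mathlib

open scoped ContDiff Topology

/-- The space of the independent variables `(t, ξ, η)`: coordinate `0` is `t`, coordinate `1` is `ξ`,
coordinate `2` is `η`. -/
abbrev Pt : Type := Fin 3 → ℝ

/-- Formal power series over `ℂ` in the increments of the three variables `t, ξ, η` at a base point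
(same numbering of the variables as in `Pt`). -/
abbrev Formal : Type := MvPowerSeries (Fin 3) ℂ

/-- The differential equations below are written once and read in two settings: for smooth functions on
a region, and for formal power series at a point. A `Calculus` records the three partial derivatives, the
meaning of "the equation `f = g` holds" and the meaning of "`f` does not vanish" (used for denominators).
Only the two instances `smoothCalculus` and `formalCalculus` are ever used. -/
structure Calculus (R : Type) where
  /-- `∂/∂t` -/
  t : R → R
  /-- `∂/∂ξ` -/
  xi : R → R
  /-- `∂/∂η` -/
  eta : R → R
  /-- the equation `f = g` holds -/
  eqn : R → R → Prop
  /-- `f` does not vanish -/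
  nonvanishing : R → Prop

/-- Complex-valued functions on the region `U`: true partial derivatives, equations and inequations are
required at every point of `U`. -/
noncomputable def smoothCalculus (U : Set Pt) : Calculus (Pt → ℂ) where
  t f p := fderiv ℝ f p (Pi.single 0 1)
  xi f p := fderiv ℝ f p (Pi.single 1 1)
  eta f p := fderiv ℝ f p (Pi.single 2 1)
  eqn f g := ∀ p ∈ U, f p = g p
  nonvanishing f := ∀ p ∈ U, f p ≠ 0

/-- Formal power series at a base point: formal partial derivatives; a series does not vanish at the base
point if its constant term is nonzero (equivalently, if it is invertible). -/
noncomputable def formalCalculus : Calculus Formal where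
  t f := MvPowerSeries.pderiv ℂ 0 f
  xi f := MvPowerSeries.pderiv ℂ 1 f
  eta f := MvPowerSeries.pderiv ℂ 2 f
  eqn f g := f = g
  nonvanishing f := MvPowerSeries.constantCoeff f ≠ 0

section Systems

variable {R : Type} [CommRing R] [Algebra ℂ R] [Inv R]

/-- The original system `z_ξ = i z_tt`, `(i/2)(z_ξ z̄_η - z̄_ξ z_η) = 1`; the argument `w` stands for `z̄`. -/
def OriginalSystem (C : Calculus R) (z w : R) : Prop :=
  C.eqn (C.xi z) (Complex.I • C.t (C.t z)) ∧
  C.eqn ((Complex.I / 2) • (C.xi z * C.eta w - C.xi w * C.eta z)) 1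

/-- `z_ξ = i z_tt` and the conjugate equation `z̄_ξ = -i z̄_tt`. -/
def SchrodingerPair (C : Calculus R) (z w : R) : Prop :=
  C.eqn (C.xi z) (Complex.I • C.t (C.t z)) ∧
  C.eqn (C.xi w) (-(Complex.I • C.t (C.t w)))

/-- `z̄_η = (-z_η z̄_tt - 2) / z_tt`. -/
def SolvedConjEta (C : Calculus R) (z w : R) : Prop :=
  C.eqn (C.eta w) ((-(C.eta z * C.t (C.t w)) - 2) * (C.t (C.t z))⁻¹)

/-- The denominator of system (A): `z_tt ≠ 0`. -/
def RegularA (C : Calculus R) (z : R) : Prop :=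
  C.nonvanishing (C.t (C.t z))

/-- The equations of system (A): `z_ξ = i z_tt` and its conjugate, the equation solved for `z̄_η`,
`z_ttη = 0`, `z_ttt = 0` and the conjugate `z̄_ttt = 0`. -/
def EquationsA (C : Calculus R) (z w : R) : Prop :=
  SchrodingerPair C z w ∧ SolvedConjEta C z w ∧
  C.eqn (C.eta (C.t (C.t z))) 0 ∧
  C.eqn (C.t (C.t (C.t z))) 0 ∧
  C.eqn (C.t (C.t (C.t w))) 0

/-- The denominators of system (B): `z_tt ≠ 0` and `N ≠ 0`. -/
def RegularB (C : Calculus R) (N z : R) : Prop :=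
  C.nonvanishing (C.t (C.t z)) ∧ C.nonvanishing N

/-- The equations of system (B), where `N` is a real function of `η`: `z_ξ = i z_tt` and its conjugate,
`z_ttt = i N z_tt` and its conjugate, `z_tη = i N z_η - i N⁻² N_η z_tt`, and the equation solved
for `z̄_η`. -/
def EquationsB (C : Calculus R) (N z w : R) : Prop :=
  SchrodingerPair C z w ∧ SolvedConjEta C z w ∧
  C.eqn (C.t (C.t (C.t z))) (Complex.I • (N * C.t (C.t z))) ∧
  C.eqn (C.t (C.t (C.t w))) (-(Complex.I • (N * C.t (C.t w)))) ∧
  C.eqn (C.eta (C.t z))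
    (Complex.I • (N * C.eta z) - Complex.I • ((N ^ 2)⁻¹ * C.eta N * C.t (C.t z)))

/-- `i z_tt z̄_ttt - i z̄_tt z_ttt - 2 k z_tt z̄_tt`. -/
def denomC (C : Calculus R) (k : ℝ) (z w : R) : R :=
  Complex.I • (C.t (C.t z) * C.t (C.t (C.t w))) - Complex.I • (C.t (C.t w) * C.t (C.t (C.t z)))
    - (2 * (k : ℂ)) • (C.t (C.t z) * C.t (C.t w))

/-- The denominators of system (C): `z_tt ≠ 0` and `i z_tt z̄_ttt - i z̄_tt z_ttt - 2 k z_tt z̄_tt ≠ 0`. -/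
def RegularC (C : Calculus R) (k : ℝ) (z w : R) : Prop :=
  C.nonvanishing (C.t (C.t z)) ∧ C.nonvanishing (denomC C k z w)

/-- The equations of system (C): `z_ξ = i z_tt` and its conjugate,
`z_tttt = 2 i k z_ttt + (k² + m) z_tt` and its conjugate, the equation solved for `z̄_η`, and
`z_tη = z_η z_ttt / z_tt - 2 i (z_ttt² - 2 i k z_tt z_ttt - (k² + m) z_tt²) /
  (z_tt (i z_tt z̄_ttt - i z̄_tt z_ttt - 2 k z_tt z̄_tt))`. -/
def EquationsC (C : Calculus R) (k m : ℝ) (z w : R) : Prop :=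
  SchrodingerPair C z w ∧ SolvedConjEta C z w ∧
  C.eqn (C.t (C.t (C.t (C.t z))))
    ((2 * Complex.I * (k : ℂ)) • C.t (C.t (C.t z)) + ((k : ℂ) ^ 2 + (m : ℂ)) • C.t (C.t z)) ∧
  C.eqn (C.t (C.t (C.t (C.t w))))
    (-((2 * Complex.I * (k : ℂ)) • C.t (C.t (C.t w))) + ((k : ℂ) ^ 2 + (m : ℂ)) • C.t (C.t w)) ∧
  C.eqn (C.eta (C.t z))
    (C.eta z * C.t (C.t (C.t z)) * (C.t (C.t z))⁻¹ -
      (2 * Complex.I) •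
        (((C.t (C.t (C.t z))) ^ 2
            - (2 * Complex.I * (k : ℂ)) • (C.t (C.t z) * C.t (C.t (C.t z)))
            - ((k : ℂ) ^ 2 + (m : ℂ)) • (C.t (C.t z)) ^ 2)
          * (C.t (C.t z) * denomC C k z w)⁻¹))

end Systems

/-- The complex conjugate `z̄` of a complex-valued function. -/
noncomputable def conjFun (z : Pt → ℂ) : Pt → ℂ := fun p => (starRingEnd ℂ) (z p)

/-- `z` is a solution of the original system on `U`. -/
def SolvesOriginal (U : Set Pt) (z : Pt → ℂ) : Prop :=
  OriginalSystem (smoothCalculus U) z (conjFun z)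

/-- `z` is a solution of system (A) on `U`. -/
def SolvesA (U : Set Pt) (z : Pt → ℂ) : Prop :=
  RegularA (smoothCalculus U) z ∧ EquationsA (smoothCalculus U) z (conjFun z)

/-- `z` is a solution on `U` of system (B) with the real function `N` of the variable `η`. -/
def SolvesB (U : Set Pt) (N : ℝ → ℝ) (z : Pt → ℂ) : Prop :=
  ContDiffOn ℝ ∞ N ((fun p : Pt => p 2) '' U) ∧
  RegularB (smoothCalculus U) (fun p => (N (p 2) : ℂ)) z ∧
  EquationsB (smoothCalculus U) (fun p => (N (p 2) : ℂ)) z (conjFun z)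

/-- `z` is a solution on `U` of system (C) with the real constants `k`, `m`. -/
def SolvesC (U : Set Pt) (k m : ℝ) (z : Pt → ℂ) : Prop :=
  RegularC (smoothCalculus U) k z (conjFun z) ∧
  EquationsC (smoothCalculus U) k m z (conjFun z)

/-- The multi-index of the derivative `∂_t^a ∂_ξ^b ∂_η^c`. -/
noncomputable def multiIndex (a b c : ℕ) : Fin 3 →₀ ℕ := Finsupp.equivFunOnFinite.symm ![a, b, c]

/-- Passivity of a system of differential equations for two unknowns `z`, `w`, solved for the derivatives
of `z` with multi-indices in `leadZ` and the derivatives of `w` with multi-indices in `leadW`. The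
principal derivatives are these and all their derivatives; the other ones are parametric. The system is
passive if all its compatibility conditions are consequences of the equations already written, that is,
if the equations and all their differential consequences determine the principal derivatives at a point
and impose no relation on the parametric ones: for arbitrarily prescribed values of all parametric
derivatives at the point at which the denominators do not vanish (here these are the values taken from an
arbitrary pair `z₀`, `w₀` of series; the Taylor coefficient with multi-index `a` is the derivative with
multi-index `a` divided by a factorial), there is exactly one formal solution with these values.
For the systems in question the condition `regular` involves parametric derivatives only. -/
def IsPassive (leadZ leadW : Set (Fin 3 →₀ ℕ)) (regular equations : Formal → Formal → Prop) : Prop :=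
  ∀ z₀ w₀ : Formal, regular z₀ w₀ →
    ∃! q : Formal × Formal, equations q.1 q.2 ∧
      (∀ a : Fin 3 →₀ ℕ, (∀ l ∈ leadZ, ¬ l ≤ a) →
        MvPowerSeries.coeff a q.1 = MvPowerSeries.coeff a z₀) ∧
      (∀ a : Fin 3 →₀ ℕ, (∀ l ∈ leadW, ¬ l ≤ a) →
        MvPowerSeries.coeff a q.2 = MvPowerSeries.coeff a w₀)

/-- System (A), solved for `z_ξ, z_ttη, z_ttt` and `z̄_ξ, z̄_η, z̄_ttt`, is passive. -/
def PassiveA : Prop :=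
  IsPassive {multiIndex 0 1 0, multiIndex 2 0 1, multiIndex 3 0 0}
    {multiIndex 0 1 0, multiIndex 0 0 1, multiIndex 3 0 0}
    (fun z _ => RegularA formalCalculus z) (EquationsA formalCalculus)

/-- The power series is a real series in the (increment of the) variable `η` alone. -/
def IsRealSeriesInEta (N : Formal) : Prop :=
  ∀ a : Fin 3 →₀ ℕ, (MvPowerSeries.coeff a N).im = 0 ∧
    ((a 0 ≠ 0 ∨ a 1 ≠ 0) → MvPowerSeries.coeff a N = 0)

/-- System (B) with the coefficient function `N`, solved for `z_ξ, z_ttt, z_tη` and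
`z̄_ξ, z̄_η, z̄_ttt`, is passive. -/
def PassiveB (N : Formal) : Prop :=
  IsPassive {multiIndex 0 1 0, multiIndex 3 0 0, multiIndex 1 0 1}
    {multiIndex 0 1 0, multiIndex 0 0 1, multiIndex 3 0 0}
    (fun z _ => RegularB formalCalculus N z) (EquationsB formalCalculus N)

/-- System (C) with the constants `k`, `m`, solved for `z_ξ, z_tttt, z_tη` and `z̄_ξ, z̄_η, z̄_tttt`,
is passive. -/
def PassiveC (k m : ℝ) : Prop :=
  IsPassive {multiIndex 0 1 0, multiIndex 4 0 0, multiIndex 1 0 1}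
    {multiIndex 0 1 0, multiIndex 0 0 1, multiIndex 4 0 0}
    (RegularC formalCalculus k) (EquationsC formalCalculus k m)

/-! Write u = z_tt, p = z_η and let v, r be their conjugates. System (S) says that z_ξ = i u and u r
+ v p = -2. Hence u never vanishes, u and p again solve f_ξ = i f_tt, p_tt = u_η, and p/u has real
part -1/|u|². Putting u_t/u = al + i be, p/u = -rho + i s and s_t = 2 rho B turns (S) into a real
system, `PolarSystem`, and the classification comes from its integrability conditions.

The first condition is B_t = be_t. If al and be do not depend on t, then al = 0 and be depends on η
alone: be = 0 leads to (A), be ≠ 0 to (B) with N = be. Otherwise R = al² + B² is nonzero on some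
open set; the plane vector (al, B) has squared length R and a certain angular velocity G - 2B, and
commuting derivatives show that R is affine in t. Two applications of one principle finish this
case: a polynomial relation, with coefficients independent of t, for a function whose t-derivative
is invertible has all its coefficients zero. Applied to R it equates a sum of two real squares to
zero and forces R_t = 0 (`affine_modulus_relation`); applied to G it forces R_ξ = 0
(`eq_zero_of_quartic_system`). Then u_tt = 2ik u_t + K u with constant k and K, which is (C) with m
= K - k² (`RotatingSystem.constant_coefficients`). Conversely, each of the three systems contains
z_ξ = i z_tt and the equation solved for z̄_η, which give (S) on a dense open set and by continuity
everywhere.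

For passivity, the equation for the η-derivatives is kept only at ξ = 0 and the pure t-equation only
at ξ = η = 0, while the ξ-equations are kept everywhere. This determines all Taylor coefficients
recursively and uniquely (`existsUnique_recursion`). The defects of the equations so restricted
vanish initially and satisfy evolution equations in η and in ξ, so they vanish identically. The
algebra behind these evolution equations is the compatibility of each system. -/

set_option linter.unusedSimpArgs false

/-! ### Polar form of the system over a ring with three commuting derivations -/

section DifferentialAlgebra

variable {S : Type*} [CommRing S] [Algebra ℂ S]

theorem derivation_ofNat (D : Derivation ℂ S S) (n : ℕ) [n.AtLeastTwo] :
    D (ofNat(n) : S) = 0 := D.map_natCast n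

theorem eq_of_natCast_mul_eq (n : ℕ) (hn : n ≠ 0) {x y : S} (h : (n : S) * x = n * y) : x = y := by
  have h' : (n : ℂ) • x = (n : ℂ) • y := by
    simpa [Algebra.smul_def] using h
  have hn' : (n : ℂ) ≠ 0 := by exact_mod_cast hn
  have := congrArg (fun f => (n : ℂ)⁻¹ • f) h'
  simpa [smul_smul, inv_mul_cancel₀ hn'] using this

theorem eq_of_two_mul_eq {x y : S} (h : 2 * x = 2 * y) : x = y :=
  eq_of_natCast_mul_eq 2 two_ne_zero (by exact_mod_cast h)

attribute [local simp] Derivation.leibniz Derivation.leibniz_pow derivation_ofNat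

/-- Real form of the system for the logarithmic derivative `al + i be` of `z_tt` and the
quotient `- rho + i s` of `z_η` by `z_tt`. -/
structure PolarSystem (dt dx de : Derivation ℂ S S) (al be rho s B : S) : Prop where
  comm_tx : ∀ f, dx (dt f) = dt (dx f)
  comm_te : ∀ f, de (dt f) = dt (de f)
  comm_xe : ∀ f, de (dx f) = dx (de f)
  rho_t : dt rho = -2 * al * rho
  s_t : dt s = 2 * rho * B
  B_t : dt B = dt be
  al_xi : dx al = -dt (dt be + 2 * al * be)
  be_xi : dx be = dt (dt al + al ^ 2 - be ^ 2)
  rho_xi : dx rho = 2 * rho * (dt be + 2 * al * be)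
  s_xi : dx s = rho * (2 * dt al - 4 * be * B)
  al_eta : de al = dt (-rho * (dt al + al ^ 2 - be ^ 2) - s * (dt be + 2 * al * be)
    + 2 * rho * (dt al - 2 * be * B))
  be_eta : de be = dt (s * (dt al + al ^ 2 - be ^ 2) - rho * (dt be + 2 * al * be)
    + 2 * rho * (dt B + 2 * be * al))

/-- Commuting derivations satisfy D(u_t/u) = ∂_t(Du/u); the unit u is cancelled after expanding
D(u_t) = ∂_t(Du). -/
theorem logDeriv_evolution {dt D : Derivation ℂ S S} {u a f g : S}
    (comm : ∀ f, D (dt f) = dt (D f)) (hu : IsUnit u) (ut : dt u = u * a)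
    (hD : D u = u * f) (hfg : dt f = g) : D a = g := by
  have h := comm u
  rw [ut, hD] at h
  simp only [Derivation.leibniz, smul_eq_mul, ut, hD, hfg] at h
  exact hu.mul_left_cancel (by linear_combination h)

/-- The polar form of the system `z_ξ = i z_tt`, `z_tt z̄_η + z̄_tt z_η = -2`. -/
theorem polarSystem_of_solution {dt dx de : Derivation ℂ S S} {u v p r al be rho s B j : S}
    (comm_tx : ∀ f, dx (dt f) = dt (dx f)) (comm_te : ∀ f, de (dt f) = dt (de f))
    (comm_xe : ∀ f, de (dx f) = dx (de f)) (hj : j * j = -1) (jt : dt j = 0) (jx : dx j = 0)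
    (je : de j = 0)
    (hrho : u * v * rho = 1) (ut : dt u = u * (al + j * be)) (vt : dt v = v * (al - j * be))
    (ux : dx u = j * dt (dt u)) (vx : dx v = -(j * dt (dt v)))
    (px : dx p = j * dt (dt p)) (rx : dx r = -(j * dt (dt r)))
    (pe : dt (dt p) = de u) (re : dt (dt r) = de v)
    (hp : p = u * (-rho + j * s)) (hr : r = v * (-rho - j * s)) (hs : dt s = 2 * rho * B) :
    PolarSystem dt dx de al be rho s B := by
  have hu : IsUnit u := IsUnit.of_mul_eq_one (v * rho) (by linear_combination hrho)
  have hv : IsUnit v := IsUnit.of_mul_eq_one (u * rho) (by linear_combination hrho)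
  have huv : IsUnit (u * v) := hu.mul hv
  have hrho' : IsUnit rho := IsUnit.of_mul_eq_one (u * v) (by linear_combination hrho)
  have rho_t : dt rho = -2 * al * rho := by
    have h := congrArg dt hrho
    simp only [Derivation.leibniz, smul_eq_mul, ut, vt, Derivation.map_one_eq_zero] at h
    exact huv.mul_left_cancel (by linear_combination h)
  have utt : dt (dt u) = u * ((dt al + al ^ 2 - be ^ 2) + j * (dt be + 2 * al * be)) := by
    rw [ut]
    simp only [Derivation.leibniz, smul_eq_mul, ut, map_add, jt]
    linear_combination u * be ^ 2 * hj
  have vtt : dt (dt v) = v * ((dt al + al ^ 2 - be ^ 2) - j * (dt be + 2 * al * be)) := by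
    rw [vt]
    simp only [Derivation.leibniz, smul_eq_mul, vt, map_sub, jt]
    linear_combination v * be ^ 2 * hj
  have ux' : dx u = u * (-(dt be + 2 * al * be) + j * (dt al + al ^ 2 - be ^ 2)) := by
    rw [ux, utt]
    linear_combination u * (dt be + 2 * al * be) * hj
  have vx' : dx v = v * (-(dt be + 2 * al * be) - j * (dt al + al ^ 2 - be ^ 2)) := by
    rw [vx, vtt]
    linear_combination v * (dt be + 2 * al * be) * hj
  have ax := logDeriv_evolution comm_tx hu ut ux' rfl
  have bx := logDeriv_evolution comm_tx hv vt vx' rfl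
  have rho_x : dx rho = 2 * rho * (dt be + 2 * al * be) := by
    have h := congrArg dx hrho
    simp only [Derivation.leibniz, smul_eq_mul, ux', vx', Derivation.map_one_eq_zero] at h
    exact huv.mul_left_cancel (by linear_combination h)
  -- Both u and u q solve f_ξ = i f_tt, so q = p/u satisfies q_ξ = i (q_tt + 2 (u_t/u) q_t). The
  -- conjugate equation follows separately, since v and r count as independent elements here.
  have hq : dx (-rho + j * s) = j * (2 * (al + j * be) * dt (-rho + j * s)
      + dt (dt (-rho + j * s))) := by
    have h := px
    rw [hp] at h
    simp only [Derivation.leibniz, smul_eq_mul, ux, ut, map_add] at h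
    refine hu.mul_left_cancel ?_
    simp only [Derivation.leibniz, smul_eq_mul, map_add]
    linear_combination h
  have hq' : dx (-rho - j * s) = -(j * (2 * (al - j * be) * dt (-rho - j * s)
      + dt (dt (-rho - j * s)))) := by
    have h := rx
    rw [hr] at h
    simp only [Derivation.leibniz, smul_eq_mul, vx, vt, map_add, map_sub] at h
    refine hv.mul_left_cancel ?_
    simp only [Derivation.leibniz, smul_eq_mul, map_add, map_sub]
    linear_combination h
  have ue : de u = u * ((-rho * (dt al + al ^ 2 - be ^ 2) - s * (dt be + 2 * al * be)
      + 2 * rho * (dt al - 2 * be * B)) + j * (s * (dt al + al ^ 2 - be ^ 2)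
      - rho * (dt be + 2 * al * be) + 2 * rho * (dt B + 2 * be * al))) := by
    rw [← pe, hp]
    simp only [Derivation.leibniz, smul_eq_mul, ut, map_add, map_neg, jt, hs, rho_t,
      derivation_ofNat, map_zero]
    linear_combination u * (s * (dt be + 2 * al * be) + 4 * rho * be * B
      + (j * s - rho) * be ^ 2) * hj
  have ve : de v = v * ((-rho * (dt al + al ^ 2 - be ^ 2) - s * (dt be + 2 * al * be)
      + 2 * rho * (dt al - 2 * be * B)) - j * (s * (dt al + al ^ 2 - be ^ 2)
      - rho * (dt be + 2 * al * be) + 2 * rho * (dt B + 2 * be * al))) := by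
    rw [← re, hr]
    simp only [Derivation.leibniz, smul_eq_mul, vt, map_add, map_sub, map_neg, jt, hs, rho_t,
      derivation_ofNat, map_zero]
    linear_combination v * (s * (dt be + 2 * al * be) + 4 * rho * be * B
      + (-j * s - rho) * be ^ 2) * hj
  have ae := logDeriv_evolution comm_te hu ut ue rfl
  have ae' := logDeriv_evolution comm_te hv vt ve rfl
  rw [map_add, map_add] at ax ae
  rw [map_sub, map_sub] at bx ae'
  simp only [Derivation.leibniz dx j, Derivation.leibniz de j, Derivation.leibniz dt j,
    smul_eq_mul, jt, jx, je] at ax bx ae ae'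
  simp only [Derivation.leibniz, smul_eq_mul, map_add, map_sub, map_neg, jt, jx, hs, rho_t,
    derivation_ofNat, rho_x, map_zero] at hq hq'
  refine ⟨comm_tx, comm_te, comm_xe, rho_t, hs, ?_, eq_of_two_mul_eq ?_, eq_of_two_mul_eq ?_,
    rho_x, eq_of_two_mul_eq ?_, eq_of_two_mul_eq ?_, eq_of_two_mul_eq ?_⟩
  -- The real part of the equation for q: the ξ-derivative of rho is already known, and what remains
  -- is 4 rho (B_t - be_t) = 0. The other components below are likewise half sums and half
  -- differences of conjugate equations.
  · refine hrho'.mul_left_cancel (eq_of_natCast_mul_eq 4 (by norm_num) ?_)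
    push_cast
    linear_combination hq + hq' + (4 * rho * dt B + 8 * rho * al * be) * hj
  · rw [map_neg] at ax bx
    linear_combination ax + bx
  · linear_combination (-j) * (ax - bx) + 2 * (dx be - dt (dt al + al ^ 2 - be ^ 2)) * hj
  · linear_combination (-j) * (hq - hq') + (2 * dx s - 4 * rho * dt al
      + 8 * rho * be * B * (1 - j * j)) * hj
  · linear_combination ae + ae'
  · linear_combination (-j) * (ae - ae') + 2 * (de be - dt (s * (dt al + al ^ 2 - be ^ 2)
      - rho * (dt be + 2 * al * be) + 2 * rho * (dt B + 2 * be * al))) * hj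

end DifferentialAlgebra

/-! ### Integrability conditions: the rotating vector (al, B) -/

section RotatingSystem

variable {S : Type*} [CommRing S] [Algebra ℂ S]

/-- If the logarithmic derivative of `z_tt` does not depend on `t`, then its real part vanishes
(as soon as the ring is reduced to real functions), by these two relations. -/
theorem PolarSystem.relations_of_stationary {dt dx de : Derivation ℂ S S} {al be rho s B : S}
    (h : PolarSystem dt dx de al be rho s B) (hrho : IsUnit rho) (al_t : dt al = 0)
    (be_t : dt be = 0) :
    al * (al * (al ^ 2 - be ^ 2 + 2 * be * B)) = 0 ∧
      al * (B * (al ^ 2 - be ^ 2) - 2 * al ^ 2 * be) = 0 := by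
  have B_t : dt B = 0 := by rw [h.B_t, be_t]
  have h1 := h.al_eta
  have h2 := h.be_eta
  simp only [Derivation.leibniz, Derivation.leibniz_pow, smul_eq_mul, map_add, map_sub, map_neg,
    h.s_t, h.rho_t, derivation_ofNat, map_zero, al_t, be_t, B_t, mul_zero, smul_zero, sub_zero, add_zero] at h1 h2
  -- With al and be independent of t, their η-derivatives must be independent of t as well;
  -- differentiating the η-equations once more in t gives the two relations.
  have h3 := h.comm_te al
  have h4 := h.comm_te be
  rw [al_t, map_zero, h1] at h3
  rw [be_t, map_zero, h2] at h4
  simp only [Derivation.leibniz, Derivation.leibniz_pow, smul_eq_mul, map_add, map_sub, map_neg,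
    h.s_t, h.rho_t, derivation_ofNat, map_zero, al_t, be_t, B_t, mul_zero, smul_zero, sub_zero, add_zero] at h3 h4
  constructor
  · refine hrho.mul_left_cancel (eq_of_natCast_mul_eq 4 (by norm_num) ?_)
    push_cast
    linear_combination h3
  · refine hrho.mul_left_cancel (eq_of_natCast_mul_eq 4 (by norm_num) ?_)
    push_cast
    linear_combination h4

/-- The evolution in `t` and `ξ` when `al + i B` does not vanish, in terms of
`hh = R_t / 2R`, `e = R_ξ / 2R`, `R = al² + B²` and an angular quantity `G`. -/
structure RotatingSystem (dt dx de : Derivation ℂ S S) (al be rho s B c R hh G e : S) : Prop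
    extends PolarSystem dt dx de al be rho s B where
  c_eq : c = 2 * (B - be)
  R_eq : R = al ^ 2 + B ^ 2
  R_t : dt R = 2 * R * hh
  R_xi : dx R = 2 * R * e
  c_t : dt c = 0
  c_xi : dx c = -8 * R * hh
  hh_t : dt hh = -2 * hh ^ 2
  al_t : dt al = al * hh - B * (G - 2 * B)
  B_t' : dt B = B * hh + al * (G - 2 * B)
  G_t : dt G = c * hh - e - 2 * hh * G
  al_xi' : dx al = al * e - B * (-hh ^ 2 - 2 * al * hh - G ^ 2 + 2 * G * B + c * G - 2 * c * B)
  B_xi : dx B = B * e + al * (-hh ^ 2 - 2 * al * hh - G ^ 2 + 2 * G * B + c * G - 2 * c * B)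
  G_xi : dx G = 4 * hh ^ 3 - 4 * hh * R + (c - 2 * G) * (c * hh - e - 2 * hh * G)

/-- The numbers hh and e are the logarithmic rates of change of the length √R in t and ξ, and G - 2B
is the angular velocity of (al, B) in t. Every equation is forced by commuting ∂_t and ∂_ξ on s, B,
al, or by computing R_ξ in two ways. -/
theorem PolarSystem.rotating {dt dx de : Derivation ℂ S S} {al be rho s B hh G e : S}
    (h : PolarSystem dt dx de al be rho s B) (hrho : IsUnit rho) (hR : IsUnit (al ^ 2 + B ^ 2))
    (R_t : dt (al ^ 2 + B ^ 2) = 2 * (al ^ 2 + B ^ 2) * hh)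
    (R_xi : dx (al ^ 2 + B ^ 2) = 2 * (al ^ 2 + B ^ 2) * e)
    (hG : (al ^ 2 + B ^ 2) * G = al * dt B - B * dt al + 2 * (al ^ 2 + B ^ 2) * B) :
    RotatingSystem dt dx de al be rho s B (2 * (B - be)) (al ^ 2 + B ^ 2) hh G e := by
  have c_t : dt (2 * (B - be)) = 0 := by
    simp only [Derivation.leibniz, smul_eq_mul, map_sub, derivation_ofNat, h.B_t]; ring
  -- Integrability of s: compare ∂_ξ(2 rho B) with the t-derivative of s_ξ.
  have B_xi0 : dx B = dx be - 4 * (al ^ 2 + B ^ 2) * hh := by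
    have h1 := h.comm_tx s
    rw [h.s_t, h.s_xi] at h1
    have h2 := R_t
    have h3 := h.be_xi
    simp only [Derivation.leibniz, Derivation.leibniz_pow, smul_eq_mul, map_add, map_sub, nsmul_eq_mul,
      map_neg, Nat.cast_ofNat, Nat.add_one_sub_one, pow_one, derivation_ofNat, h.rho_t, h.rho_xi] at h1 h2 h3
    refine hrho.mul_left_cancel (eq_of_two_mul_eq ?_)
    linear_combination h1 - 2 * rho * h3 - 4 * rho * h2 - 4 * rho * be * h.B_t
      + 8 * rho * B * h.B_t
  have al_t : dt al = al * hh - B * (G - 2 * B) := by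
    have h2 := R_t
    simp only [Derivation.leibniz_pow, smul_eq_mul, map_add, nsmul_eq_mul, Nat.cast_ofNat,
      Nat.add_one_sub_one, pow_one] at h2
    refine hR.mul_left_cancel (eq_of_two_mul_eq ?_)
    linear_combination al * h2 + 2 * B * hG
  have B_t' : dt B = B * hh + al * (G - 2 * B) := by
    have h2 := R_t
    simp only [Derivation.leibniz_pow, smul_eq_mul, map_add, nsmul_eq_mul, Nat.cast_ofNat,
      Nat.add_one_sub_one, pow_one] at h2
    refine hR.mul_left_cancel (eq_of_two_mul_eq ?_)
    linear_combination B * h2 - 2 * al * hG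
  have be_t : dt be = B * hh + al * (G - 2 * B) := by rw [← h.B_t, B_t']
  -- Since B - be is independent of t, so is its ξ-derivative -4 R hh = -2 R_t. Thus R is affine in
  -- t, and hh = R_t / 2R satisfies a Riccati equation.
  have hh_t : dt hh = -2 * hh ^ 2 := by
    have h1 := h.comm_tx B
    have h2 := h.comm_tx be
    rw [B_xi0, h.B_t, h2, map_sub, Derivation.leibniz, Derivation.leibniz, R_t,
      derivation_ofNat] at h1
    simp only [smul_eq_mul] at h1
    refine hR.mul_left_cancel (eq_of_natCast_mul_eq 4 (by norm_num) ?_)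
    push_cast
    linear_combination h1
  -- R_ξ is 2 R e by definition of e, and is also computable from the ξ-equations of al, be and B;
  -- the latter contains G_t linearly.
  have G_t : dt G = 2 * (B - be) * hh - e - 2 * hh * G := by
    have h1 := R_xi
    rw [map_add, Derivation.leibniz_pow, Derivation.leibniz_pow, B_xi0, h.al_xi, h.be_xi] at h1
    simp only [Derivation.leibniz, Derivation.leibniz_pow, smul_eq_mul, map_add, map_sub,
      nsmul_eq_mul, map_neg, Nat.cast_ofNat, Nat.add_one_sub_one, pow_one, derivation_ofNat,
      al_t, B_t', be_t, hh_t] at h1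
    refine hR.mul_left_cancel (eq_of_two_mul_eq ?_)
    linear_combination -h1
  have al_xi' : dx al = al * e - B * (-hh ^ 2 - 2 * al * hh - G ^ 2 + 2 * G * B
      + 2 * (B - be) * G - 2 * (2 * (B - be)) * B) := by
    rw [h.al_xi]
    simp only [Derivation.leibniz, Derivation.leibniz_pow, smul_eq_mul, map_add, map_sub,
      nsmul_eq_mul, map_neg, Nat.cast_ofNat, Nat.add_one_sub_one, pow_one, derivation_ofNat,
      al_t, B_t', be_t, hh_t, G_t]
    ring
  have B_xi : dx B = B * e + al * (-hh ^ 2 - 2 * al * hh - G ^ 2 + 2 * G * B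
      + 2 * (B - be) * G - 2 * (2 * (B - be)) * B) := by
    rw [B_xi0, h.be_xi]
    simp only [Derivation.leibniz, Derivation.leibniz_pow, smul_eq_mul, map_add, map_sub,
      nsmul_eq_mul, map_neg, Nat.cast_ofNat, Nat.add_one_sub_one, pow_one, derivation_ofNat,
      al_t, B_t', be_t, hh_t, G_t]
    ring
  have be_xi : dx be = B * e + al * (-hh ^ 2 - 2 * al * hh - G ^ 2 + 2 * G * B
      + 2 * (B - be) * G - 2 * (2 * (B - be)) * B) + 4 * (al ^ 2 + B ^ 2) * hh := by
    linear_combination B_xi - B_xi0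
  refine { h with
    c_eq := rfl, R_eq := rfl, R_t := R_t, R_xi := R_xi, c_t := c_t, c_xi := ?_, hh_t := hh_t,
    al_t := al_t, B_t' := B_t', G_t := G_t, al_xi' := al_xi', B_xi := B_xi, G_xi := ?_ }
  · simp only [Derivation.leibniz, smul_eq_mul, map_sub, derivation_ofNat, B_xi0]
    ring
  -- The component orthogonal to (al, B) of the commutation of ∂_t and ∂_ξ on this vector.
  · have h1 := h.comm_tx al
    have h2 := h.comm_tx B
    rw [al_t, al_xi'] at h1
    rw [B_t', B_xi] at h2
    simp only [Derivation.leibniz, Derivation.leibniz_pow, smul_eq_mul, map_add, map_sub,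
      nsmul_eq_mul, map_neg, Nat.cast_ofNat, Nat.add_one_sub_one, pow_one, derivation_ofNat,
      al_t, B_t', be_t, hh_t, G_t, B_xi, al_xi', be_xi] at h1 h2
    refine hR.mul_left_cancel ?_
    linear_combination al * h2 - B * h1

end RotatingSystem

/-! ### Polynomial relations over the constants of a derivation -/

section Constants

open Polynomial

variable {S : Type*} [CommRing S] [Algebra ℂ S]

/-- The subalgebra of the elements killed by a derivation. -/
def constants (d : Derivation ℂ S S) : Subalgebra ℂ S where
  carrier := {f | d f = 0}
  mul_mem' {a b} ha hb := by
    simp only [Set.mem_ofPred_eq] at ha hb ⊢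
    simp [ha, hb]
  add_mem' {a b} ha hb := by
    simp only [Set.mem_ofPred_eq] at ha hb ⊢
    simp [ha, hb]
  algebraMap_mem' r := d.map_algebraMap r

theorem derivation_aeval_constants (d : Derivation ℂ S S) (x : S) (P : (constants d)[X]) :
    d (aeval x P) = aeval x (derivative P) * d x := by
  induction P using Polynomial.induction_on' with
  | add p q hp hq => simp [hp, hq, add_mul]
  | monomial n a =>
    have ha : d (a : S) = 0 := a.2
    rw [aeval_monomial, derivative_monomial, aeval_monomial]
    have : (algebraMap (constants d) S) a = (a : S) := rfl
    simp [this, ha, Derivation.leibniz_pow]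
    ring

/-- A polynomial relation with constant coefficients for an element whose derivative is invertible
is trivial. -/
theorem eq_zero_of_aeval_constants {d : Derivation ℂ S S} {x : S} (hx : IsUnit (d x))
    {P : (constants d)[X]} (h : aeval x P = 0) : P = 0 := by
  -- Applying d to P(x) = 0 gives P'(x) · dx = 0, and the unit dx cancels.
  have h1 : ∀ k, aeval x (derivative^[k] P) = 0 := by
    intro k
    induction k with
    | zero => simpa using h
    | succ k ih =>
      rw [Function.iterate_succ_apply']
      have := derivation_aeval_constants d x (derivative^[k] P)
      rw [ih, map_zero] at this
      exact hx.mul_right_cancel (by rw [← this, zero_mul])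
  -- All Taylor coefficients of P at x vanish; factorials are invertible because S is a ℂ-algebra.
  have h2 : P.map (algebraMap (constants d) S) = 0 := by
    refine eq_zero_of_hasseDeriv_eq_zero _ x fun k => ?_
    have h3 := h1 k
    rw [aeval_def, ← eval_map, ← iterate_derivative_map, ← factorial_smul_hasseDeriv] at h3
    refine eq_of_natCast_mul_eq k.factorial k.factorial_ne_zero ?_
    simpa using h3
  exact Polynomial.map_injective _ Subtype.val_injective (by simpa using h2)

/-- As R is affine in t, R_ξ and g are polynomials of degree at most 1 and 2 in R, with coefficients
independent of t and denominators powers of R'. Hence `E` becomes a polynomial relation for R, whose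
constant term must vanish. The square in the conclusion is that of the constant term of 2 R'² g. -/
theorem affine_modulus_relation {dt dx : Derivation ℂ S S} (comm : ∀ f, dx (dt f) = dt (dx f))
    {R c g R' : S} (hR : dt R = R') (hR' : IsUnit R') (R'_t : dt R' = 0) (c_t : dt c = 0)
    (g_t : dt g = c * R' - dx R)
    (E : R ^ 2 * dx g - g * R * dx R
      = R' ^ 3 - 4 * R ^ 3 * R' + (c * R - g) * ((c * R' - dx R) * R - R' * g)) :
    4 * R' ^ 6 + (2 * R' ^ 2 * g - 2 * c * R' ^ 2 * R + 2 * (R' * dx R - dx R' * R) * R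
      + dx R' * R ^ 2) ^ 2 = 0 := by
  have Rx_t : dt (dx R) = dx R' := by rw [← comm, hR]
  have n_t : dt (dx R') = 0 := by rw [← comm, R'_t, map_zero]
  have r_t : dt (R' * dx R - dx R' * R) = 0 := by
    simp only [Derivation.leibniz, smul_eq_mul, map_sub, hR, Rx_t, n_t, R'_t]
    ring
  have g0_t : dt (2 * R' ^ 2 * g - 2 * c * R' ^ 2 * R + 2 * (R' * dx R - dx R' * R) * R
      + dx R' * R ^ 2) = 0 := by
    simp only [Derivation.leibniz, Derivation.leibniz_pow, smul_eq_mul, map_sub, map_add, hR, Rx_t,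
      n_t, R'_t, derivation_ofNat, c_t, g_t, nsmul_eq_mul, Nat.cast_ofNat, Nat.add_one_sub_one,
      pow_one]
    ring
  have dx_t : ∀ f, dt f = 0 → dt (dx f) = 0 := fun f hf => by rw [← comm, hf, map_zero]
  obtain ⟨a, ha⟩ : ∃ a : constants dt, (a : S) = R' := ⟨⟨R', R'_t⟩, rfl⟩
  obtain ⟨n, hn⟩ : ∃ a : constants dt, (a : S) = dx R' := ⟨⟨_, n_t⟩, rfl⟩
  obtain ⟨nx, hnx⟩ : ∃ a : constants dt, (a : S) = dx (dx R') := ⟨⟨_, dx_t _ n_t⟩, rfl⟩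
  obtain ⟨k, hk⟩ : ∃ a : constants dt, (a : S) = c := ⟨⟨_, c_t⟩, rfl⟩
  obtain ⟨kx, hkx⟩ : ∃ a : constants dt, (a : S) = dx c := ⟨⟨_, dx_t _ c_t⟩, rfl⟩
  obtain ⟨r, hr⟩ : ∃ a : constants dt, (a : S) = R' * dx R - dx R' * R := ⟨⟨_, r_t⟩, rfl⟩
  obtain ⟨rx, hrx⟩ : ∃ a : constants dt, (a : S) = dx (R' * dx R - dx R' * R) :=
    ⟨⟨_, dx_t _ r_t⟩, rfl⟩
  obtain ⟨b, hb⟩ : ∃ a : constants dt, (a : S) = (2 * R' ^ 2 * g - 2 * c * R' ^ 2 * R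
    + 2 * (R' * dx R - dx R' * R) * R + dx R' * R ^ 2) := ⟨⟨_, g0_t⟩, rfl⟩
  obtain ⟨bx, hbx⟩ : ∃ a : constants dt, (a : S) = dx (2 * R' ^ 2 * g - 2 * c * R' ^ 2 * R
    + 2 * (R' * dx R - dx R' * R) * R + dx R' * R ^ 2) := ⟨⟨_, dx_t _ g0_t⟩, rfl⟩
  -- At X = R, the polynomials `gp`, `rp` and `hp` take the values 2 R'² g, R' R_ξ and 2 R'³ g_ξ;
  -- `P` is `E` multiplied by 4 R'⁴.
  let gp : (constants dt)[X] := C b + 2 * C (k * a ^ 2 - r) * X - C n * X ^ 2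
  let rp : (constants dt)[X] := C r + C n * X
  let hp : (constants dt)[X] := C a * (C bx + 2 * C (kx * a ^ 2 + 2 * k * a * n - rx) * X
    - C nx * X ^ 2) + (2 * C (k * a ^ 2 - r) - 2 * C n * X) * rp - 2 * C n * gp
  let P : (constants dt)[X] := 2 * C a * hp * X ^ 2 - 2 * C a * gp * rp * X - 4 * C a ^ 7
    + 16 * C a ^ 5 * X ^ 3 - (2 * C (a ^ 2 * k) * X - gp)
      * (2 * C a * (C (k * a ^ 2) - rp) * X - C a * gp)
  have hP : aeval R P = 0 := by
    have co : ∀ f : constants dt, (algebraMap (constants dt) S) f = (f : S) := fun _ => rfl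
    simp only [P, gp, rp, hp, map_add, map_sub, map_mul, map_pow, aeval_C, aeval_X, map_ofNat, co,
      ha, hn, hnx, hk, hkx, hr, hrx, hb, hbx]
    simp only [Derivation.leibniz, Derivation.leibniz_pow, smul_eq_mul, map_sub, map_add,
      derivation_ofNat, nsmul_eq_mul, Nat.cast_ofNat, Nat.add_one_sub_one, pow_one]
    linear_combination 4 * R' ^ 4 * E
  -- The constant term of `P` is -a (4 a⁶ + b²), with a = R' invertible.
  have h0 := congrArg (fun Q => ((eval 0 Q : constants dt) : S))
    (eq_zero_of_aeval_constants (hR ▸ hR') hP)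
  simp [P, gp, rp, hp] at h0
  rw [ha, hb, show ((4 : constants dt) : S) = 4 from map_ofNat (algebraMap (constants dt) S) 4] at h0
  exact hR'.mul_left_cancel (by linear_combination -h0)

end Constants

/-! ### Constant length in t: vanishing of R_ξ -/

section SteadyRotation

open Polynomial

variable {S : Type*} [CommRing S] [Algebra ℂ S]

/-- The coefficient function in the `η`-derivative of the squared radius `R`. -/
theorem RotatingSystem.R_eta {dt dx de : Derivation ℂ S S} {al be rho s B c R G e : S}
    (h : RotatingSystem dt dx de al be rho s B c R 0 G e) :
    de R - de c * B = rho * (R * (-2 * G ^ 2 + 2 * c * G + 4 * R - c ^ 2)) + 2 * s * R * e := by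
  have al_t := h.al_t
  have B_t := h.B_t'
  have be_t := h.B_t'
  have G_t := h.G_t
  have ae := h.al_eta
  have bee := h.be_eta
  rw [h.B_t] at be_t
  have h1 := congrArg de h.c_eq
  have h2 := congrArg de h.R_eq
  have hc := h.c_eq
  have hR := h.R_eq
  simp only [Derivation.leibniz, Derivation.leibniz_pow, smul_eq_mul, map_add, map_sub,
      nsmul_eq_mul, map_neg, Nat.cast_ofNat, Nat.add_one_sub_one, pow_one, derivation_ofNat,
      al_t, B_t, be_t, h.G_t, h.s_t, h.rho_t, map_zero] at h1 h2 ae bee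
  rw [h2, ae]
  subst hR
  subst hc
  linear_combination (-B) * h1 + 2 * B * bee

theorem RotatingSystem.e_t {dt dx de : Derivation ℂ S S} {al be rho s B c R G e : S}
    (h : RotatingSystem dt dx de al be rho s B c R 0 G e) (hR : IsUnit R) : dt e = 0 := by
  have h1 := h.comm_tx R
  have R_t := h.R_t
  rw [mul_zero] at R_t
  rw [R_t, h.R_xi, map_zero] at h1
  simp only [Derivation.leibniz, smul_eq_mul, derivation_ofNat, R_t] at h1
  exact hR.mul_left_cancel (eq_of_two_mul_eq (by linear_combination -h1))

theorem RotatingSystem.e_xi {dt dx de : Derivation ℂ S S} {al be rho s B c R G e : S}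
    (h : RotatingSystem dt dx de al be rho s B c R 0 G e) (hR : IsUnit R) :
    dx e = 2 * e ^ 2 := by
  have h1 := h.comm_tx G
  rw [h.G_t, h.G_xi] at h1
  simp only [Derivation.leibniz, Derivation.leibniz_pow, smul_eq_mul, map_add, map_sub,
      nsmul_eq_mul, map_neg, Nat.cast_ofNat, Nat.add_one_sub_one, pow_one, derivation_ofNat,
      h.G_t, h.c_t, h.R_t, h.e_t hR, map_zero] at h1
  linear_combination -h1

/-- The relations `h5` and `h6` are linear in (al, B), with coefficients polynomial in G over the
constants of d. Cramer's rule gives D al = N₁ and D B = N₂ with deg D = 4 and deg N₁, deg N₂ ≤ 3.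
Then N₁² + N₂² = R D² at G, and since dG = -e is invertible this is an identity of polynomials; in
degree 8 it reads 0 = 18² R. -/
theorem eq_zero_of_quartic_system {d : Derivation ℂ S S} {R c e G al B : S} (R_t : d R = 0)
    (c_t : d c = 0) (e_t : d e = 0) (G_t : d G = -e) (he : IsUnit e) (hR : R = al ^ 2 + B ^ 2)
    (h5 : e * (6 * B + 6 * G - 2 * c) = al * (12 * R - 6 * G ^ 2 + 4 * c * G - c ^ 2))
    (h6 : 3 * e * al + B * (6 * R - 3 * G ^ 2 + c * G) = 2 * c * R - 3 * R * G) : R = 0 := by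
  obtain ⟨r, hr⟩ : ∃ a : constants d, (a : S) = R := ⟨⟨R, R_t⟩, rfl⟩
  obtain ⟨k, hk⟩ : ∃ a : constants d, (a : S) = c := ⟨⟨c, c_t⟩, rfl⟩
  obtain ⟨n, hn⟩ : ∃ a : constants d, (a : S) = e := ⟨⟨e, e_t⟩, rfl⟩
  let Y : (constants d)[X] := C (-6) * X ^ 2 + C (4 * k) * X + C (12 * r - k ^ 2)
  let Z : (constants d)[X] := C (-3) * X ^ 2 + C k * X + C (6 * r)
  let L : (constants d)[X] := C 6 * X + C (-2 * k)
  let M : (constants d)[X] := C (-3 * r) * X + C (2 * k * r)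
  let D : (constants d)[X] := Y * Z + C (18 * n ^ 2)
  let N₁ : (constants d)[X] := C n * (L * Z + C 6 * M)
  let N₂ : (constants d)[X] := Y * M - C (3 * n ^ 2) * L
  have dY : Y.natDegree ≤ 2 := by simp only [Y]; compute_degree
  have dZ : Z.natDegree ≤ 2 := by simp only [Z]; compute_degree
  have dL : L.natDegree ≤ 1 := by simp only [L]; compute_degree
  have dM : M.natDegree ≤ 1 := by simp only [M]; compute_degree
  have dYZ : (Y * Z).natDegree ≤ 4 := natDegree_mul_le_of_le dY dZ
  have dD : D.natDegree ≤ 4 := natDegree_add_le_of_degree_le dYZ ((natDegree_C _).le.trans (by norm_num))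
  have dN₁ : N₁.natDegree ≤ 3 := by
    refine (natDegree_C_mul_le _ _).trans (natDegree_add_le_of_degree_le
      (natDegree_mul_le_of_le dL dZ) ((natDegree_C_mul_le _ _).trans (dM.trans (by norm_num))))
  have dN₂ : N₂.natDegree ≤ 3 := by
    refine (natDegree_sub_le_of_le (natDegree_mul_le_of_le dY dM)
      ((natDegree_C_mul_le _ _).trans dL)).trans (by norm_num)
  have cD : D.coeff 4 = 18 := by
    have h1 : Y.coeff 2 = -6 := by
      simp only [Y, coeff_add, coeff_C_mul, coeff_X_pow, coeff_X, coeff_C]; norm_num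
    have h2 : Z.coeff 2 = -3 := by
      simp only [Z, coeff_add, coeff_C_mul, coeff_X_pow, coeff_X, coeff_C]; norm_num
    have h3 := coeff_mul_add_eq_of_natDegree_le dY dZ
    simp only [Nat.reduceAdd, h1, h2] at h3
    simp only [D, coeff_add, h3, coeff_C]
    norm_num
  have hP : aeval G (N₁ ^ 2 + N₂ ^ 2 - C r * D ^ 2) = 0 := by
    have co : ∀ f : constants d, (algebraMap (constants d) S) f = (f : S) := fun _ => rfl
    have hD : aeval G D * al = aeval G N₁ := by
      simp only [D, N₁, Y, Z, L, M, map_add, map_sub, map_mul, map_pow, map_neg, aeval_C, aeval_X,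
        map_ofNat, co, hr, hk, hn]
      linear_combination (-(6 * R - 3 * G ^ 2 + c * G)) * h5 + 6 * e * h6
    have hD' : aeval G D * B = aeval G N₂ := by
      simp only [D, N₂, Y, Z, L, M, map_add, map_sub, map_mul, map_pow, map_neg, aeval_C, aeval_X,
        map_ofNat, co, hr, hk, hn]
      linear_combination 3 * e * h5 + (12 * R - 6 * G ^ 2 + 4 * c * G - c ^ 2) * h6
    rw [map_sub, map_add, map_mul, map_pow, map_pow, map_pow, ← hD, ← hD', aeval_C, co, hr, hR]
    ring
  have h0 := congrArg (fun Q => Q.coeff 8)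
    (eq_zero_of_aeval_constants (d := d) (by rw [G_t]; exact he.neg) hP)
  have z₁ : (N₁ ^ 2).coeff 8 = 0 :=
    coeff_eq_zero_of_natDegree_lt ((natDegree_pow_le_of_le 2 dN₁).trans_lt (by norm_num))
  have z₂ : (N₂ ^ 2).coeff 8 = 0 :=
    coeff_eq_zero_of_natDegree_lt ((natDegree_pow_le_of_le 2 dN₂).trans_lt (by norm_num))
  have z₃ : (D ^ 2).coeff 8 = 18 ^ 2 := by
    rw [← cD]; exact coeff_pow_of_natDegree_le dD
  simp only [coeff_sub, coeff_add, coeff_C_mul, z₁, z₂, z₃, coeff_zero] at h0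
  have h9 := congrArg (algebraMap (constants d) S) h0
  have co : algebraMap (constants d) S r = R := hr
  simp only [map_sub, map_mul, map_pow, map_ofNat, map_zero, map_add, co] at h9
  refine eq_of_natCast_mul_eq 324 (by norm_num) ?_
  push_cast
  linear_combination -h9

/-- The formula for R_η is differentiated in t and ξ until the unknown η-derivatives and s are
eliminated. The two relations that remain between al, B and G force R = 0. As R is a unit, this says
that e can be invertible only in the zero ring. -/
theorem RotatingSystem.eq_zero_of_isUnit_e {dt dx de : Derivation ℂ S S}
    {al be rho s B c R G e : S} (h : RotatingSystem dt dx de al be rho s B c R 0 G e)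
    (hrho : IsUnit rho) (hR : IsUnit R) (he : IsUnit e) : R = 0 := by
  have R_t := h.R_t
  have c_xi := h.c_xi
  have al_t := h.al_t
  have B_t := h.B_t'
  have be_t := h.B_t'
  rw [h.B_t] at be_t
  have G_t := h.G_t
  have e_t := h.e_t hR
  have e_xi := h.e_xi hR
  have H0 := h.R_eta
  rw [mul_zero] at R_t c_xi
  simp only [mul_zero, zero_add, zero_sub, zero_mul, sub_zero] at G_t al_t B_t be_t
  have Re_t : dt (de R) = 0 := by rw [← h.comm_te, R_t, map_zero]
  have ce_t : dt (de c) = 0 := by rw [← h.comm_te, h.c_t, map_zero]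
  have ee_t : dt (de e) = 0 := by rw [← h.comm_te, e_t, map_zero]
  have ce_x : dx (de c) = 0 := by rw [← h.comm_xe, c_xi, map_zero]
  have Re_x : dx (de R) = 2 * de R * e + 2 * R * de e := by
    rw [← h.comm_xe, h.R_xi]
    simp only [Derivation.leibniz, smul_eq_mul, derivation_ofNat]
    ring
  -- The t-derivative of `H0`: R_η, c_η and e do not depend on t, and s_t = 2 rho B removes s.
  have H1 : R * e * rho * (4 * B + 4 * G - 2 * c)
      = al * (2 * rho * (R * (-2 * G ^ 2 + 2 * c * G + 4 * R - c ^ 2)) - de c * (G - 2 * B)) := by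
    have h1 := congrArg dt H0
    simp only [Derivation.leibniz, Derivation.leibniz_pow, smul_eq_mul, map_add, map_sub,
      nsmul_eq_mul, map_neg, Nat.cast_ofNat, Nat.add_one_sub_one, pow_one, derivation_ofNat,
      al_t, B_t, be_t, h.c_t, R_t, G_t, e_t, Re_t, ce_t, h.s_t, h.rho_t] at h1
    linear_combination -h1
  have hc := h.c_eq
  -- The ξ-derivative of `H0`, reduced by `H0` and `H1`; its left-hand side is independent of t, so
  -- another t-derivative leaves only c_η.
  have H2 : 2 * e * de R - 2 * de e * R = e * (3 * de c * B + 2 * rho * R * c * (G - c)) := by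
    have h1 := congrArg dx H0
    simp only [Derivation.leibniz, Derivation.leibniz_pow, smul_eq_mul, map_add, map_sub,
      nsmul_eq_mul, map_neg, Nat.cast_ofNat, Nat.add_one_sub_one, pow_one, derivation_ofNat,
      al_t, B_t, be_t, h.c_t, R_t, G_t, e_t, Re_x, ce_x, h.s_xi, h.rho_xi, h.R_xi, e_xi, h.G_xi,
      h.B_xi, c_xi] at h1
    subst hc
    linear_combination -h1 + 4 * e * H0 + (G - 2 * (B - be)) * H1
  have H3 : 3 * de c * al * (G - 2 * B) = 2 * rho * R * c * (2 * al * (G - c) + e) := by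
    have h1 := congrArg dt H2
    simp only [Derivation.leibniz, Derivation.leibniz_pow, smul_eq_mul, map_add, map_sub,
      nsmul_eq_mul, map_neg, Nat.cast_ofNat, Nat.add_one_sub_one, pow_one, derivation_ofNat,
      al_t, B_t, be_t, h.c_t, R_t, G_t, e_t, Re_t, ce_t, ee_t, h.s_t, h.rho_t] at h1
    exact he.mul_left_cancel (by linear_combination -h1)
  -- Elimination of c_η between `H1` and `H3`; the common factor rho R is then cancelled.
  have H5 : e * (6 * B + 6 * G - 2 * c)
      = al * (12 * R - 6 * G ^ 2 + 4 * c * G - c ^ 2) := by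
    refine hrho.mul_left_cancel (hR.mul_left_cancel (eq_of_two_mul_eq ?_))
    linear_combination 3 * H1 - H3
  refine eq_zero_of_quartic_system R_t h.c_t e_t G_t he h.R_eq H5 ?_
  -- The t-derivative of `H5` supplies the second linear relation for (al, B).
  have h1 := congrArg dt H5
  simp only [Derivation.leibniz, Derivation.leibniz_pow, smul_eq_mul, map_add, map_sub,
    nsmul_eq_mul, map_neg, Nat.cast_ofNat, Nat.add_one_sub_one, pow_one, derivation_ofNat,
    al_t, B_t, be_t, h.c_t, R_t, G_t, e_t] at h1
  have hR' := h.R_eq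
  subst hR'
  refine he.mul_left_cancel (eq_of_two_mul_eq ?_)
  linear_combination (-al) * h1 - B * (G - 2 * B) * H5

end SteadyRotation

/-! ### Constant R and G in t and ξ: constant coefficients -/

section UniformRotation

variable {S : Type*} [CommRing S] [Algebra ℂ S]

/-- The linear equation of second order in `t` satisfied by `z_tt`, in real form, has constant
coefficients. -/
theorem RotatingSystem.constant_coefficients {dt dx de : Derivation ℂ S S}
    {al be rho s B c R G k K : S} (h : RotatingSystem dt dx de al be rho s B c R 0 G 0)
    (hR : IsUnit R) (hG : IsUnit (G - 2 * B)) (hk : 2 * k = G - c)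
    (hK : 4 * K = 4 * R - 2 * c * G + c ^ 2) :
    (dt al + al ^ 2 - be ^ 2 = K - 2 * k * be ∧ dt be + 2 * al * be = 2 * k * al) ∧
    (dt k = 0 ∧ dx k = 0 ∧ de k = 0) ∧ (dt K = 0 ∧ dx K = 0 ∧ de K = 0) := by
  have R_t := h.R_t
  have R_xi := h.R_xi
  have c_xi := h.c_xi
  have al_t := h.al_t
  have B_t := h.B_t'
  have be_t := h.B_t'
  rw [h.B_t] at be_t
  have G_t := h.G_t
  have G_xi := h.G_xi
  rw [mul_zero] at R_t R_xi c_xi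
  simp only [mul_zero, zero_add, zero_sub, zero_mul, sub_zero, neg_zero] at G_t al_t B_t be_t
  have G_xi' : dx G = 0 := by rw [G_xi]; ring
  have hc := h.c_eq
  have hR' := h.R_eq
  have eq2 : dt be + 2 * al * be = 2 * k * al := by
    rw [be_t]; linear_combination al * hc - al * hk
  have eq1 : dt al + al ^ 2 - be ^ 2 = K - 2 * k * be := by
    refine eq_of_natCast_mul_eq 4 (by norm_num) ?_
    push_cast
    rw [al_t]
    linear_combination -hK - 4 * hR' + 4 * be * hk + (2 * G - c - 2 * B - 2 * be) * hc
  have k_t : dt k = 0 := by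
    have h1 := congrArg dt hk
    simp only [Derivation.leibniz, smul_eq_mul, map_sub, derivation_ofNat, G_t, h.c_t] at h1
    exact eq_of_two_mul_eq (by linear_combination h1)
  have k_x : dx k = 0 := by
    have h1 := congrArg dx hk
    simp only [Derivation.leibniz, smul_eq_mul, map_sub, derivation_ofNat, G_xi', c_xi] at h1
    exact eq_of_two_mul_eq (by linear_combination h1)
  have K_t : dt K = 0 := by
    have h1 := congrArg dt hK
    simp only [Derivation.leibniz, Derivation.leibniz_pow, smul_eq_mul, map_sub, map_add,
      derivation_ofNat, G_t, h.c_t, R_t, smul_zero, mul_zero] at h1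
    exact eq_of_natCast_mul_eq 4 (by norm_num) (by push_cast; linear_combination h1)
  have K_x : dx K = 0 := by
    have h1 := congrArg dx hK
    simp only [Derivation.leibniz, Derivation.leibniz_pow, smul_eq_mul, map_sub, map_add,
      derivation_ofNat, G_xi', c_xi, R_xi, smul_zero, mul_zero] at h1
    exact eq_of_natCast_mul_eq 4 (by norm_num) (by push_cast; linear_combination h1)
  have al_t' : dt al = K - 2 * k * be - al ^ 2 + be ^ 2 := by linear_combination eq1
  have be_t' : dt be = 2 * k * al - 2 * al * be := by linear_combination eq2
  have B_t' : dt B = 2 * k * al - 2 * al * be := by rw [h.B_t, be_t']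
  have ae := h.al_eta
  have bee := h.be_eta
  have kk_t : dt (de k) = 0 := by rw [← h.comm_te, k_t, map_zero]
  have KK_t : dt (de K) = 0 := by rw [← h.comm_te, K_t, map_zero]
  have cc_t : dt (de c) = 0 := by rw [← h.comm_te, h.c_t, map_zero]
  -- It remains to treat η: the commutation of ∂_η and ∂_t on al and be is expanded with the linear
  -- equation.
  have ate := h.comm_te al
  have bte := h.comm_te be
  rw [al_t'] at ate
  rw [be_t'] at bte
  simp only [Derivation.leibniz, Derivation.leibniz_pow, smul_eq_mul, map_add, map_sub,
      nsmul_eq_mul, map_neg, Nat.cast_ofNat, Nat.add_one_sub_one, pow_one, derivation_ofNat,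
      map_zero, al_t', B_t', be_t', k_t, K_t, h.s_t, h.rho_t] at ae bee
  have ae_t := congrArg dt ae
  have bee_t := congrArg dt bee
  simp only [Derivation.leibniz, Derivation.leibniz_pow, smul_eq_mul, map_add, map_sub,
      nsmul_eq_mul, map_neg, Nat.cast_ofNat, Nat.add_one_sub_one, pow_one, derivation_ofNat,
      map_zero, al_t', B_t', be_t', k_t, K_t, h.s_t, h.rho_t] at ate bte ae_t bee_t
  -- Two expressions for al_t, one from the linear equation and one from the rotation, agree. Modulo
  -- this relation the commutation conditions collapse to K_η = 2 k_η be and k_η al = 0.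
  have rel : al ^ 2 - be ^ 2 + 2 * B * be - 2 * B * k + 2 * k * be - K = 0 := by
    linear_combination eq1 - al_t - B * hk + B * hc
  rw [ae_t, ae, bee] at ate
  rw [bee_t, ae, bee] at bte
  have r1 : de K = 2 * de k * be := by
    linear_combination ate + rho * (6 * K - 24 * al ^ 2 + 8 * be ^ 2 - 12 * k * be) * rel
  have r2 : de k * al = 0 := by
    refine eq_of_two_mul_eq ?_
    linear_combination bte + al * rho * (16 * be - 4 * k) * rel
  -- As k_η and K_η are independent of t, differentiating these two relations in t gives k_η be_t =
  -- k_η al_t = 0. Here (al_t, be_t) is (-B, al) times G - 2B, so R (G - 2B) k_η = 0.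
  have k_e : de k = 0 := by
    have h1 := congrArg dt r1
    have h2 := congrArg dt r2
    simp only [Derivation.leibniz, smul_eq_mul, derivation_ofNat, kk_t, KK_t, al_t, be_t, map_zero] at h1 h2
    refine (hR.mul hG).mul_left_cancel (eq_of_two_mul_eq ?_)
    rw [hR']
    linear_combination -2 * B * h2 - al * h1
  exact ⟨⟨eq1, eq2⟩, ⟨k_t, k_x, k_e⟩, K_t, K_x, by rw [r1, k_e]; ring⟩

end UniformRotation

/-! ### The differential algebra of smooth functions on an open set -/

section SmoothFunctions

open TopologicalSpace

/-- The algebra of smooth complex-valued functions on an open subset of `Pt`. -/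
def smoothFunctions (O : Opens Pt) : Subalgebra ℂ (O → ℂ) where
  carrier := {f | ∃ F : Pt → ℂ, ContDiffOn ℝ ∞ F O ∧ ∀ x : O, f x = F x}
  mul_mem' := by
    rintro f g ⟨F, hF, hf⟩ ⟨G, hG, hg⟩
    exact ⟨fun x => F x * G x, hF.mul hG, fun x => by simp [hf, hg]⟩
  add_mem' := by
    rintro f g ⟨F, hF, hf⟩ ⟨G, hG, hg⟩
    exact ⟨fun x => F x + G x, hF.add hG, fun x => by simp [hf, hg]⟩
  algebraMap_mem' r := ⟨fun _ => r, contDiffOn_const, fun x => by simp⟩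

variable {O : Opens Pt}

/-- The restriction of a smooth function to `O`. -/
def smoothMk (F : Pt → ℂ) (hF : ContDiffOn ℝ ∞ F O) : smoothFunctions O :=
  ⟨fun x => F x, F, hF, fun _ => rfl⟩

@[simp]
theorem smoothMk_apply (F : Pt → ℂ) (hF : ContDiffOn ℝ ∞ F O) (x : O) :
    (smoothMk F hF : O → ℂ) x = F x := rfl

theorem smooth_ext {f g : smoothFunctions O} (h : ∀ x : O, (f : O → ℂ) x = (g : O → ℂ) x) :
    f = g := Subtype.ext (funext h)

theorem smooth_congr {f g : smoothFunctions O} (h : f = g) (x : O) :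
    (f : O → ℂ) x = (g : O → ℂ) x := by rw [h]

theorem exists_smoothMk (f : smoothFunctions O) : ∃ F, ∃ hF : ContDiffOn ℝ ∞ F O, f = smoothMk F hF := by
  obtain ⟨f, F, hF, hf⟩ := f
  exact ⟨F, hF, smooth_ext hf⟩

/-- Extension of a function on `O` by zero. -/
noncomputable def extendZero (f : O → ℂ) : Pt → ℂ := Function.extend Subtype.val f 0

theorem extendZero_apply (f : O → ℂ) (x : O) : extendZero f x = f x :=
  Subtype.val_injective.extend_apply f 0 x

theorem contDiffOn_extendZero (f : smoothFunctions O) : ContDiffOn ℝ ∞ (extendZero (f : O → ℂ)) O := by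
  obtain ⟨F, hF, rfl⟩ := exists_smoothMk f
  exact hF.congr fun x hx => extendZero_apply _ ⟨x, hx⟩

theorem contDiffOn_partial {F : Pt → ℂ} {s : Set Pt} (hs : IsOpen s) (hF : ContDiffOn ℝ ∞ F s)
    (e : Pt) : ContDiffOn ℝ ∞ (fun p => fderiv ℝ F p e) s :=
  (hF.fderiv_of_isOpen hs (m := ∞) (by simp)).clm_apply contDiffOn_const

theorem differentiableAt_of_contDiffOn {F : Pt → ℂ} {s : Set Pt} (hs : IsOpen s)
    (hF : ContDiffOn ℝ ∞ F s) {x : Pt} (hx : x ∈ s) : DifferentiableAt ℝ F x :=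
  (hF.differentiableOn (by simp)).differentiableAt (hs.mem_nhds hx)

/-- The `i`-th partial derivative, as a derivation. -/
noncomputable def pd (O : Opens Pt) (i : Fin 3) :
    Derivation ℂ (smoothFunctions O) (smoothFunctions O) :=
  Derivation.mk'
    { toFun := fun f => smoothMk (fun p => fderiv ℝ (extendZero (f : O → ℂ)) p (Pi.single i 1))
        (contDiffOn_partial O.isOpen (contDiffOn_extendZero f) _)
      map_add' := fun f g => smooth_ext fun x => by
        have h : extendZero ((f : O → ℂ) + (g : O → ℂ)) =
            extendZero (f : O → ℂ) + extendZero (g : O → ℂ) := by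
          rw [extendZero, extendZero, extendZero, ← Function.extend_add]
          simp
        have hf := differentiableAt_of_contDiffOn O.isOpen (contDiffOn_extendZero f) x.2
        have hg := differentiableAt_of_contDiffOn O.isOpen (contDiffOn_extendZero g) x.2
        simp [h, fderiv_add hf hg]
      map_smul' := fun c f => smooth_ext fun x => by
        have h : extendZero (c • (f : O → ℂ)) =
            c • extendZero (f : O → ℂ) := by
          rw [extendZero, extendZero, ← Function.extend_smul]
          simp
        have hf := differentiableAt_of_contDiffOn O.isOpen (contDiffOn_extendZero f) x.2
        simp [h, fderiv_const_smul hf] }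
    (fun f g => smooth_ext fun x => by
      have h : extendZero ((f : O → ℂ) * (g : O → ℂ)) =
          extendZero (f : O → ℂ) * extendZero (g : O → ℂ) := by
        rw [extendZero, extendZero, extendZero, ← Function.extend_mul]
        simp
      have hf := differentiableAt_of_contDiffOn O.isOpen (contDiffOn_extendZero f) x.2
      have hg := differentiableAt_of_contDiffOn O.isOpen (contDiffOn_extendZero g) x.2
      simp [h, fderiv_mul hf hg, extendZero_apply])

theorem pd_smoothMk (i : Fin 3) (F : Pt → ℂ) (hF : ContDiffOn ℝ ∞ F O) :
    pd O i (smoothMk F hF) = smoothMk (fun p => fderiv ℝ F p (Pi.single i 1))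
      (contDiffOn_partial O.isOpen hF _) := by
  refine smooth_ext fun x => ?_
  have h : extendZero ((smoothMk F hF : smoothFunctions O) : O → ℂ) =ᶠ[𝓝 (x : Pt)] F := by
    filter_upwards [O.isOpen.mem_nhds x.2] with y hy
    exact extendZero_apply _ ⟨y, hy⟩
  change fderiv ℝ (extendZero _) (x : Pt) (Pi.single i 1) = _
  rw [h.fderiv_eq]
  rfl

theorem pd_comm (i k : Fin 3) (f : smoothFunctions O) : pd O i (pd O k f) = pd O k (pd O i f) := by
  obtain ⟨F, hF, rfl⟩ := exists_smoothMk f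
  rw [pd_smoothMk, pd_smoothMk, pd_smoothMk, pd_smoothMk]
  refine smooth_ext fun x => ?_
  have hx := O.isOpen.mem_nhds x.2
  have hd : DifferentiableAt ℝ (fderiv ℝ F) (x : Pt) :=
    ((hF.fderiv_of_isOpen O.isOpen (m := ∞) (by simp)).differentiableOn (by simp)).differentiableAt hx
  have hs : IsSymmSndFDerivAt ℝ F (x : Pt) :=
    (hF.contDiffAt hx).isSymmSndFDerivAt (by
      rw [minSmoothness_of_isRCLikeNormedField]
      exact WithTop.coe_le_coe.mpr (le_top : (2 : ℕ∞) ≤ ⊤))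
  simp only [smoothMk_apply]
  rw [fderiv_clm_apply hd (differentiableAt_const _), fderiv_clm_apply hd (differentiableAt_const _)]
  simpa using hs (Pi.single i 1) (Pi.single k 1)

theorem contDiffOn_conj {F : Pt → ℂ} {s : Set Pt} (hF : ContDiffOn ℝ ∞ F s) :
    ContDiffOn ℝ ∞ (fun x => (starRingEnd ℂ) (F x)) s :=
  Complex.conjCLE.contDiff.comp_contDiffOn hF

theorem fderiv_conj (F : Pt → ℂ) (x e : Pt) :
    fderiv ℝ (fun x => (starRingEnd ℂ) (F x)) x e = (starRingEnd ℂ) (fderiv ℝ F x e) :=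
  congrArg (fun L => L e) ((Complex.conjCLE : ℂ ≃L[ℝ] ℂ).comp_fderiv (f := F) (x := x))

/-- Complex conjugation of smooth functions. -/
noncomputable def smoothConj (O : Opens Pt) : smoothFunctions O →+* smoothFunctions O where
  toFun f := smoothMk (fun x => (starRingEnd ℂ) (extendZero (f : O → ℂ) x))
    (contDiffOn_conj (contDiffOn_extendZero f))
  map_one' := smooth_ext fun x => by simp [extendZero_apply]
  map_zero' := smooth_ext fun x => by simp [extendZero_apply]
  map_mul' f g := smooth_ext fun x => by simp [extendZero_apply]
  map_add' f g := smooth_ext fun x => by simp [extendZero_apply]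

@[simp]
theorem smoothConj_apply (f : smoothFunctions O) (x : O) :
    (smoothConj O f : O → ℂ) x = (starRingEnd ℂ) ((f : O → ℂ) x) := by
  simp [smoothConj, extendZero_apply]

theorem smoothConj_smoothConj (f : smoothFunctions O) : smoothConj O (smoothConj O f) = f :=
  smooth_ext fun x => by simp

theorem smoothConj_smul (c : ℂ) (f : smoothFunctions O) :
    smoothConj O (c • f) = (starRingEnd ℂ) c • smoothConj O f :=
  smooth_ext fun x => by simp

theorem pd_smoothConj (i : Fin 3) (f : smoothFunctions O) :
    pd O i (smoothConj O f) = smoothConj O (pd O i f) := by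
  obtain ⟨F, hF, rfl⟩ := exists_smoothMk f
  have h : smoothConj O (smoothMk F hF) = smoothMk (fun x => (starRingEnd ℂ) (F x))
      (contDiffOn_conj hF) := smooth_ext fun x => by simp
  rw [h, pd_smoothMk, pd_smoothMk]
  refine smooth_ext fun x => ?_
  simp only [smoothConj_apply, smoothMk_apply, fderiv_conj]

/-- Restriction of smooth functions to a smaller open set. -/
def smoothRestrict {O' O : Opens Pt} (h : O' ≤ O) : smoothFunctions O →+* smoothFunctions O' where
  toFun f := ⟨fun x => (f : O → ℂ) ⟨x, h x.2⟩, by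
    obtain ⟨F, hF, rfl⟩ := exists_smoothMk f
    exact ⟨F, hF.mono h, fun x => rfl⟩⟩
  map_one' := rfl
  map_zero' := rfl
  map_mul' _ _ := rfl
  map_add' _ _ := rfl

@[simp]
theorem smoothRestrict_apply {O' O : Opens Pt} (h : O' ≤ O) (f : smoothFunctions O) (x : O') :
    (smoothRestrict h f : O' → ℂ) x = (f : O → ℂ) ⟨x, h x.2⟩ := rfl

theorem pd_smoothRestrict {O' O : Opens Pt} (h : O' ≤ O) (i : Fin 3) (f : smoothFunctions O) :
    pd O' i (smoothRestrict h f) = smoothRestrict h (pd O i f) := by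
  obtain ⟨F, hF, rfl⟩ := exists_smoothMk f
  have h' : smoothRestrict h (smoothMk F hF) = smoothMk F (hF.mono h) := rfl
  rw [h', pd_smoothMk, pd_smoothMk]
  rfl

theorem isUnit_smooth {f : smoothFunctions O} (h : ∀ x : O, (f : O → ℂ) x ≠ 0) : IsUnit f := by
  have hF := contDiffOn_extendZero f
  refine IsUnit.of_mul_eq_one (smoothMk (fun x => (extendZero (f : O → ℂ) x)⁻¹) (hF.inv fun x hx => ?_))
    (smooth_ext fun x => ?_)
  · rw [extendZero_apply _ ⟨x, hx⟩]
    exact h _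
  · simp [extendZero_apply, h x]

/-- The open set on which a smooth function does not vanish. -/
def smoothSupport (f : smoothFunctions O) : Opens Pt :=
  ⟨{x | x ∈ O ∧ extendZero (f : O → ℂ) x ≠ 0}, by
    have := (contDiffOn_extendZero f).continuousOn.isOpen_inter_preimage O.isOpen
      (isOpen_compl_singleton (x := (0 : ℂ)))
    exact this⟩

theorem smoothSupport_le (f : smoothFunctions O) : smoothSupport f ≤ O := fun _ hx => hx.1

theorem isUnit_smoothRestrict_smoothSupport (f : smoothFunctions O) :
    IsUnit (smoothRestrict (smoothSupport_le f) f) :=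
  isUnit_smooth fun x => by
    have := x.2.2
    rwa [extendZero_apply (f : O → ℂ) ⟨x, x.2.1⟩] at this

theorem mem_smoothSupport {f : smoothFunctions O} {x : O} (h : (f : O → ℂ) x ≠ 0) :
    (x : Pt) ∈ smoothSupport f := ⟨x.2, by rwa [extendZero_apply]⟩

end SmoothFunctions

/-! ### Polar form of a smooth solution -/

section Setup

open TopologicalSpace

theorem PolarSystem.map {S S' : Type*} [CommRing S] [Algebra ℂ S] [CommRing S'] [Algebra ℂ S']
    {dt dx de : Derivation ℂ S S} {dt' dx' de' : Derivation ℂ S' S'} {al be rho s B : S}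
    (h : PolarSystem dt dx de al be rho s B) (φ : S →+* S') (ht : ∀ f, dt' (φ f) = φ (dt f))
    (hx : ∀ f, dx' (φ f) = φ (dx f)) (he : ∀ f, de' (φ f) = φ (de f))
    (comm_tx : ∀ f, dx' (dt' f) = dt' (dx' f)) (comm_te : ∀ f, de' (dt' f) = dt' (de' f))
    (comm_xe : ∀ f, de' (dx' f) = dx' (de' f)) :
    PolarSystem dt' dx' de' (φ al) (φ be) (φ rho) (φ s) (φ B) := by
  refine ⟨comm_tx, comm_te, comm_xe, ?_, ?_, ?_, ?_, ?_, ?_, ?_, ?_, ?_⟩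
  · rw [ht, h.rho_t]; simp only [map_mul, map_neg, map_ofNat]
  · rw [ht, h.s_t]; simp only [map_mul, map_ofNat]
  · rw [ht, ht, h.B_t]
  · rw [hx, h.al_xi, map_neg, ← ht]
    simp only [map_add, map_mul, map_ofNat, ht]
  · rw [hx, h.be_xi, ← ht]
    simp only [map_add, map_sub, map_pow, ht]
  · rw [hx, h.rho_xi]; simp only [map_add, map_mul, map_ofNat, ht]
  · rw [hx, h.s_xi]; simp only [map_sub, map_mul, map_ofNat, ht]
  · rw [he, h.al_eta, ← ht]
    simp only [map_add, map_sub, map_neg, map_mul, map_pow, map_ofNat, ht]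
  · rw [he, h.be_eta, ← ht]
    simp only [map_add, map_sub, map_neg, map_mul, map_pow, map_ofNat, ht]

variable {O : Opens Pt}

theorem PolarSystem.restrict {al be rho s B : smoothFunctions O}
    (h : PolarSystem (pd O 0) (pd O 1) (pd O 2) al be rho s B) {O' : Opens Pt} (hO : O' ≤ O) :
    PolarSystem (pd O' 0) (pd O' 1) (pd O' 2) (smoothRestrict hO al) (smoothRestrict hO be)
      (smoothRestrict hO rho) (smoothRestrict hO s) (smoothRestrict hO B) :=
  h.map _ (pd_smoothRestrict hO 0) (pd_smoothRestrict hO 1) (pd_smoothRestrict hO 2)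
    (pd_comm 1 0) (pd_comm 2 0) (pd_comm 2 1)

/-- The imaginary unit as a constant function. -/
noncomputable def smoothI (O : Opens Pt) : smoothFunctions O := algebraMap ℂ _ Complex.I

@[simp]
theorem smoothI_apply (x : O) : (smoothI O : O → ℂ) x = Complex.I := rfl

theorem smoothI_mul_self : smoothI O * smoothI O = -1 :=
  smooth_ext fun x => by simp

theorem pd_smoothI (i : Fin 3) : pd O i (smoothI O) = 0 := (pd O i).map_algebraMap _

/-- A partial derivative of a function on `Pt`. -/
noncomputable def partialD (i : Fin 3) (f : Pt → ℂ) : Pt → ℂ :=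
  fun p => fderiv ℝ f p (Pi.single i 1)

theorem partialD_conjFun (i : Fin 3) (f : Pt → ℂ) :
    partialD i (conjFun f) = conjFun (partialD i f) := funext fun x => fderiv_conj f x _

theorem contDiffOn_partialD {f : Pt → ℂ} {s : Set Pt} (hs : IsOpen s) (hf : ContDiffOn ℝ ∞ f s)
    (i : Fin 3) : ContDiffOn ℝ ∞ (partialD i f) s := contDiffOn_partial hs hf _

@[simp]
theorem smooth_ofNat_apply (n : ℕ) [n.AtLeastTwo] (x : O) :
    ((ofNat(n) : smoothFunctions O) : O → ℂ) x = ofNat(n) := rfl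

theorem eq_half_add_I_mul (w w' : ℂ) :
    w = 1 / 2 * (w + w') + Complex.I * (-(Complex.I / 2) * (w - w')) := by
  linear_combination ((w - w') / 2) * Complex.I_mul_I

theorem eq_half_sub_I_mul (w w' : ℂ) :
    w' = 1 / 2 * (w + w') - Complex.I * (-(Complex.I / 2) * (w - w')) := by
  linear_combination (-(w - w') / 2) * Complex.I_mul_I

theorem eq_neg_add_I_mul {w w' t : ℂ} (h : w + w' = -2 * t) :
    w = -t + Complex.I * (-(Complex.I / 2) * (w - w')) := by
  linear_combination h / 2 + ((w - w') / 2) * Complex.I_mul_I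

theorem eq_neg_sub_I_mul {w w' t : ℂ} (h : w + w' = -2 * t) :
    w' = -t - Complex.I * (-(Complex.I / 2) * (w - w')) := by
  linear_combination h / 2 - ((w - w') / 2) * Complex.I_mul_I

/-- The polar form of a solution, with real coefficients. -/
structure PolarForm (O : Opens Pt) (z : smoothFunctions O) (al be rho s B : smoothFunctions O) :
    Prop where
  al_real : smoothConj O al = al
  be_real : smoothConj O be = be
  B_real : smoothConj O B = B
  rho_eq : pd O 0 (pd O 0 z) * smoothConj O (pd O 0 (pd O 0 z)) * rho = 1
  u_t : pd O 0 (pd O 0 (pd O 0 z)) = pd O 0 (pd O 0 z) * (al + smoothI O * be)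
  p_eq : pd O 2 z = pd O 0 (pd O 0 z) * (-rho + smoothI O * s)
  system : PolarSystem (pd O 0) (pd O 1) (pd O 2) al be rho s B

/-- Real and imaginary parts of u_t/u and z_η/u. By the second equation, the sum of z_η/u and its
conjugate is -2/(u ū), whence rho = 1/(u ū). -/
theorem exists_polarForm (z : smoothFunctions O)
    (h₁ : pd O 1 z = smoothI O * pd O 0 (pd O 0 z))
    (h₂ : pd O 0 (pd O 0 z) * smoothConj O (pd O 2 z)
      + smoothConj O (pd O 0 (pd O 0 z)) * pd O 2 z = -2) :
    ∃ al be rho s B, PolarForm O z al be rho s B := by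
  set j := smoothI O with hj
  set u := pd O 0 (pd O 0 z) with hu
  set v := smoothConj O u with hv
  set p := pd O 2 z with hp
  set r := smoothConj O p with hr
  have jj : j * j = -1 := smoothI_mul_self
  have hI : ∀ i, pd O i j = 0 := pd_smoothI
  have c2 : (starRingEnd ℂ) 2 = 2 := map_ofNat _ 2
  have cj : smoothConj O j = -j := smooth_ext fun x => by simp [hj]
  have u_ne : ∀ x : O, (u : O → ℂ) x ≠ 0 := fun x hx => by
    have := smooth_congr h₂ x
    simp [hv, hx] at this
  obtain ⟨ui, hui⟩ := (isUnit_smooth u_ne).exists_right_inv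
  have hvi : v * smoothConj O ui = 1 := by rw [hv, ← map_mul, hui, map_one]
  set vi := smoothConj O ui with hvi'
  have cc : ∀ f, smoothConj O (smoothConj O f) = f := smoothConj_smoothConj
  set a := pd O 0 u * ui with ha
  set q := p * ui with hq
  have hal : a = (1 / 2 : ℂ) • (a + smoothConj O a)
      + j * ((-(Complex.I / 2)) • (a - smoothConj O a)) := smooth_ext fun x => eq_half_add_I_mul _ _
  have hal' : smoothConj O a = (1 / 2 : ℂ) • (a + smoothConj O a)
      - j * ((-(Complex.I / 2)) • (a - smoothConj O a)) := smooth_ext fun x => eq_half_sub_I_mul _ _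
  have hqq : q + smoothConj O q = -2 * (ui * vi) := by
    rw [hq, map_mul]
    linear_combination (ui * vi) * h₂ - vi * r * hui - ui * p * hvi
  have hqs : q = -(ui * vi) + j * ((-(Complex.I / 2)) • (q - smoothConj O q)) :=
    smooth_ext fun x => eq_neg_add_I_mul (smooth_congr hqq x)
  have hqs' : smoothConj O q = -(ui * vi) - j * ((-(Complex.I / 2)) • (q - smoothConj O q)) :=
    smooth_ext fun x => eq_neg_sub_I_mul (smooth_congr hqq x)
  set al := (1 / 2 : ℂ) • (a + smoothConj O a)
  set be := (-(Complex.I / 2)) • (a - smoothConj O a)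
  set s := (-(Complex.I / 2)) • (q - smoothConj O q) with hs
  have s_real : smoothConj O s = s := smooth_ext fun x => by simp [hs, c2]; ring
  have hut : pd O 0 u = u * (al + j * be) := by
    rw [← hal, ha]; linear_combination (-pd O 0 u) * hui
  have hux : pd O 1 u = j * pd O 0 (pd O 0 u) := by
    have h : pd O 1 u = pd O 0 (pd O 0 (pd O 1 z)) := by rw [hu, pd_comm 1 0, pd_comm 1 0]
    rw [h, h₁]
    simp only [Derivation.leibniz, smul_eq_mul, hI, map_add, mul_zero, add_zero]
  have hpe : pd O 0 (pd O 0 p) = pd O 2 u := by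
    rw [hp, hu, pd_comm 2 0, pd_comm 2 0]
  have hpx : pd O 1 p = j * pd O 0 (pd O 0 p) := by
    rw [hpe, hp, pd_comm 1 2, h₁]
    simp only [Derivation.leibniz, smul_eq_mul, hI, map_add, mul_zero, add_zero]
  -- B is s_t / (2 rho), and 1/rho = u v.
  refine ⟨al, be, ui * vi, s, (1 / 2 : ℂ) • (u * v * pd O 0 s), ?_, ?_, ?_, ?_, hut, ?_, ?_⟩
  · exact smooth_ext fun x => by simp [al, c2]; ring
  · exact smooth_ext fun x => by simp [be, c2]; ring
  · have hst : smoothConj O (pd O 0 s) = pd O 0 s := by rw [← pd_smoothConj, s_real]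
    rw [smoothConj_smul, map_mul, map_mul, hst, hv, cc, mul_comm u]
    simp [c2]
  · linear_combination (v * vi) * hui + hvi
  · rw [← hqs, hq]; linear_combination (-p) * hui
  · refine polarSystem_of_solution (u := u) (v := v) (p := p) (r := r) (j := j) (pd_comm 1 0)
      (pd_comm 2 0) (pd_comm 2 1) jj
      (hI 0) (hI 1) (hI 2) ?_ hut ?_ hux ?_ hpx ?_ hpe ?_ ?_ ?_ ?_
    · linear_combination (v * vi) * hui + hvi
    · have h : pd O 0 v = smoothConj O (pd O 0 u) := by rw [hv, pd_smoothConj]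
      rw [← hal', ha, map_mul, h]
      linear_combination (-smoothConj O (pd O 0 u)) * hvi
    · rw [hv, pd_smoothConj, hux, map_mul, cj, pd_smoothConj, pd_smoothConj]; ring
    · rw [hr, pd_smoothConj, hpx, map_mul, cj, pd_smoothConj, pd_smoothConj]; ring
    · rw [hr, hv, pd_smoothConj, pd_smoothConj, hpe, pd_smoothConj]
    · rw [← hqs, hq]; linear_combination (-p) * hui
    · rw [← hqs', hq, map_mul, hr]; linear_combination (-smoothConj O p) * hvi
    · have : 2 * (ui * vi) * ((1 / 2 : ℂ) • (u * v * pd O 0 s))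
          = (u * ui) * (v * vi) * pd O 0 s := smooth_ext fun x => by simp; ring
      rw [this, hui, hvi]; ring

end Setup

/-! ### The three normal forms on open subsets -/

section NormalForms

open TopologicalSpace

variable {O : Opens Pt}

theorem exists_real {f : smoothFunctions O} (hf : smoothConj O f = f) (x : O) :
    ∃ r : ℝ, (f : O → ℂ) x = r := by
  have h := smooth_congr hf x
  rw [smoothConj_apply] at h
  exact Complex.conj_eq_iff_real.mp h

/-- A point where the algebra of the polar system is insufficient and the reality of al, be, B and G
is needed. -/
theorem smooth_eq_zero_of_sum_squares {f g h : smoothFunctions O} (hf : smoothConj O f = f)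
    (hg : smoothConj O g = g) (H : h = f ^ 2 + g ^ 2) (x : O) (hx : (h : O → ℂ) x = 0) :
    (f : O → ℂ) x = 0 ∧ (g : O → ℂ) x = 0 := by
  obtain ⟨a, ha⟩ := exists_real hf x
  obtain ⟨b, hb⟩ := exists_real hg x
  have h1 : a ^ 2 + b ^ 2 = 0 := by
    have h2 : (f : O → ℂ) x ^ 2 + (g : O → ℂ) x ^ 2 = 0 := by
      rw [← hx, H]; rfl
    rw [ha, hb] at h2
    exact_mod_cast h2
  have ha0 : a = 0 := by nlinarith [sq_nonneg a, sq_nonneg b]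
  have hb0 : b = 0 := by nlinarith [sq_nonneg a, sq_nonneg b]
  simp [ha, hb, ha0, hb0]

theorem pd_real {f : smoothFunctions O} (hf : smoothConj O f = f) (i : Fin 3) :
    smoothConj O (pd O i f) = pd O i f := by rw [← pd_smoothConj, hf]

/-- `z_tt` depends on neither `t` nor `η`. -/
def StationaryForm (O : Opens Pt) (z : smoothFunctions O) : Prop :=
  pd O 0 (pd O 0 (pd O 0 z)) = 0 ∧ pd O 2 (pd O 0 (pd O 0 z)) = 0

/-- `z_tt` rotates with a frequency `N` depending on `η` only. -/
def RotatingForm (O : Opens Pt) (z : smoothFunctions O) : Prop :=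
  ∃ N : smoothFunctions O, IsUnit N ∧ smoothConj O N = N ∧ pd O 0 N = 0 ∧ pd O 1 N = 0 ∧
    pd O 0 (pd O 0 (pd O 0 z)) = smoothI O * (N * pd O 0 (pd O 0 z)) ∧
    N ^ 2 * pd O 2 (pd O 0 z) = smoothI O * (N ^ 3 * pd O 2 z - pd O 2 N * pd O 0 (pd O 0 z))

/-- `u = z_tt` satisfies a linear equation of second order with constant coefficients. -/
def LinearForm (O : Opens Pt) (z : smoothFunctions O) : Prop :=
  ∃ k K : smoothFunctions O, smoothConj O k = k ∧ smoothConj O K = K ∧ (∀ i, pd O i k = 0) ∧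
    (∀ i, pd O i K = 0) ∧ ∃ u D : smoothFunctions O, u = pd O 0 (pd O 0 z) ∧ IsUnit D ∧
    D = smoothI O * (u * smoothConj O (pd O 0 u)) - smoothI O * (smoothConj O u * pd O 0 u)
      - 2 * k * (u * smoothConj O u) ∧
    pd O 0 (pd O 0 u) = 2 * smoothI O * k * pd O 0 u + K * u ∧
    pd O 2 (pd O 0 z) * u * D = pd O 2 z * pd O 0 u * D
      - 2 * smoothI O * (pd O 0 u ^ 2 - 2 * smoothI O * k * (u * pd O 0 u) - K * u ^ 2)

theorem PolarForm.restrict {z al be rho s B : smoothFunctions O} (h : PolarForm O z al be rho s B)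
    {O' : Opens Pt} (hO : O' ≤ O) :
    PolarForm O' (smoothRestrict hO z) (smoothRestrict hO al) (smoothRestrict hO be)
      (smoothRestrict hO rho) (smoothRestrict hO s) (smoothRestrict hO B) := by
  have hc : ∀ f : smoothFunctions O, smoothConj O' (smoothRestrict hO f)
      = smoothRestrict hO (smoothConj O f) := fun f => smooth_ext fun x => by simp
  have hI : smoothI O' = smoothRestrict hO (smoothI O) := rfl
  refine ⟨?_, ?_, ?_, ?_, ?_, ?_, h.system.restrict hO⟩
  · rw [hc, h.al_real]
  · rw [hc, h.be_real]
  · rw [hc, h.B_real]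
  · simp only [pd_smoothRestrict, hc, ← map_mul, h.rho_eq, map_one]
  · simp only [pd_smoothRestrict, hI, ← map_mul, ← map_add, h.u_t]
  · simp only [pd_smoothRestrict, hI, ← map_mul, ← map_add, ← map_neg, h.p_eq]

theorem PolarForm.isUnit_rho {z al be rho s B : smoothFunctions O}
    (h : PolarForm O z al be rho s B) : IsUnit rho :=
  IsUnit.of_mul_eq_one_right _ h.rho_eq

/-- The t-derivative of z_η = u (-rho + i s); this becomes the equation for z_tη in (B) and (C). -/
theorem PolarForm.p_t {z al be rho s B : smoothFunctions O}
    (h : PolarForm O z al be rho s B) : pd O 2 (pd O 0 z) = pd O 2 z * (al + smoothI O * be)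
      + 2 * pd O 0 (pd O 0 z) * rho * (al + smoothI O * B) := by
  rw [pd_comm 2 0, h.p_eq]
  simp only [Derivation.leibniz, smul_eq_mul, map_add, map_neg, h.u_t, h.system.rho_t,
    h.system.s_t, pd_smoothI]
  ring

theorem PolarForm.al_eq_zero {z al be rho s B : smoothFunctions O}
    (h : PolarForm O z al be rho s B) (al_t : pd O 0 al = 0) (be_t : pd O 0 be = 0) : al = 0 := by
  obtain ⟨h1, h2⟩ := h.system.relations_of_stationary h.isUnit_rho al_t be_t
  refine smooth_ext fun x => ?_
  obtain ⟨a, ha⟩ := exists_real h.al_real x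
  obtain ⟨b, hb⟩ := exists_real h.be_real x
  obtain ⟨c, hc⟩ := exists_real h.B_real x
  have h1' : (al : O → ℂ) x * ((al : O → ℂ) x * ((al : O → ℂ) x ^ 2 - (be : O → ℂ) x ^ 2
      + 2 * (be : O → ℂ) x * (B : O → ℂ) x)) = 0 := smooth_congr h1 x
  have h2' : (al : O → ℂ) x * ((B : O → ℂ) x * ((al : O → ℂ) x ^ 2 - (be : O → ℂ) x ^ 2)
      - 2 * (al : O → ℂ) x ^ 2 * (be : O → ℂ) x) = 0 := smooth_congr h2 x
  rw [ha, hb, hc] at h1' h2'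
  norm_cast at h1' h2'
  suffices a = 0 by simp [ha, this]
  by_contra ha0
  have e1 := (mul_eq_zero.mp ((mul_eq_zero.mp h1').resolve_left ha0)).resolve_left ha0
  have e2 := (mul_eq_zero.mp h2').resolve_left ha0
  -- Once a ≠ 0, this gives b = 0, and then the first relation reduces to a² = 0.
  have e3 : b * (a ^ 2 + c ^ 2) = 0 := by linear_combination (c * e1 - e2) / 2
  have e4 : a ^ 2 + c ^ 2 ≠ 0 := by positivity
  have hb0 := (mul_eq_zero.mp e3).resolve_right e4
  rw [hb0] at e1
  exact ha0 (pow_eq_zero_iff two_ne_zero |>.mp (by linarith))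

/-- Now z_tη = 2i u rho B with every factor independent of t, so u_η = ∂_t z_tη = 0. -/
theorem PolarForm.stationaryForm {z al be rho s B : smoothFunctions O}
    (h : PolarForm O z al be rho s B) (hal : al = 0) (hbe : be = 0) : StationaryForm O z := by
  have hp := h.p_t
  have hs := h.system
  have hB : pd O 0 B = 0 := by rw [hs.B_t, hbe, map_zero]
  have hr := hs.rho_t
  have hu := h.u_t
  simp only [hal, hbe, mul_zero, add_zero, zero_add, zero_mul, neg_zero] at hp hr hu
  refine ⟨hu, ?_⟩
  rw [pd_comm 2 0, hp]
  simp only [Derivation.leibniz, smul_eq_mul, derivation_ofNat, pd_smoothI, hu, hr, hB]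
  ring

/-- Here N = be. The polar equations reduce to be_ξ = 0 and be_η = -2 rho B be²; the latter replaces
2 rho B in z_tη by -N_η/N². -/
theorem PolarForm.rotatingForm {z al be rho s B : smoothFunctions O}
    (h : PolarForm O z al be rho s B) (hal : al = 0) (be_t : pd O 0 be = 0) (hbe : IsUnit be) :
    RotatingForm O z := by
  have hp := h.p_t
  have hs := h.system
  have hu := h.u_t
  have h1 := hs.be_xi
  have h2 := hs.be_eta
  have hB := hs.B_t
  simp only [hal, mul_zero, add_zero, zero_add, zero_mul, neg_zero] at hp hu
  simp only [hal, hB, be_t, mul_zero, add_zero, zero_add, zero_mul, neg_zero, map_zero, map_sub,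
    Derivation.leibniz, Derivation.leibniz_pow, smul_eq_mul, nsmul_zero, zero_sub, map_neg,
    smul_zero, sub_zero, ne_eq, OfNat.ofNat_ne_zero, not_false_eq_true, zero_pow, hs.s_t] at h1 h2
  refine ⟨be, hbe, h.be_real, be_t, h1, ?_, ?_⟩
  · rw [hu]; ring
  · rw [hp, h2]; ring

/-- The denominator D of (C) equals -u ū (G - 2B), so it is invertible exactly because the angular
velocity is; with rho u ū = 1 the formula for z_tη takes the form in (C). -/
theorem PolarForm.linearForm {z al be rho s B G : smoothFunctions O}
    (h : PolarForm O z al be rho s B) (hG : smoothConj O G = G)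
    (hR : RotatingSystem (pd O 0) (pd O 1) (pd O 2) al be rho s B (2 * (B - be))
      (al ^ 2 + B ^ 2) 0 G 0) (hRu : IsUnit (al ^ 2 + B ^ 2)) (hGB : IsUnit (G - 2 * B)) :
    LinearForm O z := by
  have c2 : (starRingEnd ℂ) 2 = 2 := map_ofNat _ 2
  have c4 : (starRingEnd ℂ) 4 = 4 := map_ofNat _ 4
  have h2 : ∀ f : smoothFunctions O, 2 * ((1 / 2 : ℂ) • f) = f := fun f => smooth_ext fun x => by
    simp
  have h4 : ∀ f : smoothFunctions O, 4 * ((1 / 4 : ℂ) • f) = f := fun f => smooth_ext fun x => by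
    simp
  set c := 2 * (B - be) with hc
  set R := al ^ 2 + B ^ 2 with hR0
  have c_real : smoothConj O c = c := by
    rw [hc, map_mul, map_sub, map_ofNat, h.B_real, h.be_real]
  have R_real : smoothConj O R = R := by
    rw [hR0, map_add, map_pow, map_pow, h.B_real, h.al_real]
  obtain ⟨k, hk⟩ : ∃ k, k = (1 / 2 : ℂ) • (G - c) := ⟨_, rfl⟩
  obtain ⟨K, hK⟩ : ∃ K, K = (1 / 4 : ℂ) • (4 * R - 2 * c * G + c ^ 2) := ⟨_, rfl⟩
  have hk2 : 2 * k = G - c := by rw [hk, h2]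
  have hK4 : 4 * K = 4 * R - 2 * c * G + c ^ 2 := by rw [hK, h4]
  obtain ⟨⟨e1, e2⟩, ⟨k0, k1, k2⟩, K0, K1, K2⟩ := hR.constant_coefficients hRu hGB hk2 hK4
  have hj : smoothI O * smoothI O = -1 := smoothI_mul_self
  have cj : smoothConj O (smoothI O) = -smoothI O := smooth_ext fun x => by simp
  obtain ⟨u, hu⟩ : ∃ u, u = pd O 0 (pd O 0 z) := ⟨_, rfl⟩
  have p_t := h.p_t
  have u_t := h.u_t
  have rho_eq := h.rho_eq
  rw [← hu] at p_t u_t rho_eq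
  have v_t : smoothConj O (pd O 0 u) = smoothConj O u * (al - smoothI O * be) := by
    rw [u_t, map_mul, map_add, map_mul, h.al_real, h.be_real, cj]; ring
  have hD : smoothI O * (u * smoothConj O (pd O 0 u)) - smoothI O * (smoothConj O u * pd O 0 u)
      - 2 * k * (u * smoothConj O u) = -(u * smoothConj O u * (G - 2 * B)) := by
    rw [v_t, u_t]
    linear_combination (-2 * u * smoothConj O u * be) * hj - u * smoothConj O u * hk2
      + u * smoothConj O u * hc
  refine ⟨k, K, ?_, ?_, ?_, ?_, u, -(u * smoothConj O u * (G - 2 * B)), hu, ?_, hD.symm, ?_, ?_⟩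
  · rw [hk, smoothConj_smul, map_sub, hG, c_real]; simp [c2]
  · rw [hK, smoothConj_smul, map_add, map_sub, map_mul, map_mul, map_mul, map_pow, hG, c_real,
      R_real, map_ofNat, map_ofNat]
    simp [c4]
  · intro i; fin_cases i; exacts [k0, k1, k2]
  · intro i; fin_cases i; exacts [K0, K1, K2]
  · exact ((IsUnit.of_mul_eq_one _ rho_eq).mul hGB).neg
  · rw [u_t]
    simp only [Derivation.leibniz, smul_eq_mul, map_add, u_t, pd_smoothI]
    linear_combination u * e1 + u * smoothI O * e2 + u * (be ^ 2 - 2 * k * be) * hj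
  · have al_t := hR.al_t
    rw [p_t, u_t]
    linear_combination (-2 * u ^ 2 * (al + smoothI O * B) * (G - 2 * B)) * rho_eq
      + 2 * smoothI O * u ^ 2 * (e1 - al_t) + 2 * al * u ^ 2 * (hk2 - hc)
      + u ^ 2 * (4 * al * be + 2 * smoothI O * be ^ 2 - 4 * k * (al + smoothI O * be)) * hj

theorem exists_ne_zero {f : smoothFunctions O} (hf : f ≠ 0) : ∃ x : O, (f : O → ℂ) x ≠ 0 := by
  by_contra! h
  exact hf (smooth_ext h)

theorem RotatingSystem.restrict {al be rho s B c R hh G e : smoothFunctions O}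
    (h : RotatingSystem (pd O 0) (pd O 1) (pd O 2) al be rho s B c R hh G e) {O' : Opens Pt}
    (hO : O' ≤ O) :
    RotatingSystem (pd O' 0) (pd O' 1) (pd O' 2) (smoothRestrict hO al) (smoothRestrict hO be)
      (smoothRestrict hO rho) (smoothRestrict hO s) (smoothRestrict hO B) (smoothRestrict hO c)
      (smoothRestrict hO R) (smoothRestrict hO hh) (smoothRestrict hO G) (smoothRestrict hO e) := by
  have h2 : (2 : smoothFunctions O') = smoothRestrict hO 2 := rfl
  have h4 : (4 : smoothFunctions O') = smoothRestrict hO 4 := rfl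
  have h8 : (8 : smoothFunctions O') = smoothRestrict hO 8 := rfl
  refine { h.toPolarSystem.restrict hO with
    c_eq := ?_, R_eq := ?_, R_t := ?_, R_xi := ?_, c_t := ?_, c_xi := ?_, hh_t := ?_, al_t := ?_,
    B_t' := ?_, G_t := ?_, al_xi' := ?_, B_xi := ?_, G_xi := ?_ } <;>
  simp only [pd_smoothRestrict, h2, h4, h8, ← map_mul, ← map_add, ← map_sub, ← map_pow, ← map_neg]
  · rw [h.c_eq]
  · rw [h.R_eq]
  · rw [h.R_t]
  · rw [h.R_xi]
  · rw [h.c_t, map_zero]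
  · rw [h.c_xi]
  · rw [h.hh_t]
  · rw [h.al_t]
  · rw [h.B_t']
  · rw [h.G_t]
  · rw [h.al_xi']
  · rw [h.B_xi]
  · rw [h.G_xi]

/-- If hh were invertible, so would be R_t = 2 R hh; but `affine_modulus_relation` makes a sum of
two real squares vanish, one of them (2 R_t³)². -/
theorem RotatingSystem.not_isUnit_hh {al be rho s B c R hh G e : smoothFunctions O}
    (h : RotatingSystem (pd O 0) (pd O 1) (pd O 2) al be rho s B c R hh G e)
    (al_real : smoothConj O al = al) (be_real : smoothConj O be = be)
    (B_real : smoothConj O B = B) (G_real : smoothConj O G = G) (hR : IsUnit R) (x : O) :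
    ¬ IsUnit hh := by
  intro hu
  have R_real : smoothConj O R = R := by
    rw [h.R_eq, map_add, map_pow, map_pow, al_real, B_real]
  have c_real : smoothConj O c = c := by
    rw [h.c_eq, map_mul, map_sub, map_ofNat, be_real, B_real]
  have h2 : IsUnit (2 : smoothFunctions O) := isUnit_smooth fun x => by simp
  have hRt : IsUnit (pd O 0 R) := by rw [h.R_t]; exact (h2.mul hR).mul hu
  have t_real := pd_real R_real 0
  -- The choice g = 2 R G clears the denominators: g_t = c R_t - R_ξ.
  have key := affine_modulus_relation (R := R) (c := c) (g := 2 * R * G) h.comm_tx rfl hRt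
    (by simp only [Derivation.leibniz, smul_eq_mul, derivation_ofNat, h.R_t, h.hh_t]; ring) h.c_t
    (by simp only [Derivation.leibniz, smul_eq_mul, derivation_ofNat, h.R_t, h.R_xi, h.G_t]; ring)
    (by simp only [Derivation.leibniz, smul_eq_mul, derivation_ofNat, h.R_t, h.R_xi, h.G_xi]; ring)
  have key2 : (0 : smoothFunctions O) = (2 * pd O 0 R ^ 3) ^ 2
      + (2 * pd O 0 R ^ 2 * (2 * R * G) - 2 * c * pd O 0 R ^ 2 * R
        + 2 * (pd O 0 R * pd O 1 R - pd O 1 (pd O 0 R) * R) * R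
        + pd O 1 (pd O 0 R) * R ^ 2) ^ 2 := by linear_combination -key
  have h3 := (smooth_eq_zero_of_sum_squares
    (by simp only [map_mul, map_pow, map_ofNat, t_real])
    (by simp only [map_add, map_sub, map_mul, map_pow, map_ofNat, t_real, R_real, G_real, c_real,
      pd_real R_real 1, pd_real t_real 1]) key2 x (by simp)).1
  obtain ⟨w, hw⟩ := (h2.mul (hRt.pow 3)).exists_right_inv
  have h4 : ((2 * pd O 0 R ^ 3 : smoothFunctions O) : O → ℂ) x * (w : O → ℂ) x = 1 :=
    smooth_congr hw x
  rw [h3, zero_mul] at h4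
  exact zero_ne_one h4

theorem RotatingSystem.hh_eq_zero {al be rho s B c R hh G e : smoothFunctions O}
    (h : RotatingSystem (pd O 0) (pd O 1) (pd O 2) al be rho s B c R hh G e)
    (al_real : smoothConj O al = al) (be_real : smoothConj O be = be)
    (B_real : smoothConj O B = B) (G_real : smoothConj O G = G) (hR : IsUnit R) : hh = 0 := by
  by_contra hne
  obtain ⟨x, hx⟩ := exists_ne_zero hne
  have hO := smoothSupport_le hh
  have hc : ∀ f : smoothFunctions O, smoothConj O f = f → smoothConj (smoothSupport hh)
      (smoothRestrict hO f) = smoothRestrict hO f := fun f hf => by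
    conv_rhs => rw [← hf]
    exact smooth_ext fun x => by simp
  exact (h.restrict hO).not_isUnit_hh (hc _ al_real) (hc _ be_real) (hc _ B_real) (hc _ G_real)
    (hR.map _) ⟨x, mem_smoothSupport hx⟩ (isUnit_smoothRestrict_smoothSupport hh)

theorem RotatingSystem.e_eq_zero {al be rho s B c R G e : smoothFunctions O}
    (h : RotatingSystem (pd O 0) (pd O 1) (pd O 2) al be rho s B c R 0 G e)
    (hrho : IsUnit rho) (hR : IsUnit R) : e = 0 := by
  by_contra hne
  obtain ⟨x, hx⟩ := exists_ne_zero hne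
  have hO := smoothSupport_le e
  have h' := h.restrict hO
  rw [map_zero] at h'
  have h0 := h'.eq_zero_of_isUnit_e (hrho.map (smoothRestrict hO)) (hR.map (smoothRestrict hO))
    (isUnit_smoothRestrict_smoothSupport e)
  obtain ⟨w, hw⟩ := (hR.map (smoothRestrict hO)).exists_right_inv
  rw [h0, zero_mul] at hw
  have := smooth_congr hw ⟨x, mem_smoothSupport hx⟩
  simp at this

theorem PolarForm.linearForm_of_isUnit {z al be rho s B : smoothFunctions O}
    (h : PolarForm O z al be rho s B) (hR : IsUnit (al ^ 2 + B ^ 2))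
    (ht : IsUnit (pd O 0 al ^ 2 + pd O 0 be ^ 2)) : LinearForm O z := by
  obtain ⟨r, hr⟩ := hR.exists_right_inv
  have R_real : smoothConj O (al ^ 2 + B ^ 2) = al ^ 2 + B ^ 2 := by
    rw [map_add, map_pow, map_pow, h.al_real, h.B_real]
  have r_real : smoothConj O r = r := by
    refine hR.mul_left_cancel ?_
    have := congrArg (smoothConj O) hr
    rw [map_mul, R_real, map_one] at this
    rw [this, hr]
  have h2 : ∀ f : smoothFunctions O, 2 * ((1 / 2 : ℂ) • f) = f := fun f => smooth_ext fun x => by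
    simp
  set R := al ^ 2 + B ^ 2 with hR0
  obtain ⟨G, hG⟩ : ∃ G, G = (al * pd O 0 B - B * pd O 0 al) * r + 2 * B := ⟨_, rfl⟩
  have G_real : smoothConj O G = G := by
    rw [hG]
    simp only [map_add, map_sub, map_mul, map_ofNat, r_real, h.al_real, h.B_real,
      pd_real h.al_real 0, pd_real h.B_real 0]
  have hrot := h.system.rotating h.isUnit_rho hR (hh := (1 / 2 : ℂ) • (pd O 0 R * r))
    (G := G) (e := (1 / 2 : ℂ) • (pd O 1 R * r))
    (by rw [← hR0]; linear_combination (-R) * h2 (pd O 0 R * r) - pd O 0 R * hr)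
    (by rw [← hR0]; linear_combination (-R) * h2 (pd O 1 R * r) - pd O 1 R * hr)
    (by rw [← hR0, hG]; linear_combination (al * pd O 0 B - B * pd O 0 al) * hr)
  rw [hrot.hh_eq_zero h.al_real h.be_real h.B_real G_real hR] at hrot
  rw [hrot.e_eq_zero h.isUnit_rho hR] at hrot
  refine h.linearForm G_real hrot hR ?_
  have al_t := hrot.al_t
  have be_t := hrot.B_t'
  rw [hrot.B_t] at be_t
  -- With hh = 0 the motion is a pure rotation, whose squared speed is (G - 2B)² R.
  have : pd O 0 al ^ 2 + pd O 0 be ^ 2 = (G - 2 * B) * ((G - 2 * B) * R) := by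
    rw [al_t, be_t, hR0]; ring
  rw [this] at ht
  exact isUnit_of_mul_isUnit_left ht

/-- Every solution is in one of the three forms on some nonempty open set. -/
theorem PolarForm.exists_normalForm {z al be rho s B : smoothFunctions O}
    (h : PolarForm O z al be rho s B) (x : O) :
    ∃ (O' : Opens Pt) (hO : O' ≤ O), Nonempty O' ∧ (StationaryForm O' (smoothRestrict hO z) ∨
      RotatingForm O' (smoothRestrict hO z) ∨ LinearForm O' (smoothRestrict hO z)) := by
  by_cases hs : pd O 0 al = 0 ∧ pd O 0 be = 0
  · have hal := h.al_eq_zero hs.1 hs.2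
    by_cases hbe : be = 0
    · exact ⟨O, le_rfl, ⟨x⟩, Or.inl (h.stationaryForm hal hbe)⟩
    · obtain ⟨y, hy⟩ := exists_ne_zero hbe
      have hO := smoothSupport_le be
      refine ⟨_, hO, ⟨⟨y, mem_smoothSupport hy⟩⟩, Or.inr (Or.inl ?_)⟩
      refine (h.restrict hO).rotatingForm (by rw [hal, map_zero]) ?_
        (isUnit_smoothRestrict_smoothSupport be)
      rw [pd_smoothRestrict, hs.2, map_zero]
  · obtain ⟨T, hT⟩ : ∃ T, T = pd O 0 al ^ 2 + pd O 0 be ^ 2 := ⟨_, rfl⟩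
    have hT0 : T ≠ 0 := fun h0 => hs
      ⟨smooth_ext fun y => (smooth_eq_zero_of_sum_squares (pd_real h.al_real 0)
          (pd_real h.be_real 0) hT y (by simp [h0])).1,
        smooth_ext fun y => (smooth_eq_zero_of_sum_squares (pd_real h.al_real 0)
          (pd_real h.be_real 0) hT y (by simp [h0])).2⟩
    obtain ⟨y, hy⟩ := exists_ne_zero hT0
    have hO := smoothSupport_le T
    have h' := h.restrict hO
    have hTu := isUnit_smoothRestrict_smoothSupport T
    have hTe : smoothRestrict hO T = pd _ 0 (smoothRestrict hO al) ^ 2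
        + pd _ 0 (smoothRestrict hO be) ^ 2 := by
      refine (congrArg (smoothRestrict hO) hT).trans ?_
      rw [map_add, map_pow, map_pow, pd_smoothRestrict, pd_smoothRestrict]
    rw [hTe] at hTu
    obtain ⟨Q, hQ⟩ : ∃ Q, Q = smoothRestrict hO al ^ 2 + smoothRestrict hO B ^ 2 := ⟨_, rfl⟩
    -- If al = B = 0 then al_t = 0 and be_t = B_t = 0, contradicting that T is invertible on its
    -- support.
    have hQ0 : Q ≠ 0 := fun h0 => by
      have ha : smoothRestrict hO al = 0 := smooth_ext fun w => (smooth_eq_zero_of_sum_squares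
        h'.al_real h'.B_real hQ w (by simp [h0])).1
      have hB : smoothRestrict hO B = 0 := smooth_ext fun w => (smooth_eq_zero_of_sum_squares
        h'.al_real h'.B_real hQ w (by simp [h0])).2
      rw [← h'.system.B_t, ha, hB, map_zero] at hTu
      obtain ⟨w, hw⟩ := hTu.exists_right_inv
      have := smooth_congr hw ⟨y, mem_smoothSupport hy⟩
      simp at this
    obtain ⟨w, hw⟩ := exists_ne_zero hQ0
    have hO2 := smoothSupport_le Q
    have h'' := h'.restrict hO2
    refine ⟨smoothSupport Q, hO2.trans hO, ⟨⟨w, mem_smoothSupport hw⟩⟩, Or.inr (Or.inr ?_)⟩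
    have e : smoothRestrict (hO2.trans hO) z = smoothRestrict hO2 (smoothRestrict hO z) := rfl
    rw [e]
    refine h''.linearForm_of_isUnit ?_ ?_
    · have := isUnit_smoothRestrict_smoothSupport Q
      have hQe : smoothRestrict hO2 Q = smoothRestrict hO2 (smoothRestrict hO al) ^ 2
          + smoothRestrict hO2 (smoothRestrict hO B) ^ 2 := by
        refine (congrArg (smoothRestrict hO2) hQ).trans ?_
        rw [map_add, map_pow, map_pow]
      rwa [hQe] at this
    · have := hTu.map (smoothRestrict hO2)
      rwa [map_add, map_pow, map_pow, ← pd_smoothRestrict, ← pd_smoothRestrict] at this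

end NormalForms

/-! ### From normal forms to solutions of (A), (B), (C), and the converse -/

section LocalSolutions

open TopologicalSpace

variable {O : Opens Pt}

theorem pd_smoothMk_partialD (i : Fin 3) (F : Pt → ℂ) (hF : ContDiffOn ℝ ∞ F O) :
    pd O i (smoothMk F hF) = smoothMk (partialD i F) (contDiffOn_partialD O.isOpen hF i) :=
  pd_smoothMk i F hF

theorem smoothConj_smoothMk (F : Pt → ℂ) (hF : ContDiffOn ℝ ∞ F O) :
    smoothConj O (smoothMk F hF) = smoothMk (conjFun F) (contDiffOn_conj hF) :=
  smooth_ext fun x => by simp only [smoothConj_apply, smoothMk_apply]; rfl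

theorem smoothCalculus_t (U : Set Pt) (f : Pt → ℂ) : (smoothCalculus U).t f = partialD 0 f := rfl

theorem smoothCalculus_xi (U : Set Pt) (f : Pt → ℂ) : (smoothCalculus U).xi f = partialD 1 f := rfl

theorem smoothCalculus_eta (U : Set Pt) (f : Pt → ℂ) : (smoothCalculus U).eta f = partialD 2 f := rfl

theorem smoothCalculus_eqn (U : Set Pt) (f g : Pt → ℂ) :
    (smoothCalculus U).eqn f g ↔ ∀ p ∈ U, f p = g p := Iff.rfl

theorem conjFun_apply (f : Pt → ℂ) (p : Pt) : conjFun f p = (starRingEnd ℂ) (f p) := rfl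

theorem solvesOriginal_iff (U : Set Pt) (z : Pt → ℂ) : SolvesOriginal U z ↔
    (∀ p ∈ U, partialD 1 z p = Complex.I * partialD 0 (partialD 0 z) p) ∧
    ∀ p ∈ U, partialD 0 (partialD 0 z) p * (starRingEnd ℂ) (partialD 2 z p)
      + (starRingEnd ℂ) (partialD 0 (partialD 0 z) p) * partialD 2 z p = -2 := by
  simp only [SolvesOriginal, OriginalSystem, smoothCalculus_t, smoothCalculus_xi,
    smoothCalculus_eta, smoothCalculus_eqn, partialD_conjFun, Pi.smul_apply, smul_eq_mul,
    Pi.sub_apply, Pi.mul_apply, Pi.one_apply, conjFun_apply]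
  refine and_congr_right fun h => forall₂_congr fun p hp => ?_
  rw [h p hp]
  simp only [map_mul, Complex.conj_I]
  constructor
  · intro H
    linear_combination (-2) * H - (partialD 0 (partialD 0 z) p * (starRingEnd ℂ) (partialD 2 z p)
      + (starRingEnd ℂ) (partialD 0 (partialD 0 z) p) * partialD 2 z p) * (-Complex.I_mul_I)
  · intro H
    linear_combination (-1 / 2) * H + (partialD 0 (partialD 0 z) p * (starRingEnd ℂ) (partialD 2 z p)
      + (starRingEnd ℂ) (partialD 0 (partialD 0 z) p) * partialD 2 z p) / 2 * Complex.I_mul_I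

theorem z_tt_ne_zero {u p : ℂ} (h : u * (starRingEnd ℂ) p + (starRingEnd ℂ) u * p = -2) :
    u ≠ 0 := by
  rintro rfl
  simp at h

theorem SolvesOriginal.schrodingerPair {U : Set Pt} {z : Pt → ℂ} (h : SolvesOriginal U z) :
    SchrodingerPair (smoothCalculus U) z (conjFun z) := by
  obtain ⟨h1, -⟩ := (solvesOriginal_iff U z).mp h
  refine ⟨h1, fun p hp => ?_⟩
  simp only [smoothCalculus_t, smoothCalculus_xi, partialD_conjFun]
  simp [conjFun_apply, h1 p hp]

theorem SolvesOriginal.solvedConjEta {U : Set Pt} {z : Pt → ℂ} (h : SolvesOriginal U z) :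
    SolvedConjEta (smoothCalculus U) z (conjFun z) := by
  obtain ⟨-, h2⟩ := (solvesOriginal_iff U z).mp h
  intro p hp
  have hu := z_tt_ne_zero (h2 p hp)
  simp only [smoothCalculus_t, smoothCalculus_eta, partialD_conjFun]
  simp only [Pi.mul_apply, Pi.inv_apply, Pi.sub_apply, Pi.neg_apply, conjFun_apply, Pi.ofNat_apply]
  rw [eq_mul_inv_iff_mul_eq₀ hu]
  linear_combination h2 p hp

theorem solvesOriginal_of_pair {U : Set Pt} {z : Pt → ℂ}
    (hu : RegularA (smoothCalculus U) z)
    (h₁ : SchrodingerPair (smoothCalculus U) z (conjFun z))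
    (h₂ : SolvedConjEta (smoothCalculus U) z (conjFun z)) : SolvesOriginal U z := by
  refine (solvesOriginal_iff U z).mpr ⟨h₁.1, fun p hp => ?_⟩
  have h := h₂ p hp
  simp only [smoothCalculus_t, smoothCalculus_eta, partialD_conjFun] at h
  simp only [Pi.mul_apply, Pi.inv_apply, Pi.sub_apply, Pi.neg_apply, conjFun_apply,
    Pi.ofNat_apply] at h
  have hu' : partialD 0 (partialD 0 z) p ≠ 0 := hu p hp
  rw [eq_mul_inv_iff_mul_eq₀ hu'] at h
  linear_combination h

/-- F is constant along the segment from p to q, whose direction involves only the coordinates in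
which p and q differ. This serves both constants and functions of η alone. -/
theorem eq_of_partialD_eq_zero {W : Set Pt} (hW : IsOpen W) (hc : Convex ℝ W) {F : Pt → ℂ}
    (hF : ContDiffOn ℝ ∞ F W) {p q : Pt} (hp : p ∈ W) (hq : q ∈ W)
    (h : ∀ i, q i ≠ p i → ∀ x ∈ W, partialD i F x = 0) : F q = F p := by
  have hd : ∀ s ∈ Set.Icc (0 : ℝ) 1, HasDerivAt (fun s => F (AffineMap.lineMap p q s)) 0 s := by
    intro s hs
    have hx : AffineMap.lineMap p q s ∈ W := hc.lineMap_mem hp hq hs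
    have h1 := (differentiableAt_of_contDiffOn hW hF hx).hasFDerivAt.comp_hasDerivAt s
      (AffineMap.hasDerivAt_lineMap (a := p) (b := q) (x := s))
    have h2 : fderiv ℝ F (AffineMap.lineMap p q s) (q - p) = 0 := by
      rw [← Finset.univ_sum_single (q - p), map_sum]
      refine Finset.sum_eq_zero fun i _ => ?_
      by_cases hi : q i = p i
      · simp [hi]
      · have h3 := h i hi _ hx
        have h4 : (Pi.single i ((q - p) i) : Pt) = (q - p) i • Pi.single i (1 : ℝ) := by
          rw [← Pi.single_smul]; simp
        rw [h4, map_smul]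
        exact (congrArg _ h3).trans (smul_zero _)
    rwa [h2] at h1
  have := constant_of_has_deriv_right_zero (f := fun s => F (AffineMap.lineMap p q s)) (a := 0)
    (b := 1) (fun s hs => (hd s hs).continuousAt.continuousWithinAt)
    (fun s hs => (hd s ⟨hs.1, hs.2.le⟩).hasDerivWithinAt) 1 (by simp)
  simpa using this

theorem solvesA_of_stationaryForm {z : Pt → ℂ} (hz : ContDiffOn ℝ ∞ z O) (h : SolvesOriginal O z)
    (hf : StationaryForm O (smoothMk z hz)) : SolvesA O z := by
  obtain ⟨-, h2⟩ := (solvesOriginal_iff O z).mp h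
  obtain ⟨f1, f2⟩ := hf
  simp only [pd_smoothMk_partialD] at f1 f2
  refine ⟨fun p hp => z_tt_ne_zero (h2 p hp), h.schrodingerPair, h.solvedConjEta,
    fun p hp => smooth_congr f2 ⟨p, hp⟩, fun p hp => smooth_congr f1 ⟨p, hp⟩, fun p hp => ?_⟩
  have := smooth_congr f1 ⟨p, hp⟩
  rw [smoothMk_apply] at this
  simp only [smoothCalculus_t, partialD_conjFun]
  rw [conjFun_apply, this]
  simp

theorem SolvesOriginal.mono {U W : Set Pt} {z : Pt → ℂ} (h : SolvesOriginal U z) (hW : W ⊆ U) :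
    SolvesOriginal W z := ⟨fun p hp => h.1 p (hW hp), fun p hp => h.2 p (hW hp)⟩

/-- On a ball around x, the coefficient is replaced by its restriction to the line through x
parallel to the η-axis, which makes it a function of one real variable. -/
theorem exists_solvesB_of_rotatingForm {z : Pt → ℂ} (hz : ContDiffOn ℝ ∞ z O)
    (h : SolvesOriginal O z) (hf : RotatingForm O (smoothMk z hz)) (x : O) :
    ∃ W : Set Pt, IsOpen W ∧ W.Nonempty ∧ W ⊆ O ∧ ∃ N : ℝ → ℝ, SolvesB W N z := by
  obtain ⟨N, hNu, hNr, N0, N1, f1, f2⟩ := hf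
  obtain ⟨F, hF, rfl⟩ := exists_smoothMk N
  simp only [pd_smoothMk_partialD] at f1 f2 N0 N1
  obtain ⟨ε, hε, hball⟩ := Metric.isOpen_iff.mp O.isOpen x x.2
  set W := Metric.ball (x : Pt) ε with hW
  have hWo : IsOpen W := Metric.isOpen_ball
  -- The ball is a cube for the sup metric, hence it contains the projection of each of its points
  -- to this line.
  have hup : ∀ p ∈ W, Function.update (x : Pt) 2 (p 2) ∈ W := by
    intro p hp
    rw [hW, Metric.mem_ball, dist_pi_lt_iff hε] at hp ⊢
    intro i
    by_cases hi : i = 2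
    · subst hi; simpa using hp 2
    · simp [Function.update_of_ne hi, hε]
  have hFr : ∀ p ∈ W, ((F p).re : ℂ) = F p := by
    intro p hp
    have := smooth_congr hNr ⟨p, hball hp⟩
    rw [smoothConj_apply] at this
    exact (Complex.conj_eq_iff_re.mp this)
  have hFN : ∀ p ∈ W, ((F (Function.update (x : Pt) 2 (p 2))).re : ℂ) = F p := by
    intro p hp
    rw [hFr _ (hup p hp)]
    refine eq_of_partialD_eq_zero hWo (convex_ball _ _) (hF.mono hball) hp (hup p hp) ?_
    intro i hi y hy
    fin_cases i
    · exact smooth_congr N0 ⟨y, hball hy⟩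
    · exact smooth_congr N1 ⟨y, hball hy⟩
    · simp at hi
  have hFne : ∀ p ∈ W, F p ≠ 0 := by
    intro p hp h0
    obtain ⟨w, hw⟩ := hNu.exists_right_inv
    have h1 : F p * (w : O → ℂ) ⟨p, hball hp⟩ = 1 := smooth_congr hw ⟨p, hball hp⟩
    rw [h0, zero_mul] at h1
    exact zero_ne_one h1
  have hFη : ∀ p ∈ W, partialD 2 (fun q : Pt => ((F (Function.update (x : Pt) 2 (q 2))).re : ℂ)) p
      = partialD 2 F p := by
    intro p hp
    have : (fun q : Pt => ((F (Function.update (x : Pt) 2 (q 2))).re : ℂ)) =ᶠ[𝓝 p] F := by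
      filter_upwards [hWo.mem_nhds hp] with q hq using hFN q hq
    simp only [partialD, this.fderiv_eq]
  have hS := h.mono hball
  obtain ⟨-, h2⟩ := (solvesOriginal_iff W z).mp hS
  have e1 : ∀ p ∈ W, partialD 0 (partialD 0 (partialD 0 z)) p
      = Complex.I * (F p * partialD 0 (partialD 0 z) p) :=
    fun p hp => smooth_congr f1 ⟨p, hball hp⟩
  have e2 : ∀ p ∈ W, F p ^ 2 * partialD 2 (partialD 0 z) p = Complex.I * (F p ^ 3 * partialD 2 z p
      - partialD 2 F p * partialD 0 (partialD 0 z) p) :=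
    fun p hp => smooth_congr f2 ⟨p, hball hp⟩
  refine ⟨W, hWo, ⟨x, Metric.mem_ball_self hε⟩, hball,
    fun y => (F (Function.update (x : Pt) 2 y)).re, ?_,
    ⟨fun p hp => z_tt_ne_zero (h2 p hp), fun p hp => ?_⟩, hS.schrodingerPair, hS.solvedConjEta,
    fun p hp => ?_, fun p hp => ?_, fun p hp => ?_⟩
  · have hc : ContDiffOn ℝ ∞ (F ∘ Function.update (x : Pt) 2) ((fun p : Pt => p 2) '' W) :=
      (hF.mono hball).comp (contDiff_update _ _ _).contDiffOn
        (by rintro _ ⟨p, hp, rfl⟩; exact hup p hp)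
    exact Complex.reCLM.contDiff.comp_contDiffOn hc
  · simp only [hFN p hp]; exact hFne p hp
  · simp only [smoothCalculus_t, Pi.smul_apply, Pi.mul_apply, smul_eq_mul, hFN p hp]
    exact e1 p hp
  · simp only [smoothCalculus_t, Pi.smul_apply, Pi.mul_apply, smul_eq_mul, hFN p hp,
      partialD_conjFun, Pi.neg_apply]
    rw [conjFun_apply, conjFun_apply, e1 p hp, ← hFr p hp]
    simp
  · simp only [smoothCalculus_t, smoothCalculus_eta, Pi.smul_apply, Pi.mul_apply, smul_eq_mul,
      hFN p hp, Pi.neg_apply, Pi.sub_apply, Pi.inv_apply, Pi.pow_apply, hFη p hp]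
    have := hFne p hp
    have h3 := e2 p hp
    field_simp
    linear_combination h3

theorem exists_solvesC_of_linearForm {z : Pt → ℂ} (hz : ContDiffOn ℝ ∞ z O)
    (h : SolvesOriginal O z) (hf : LinearForm O (smoothMk z hz)) (x : O) :
    ∃ W : Set Pt, IsOpen W ∧ W.Nonempty ∧ W ⊆ O ∧ ∃ k m : ℝ, SolvesC W k m z := by
  obtain ⟨k, K, hkr, hKr, hk, hK, u, D, rfl, hDu, rfl, f1, f2⟩ := hf
  obtain ⟨F, hF, rfl⟩ := exists_smoothMk k
  obtain ⟨H, hH, rfl⟩ := exists_smoothMk K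
  obtain ⟨k, hk0⟩ := exists_real hkr x
  obtain ⟨K, hK0⟩ := exists_real hKr x
  simp only [pd_smoothMk_partialD, smoothConj_smoothMk] at f1 f2 hk hK hDu
  rw [smoothMk_apply] at hk0 hK0
  obtain ⟨ε, hε, hball⟩ := Metric.isOpen_iff.mp O.isOpen x x.2
  set W := Metric.ball (x : Pt) ε with hW
  have hWo : IsOpen W := Metric.isOpen_ball
  have hFk : ∀ p ∈ W, F p = k := fun p hp => by
    rw [← hk0]
    exact eq_of_partialD_eq_zero hWo (convex_ball _ _) (hF.mono hball) (Metric.mem_ball_self hε) hp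
      fun i _ y hy => smooth_congr (hk i) ⟨y, hball hy⟩
  have hHK : ∀ p ∈ W, H p = K := fun p hp => by
    rw [← hK0]
    exact eq_of_partialD_eq_zero hWo (convex_ball _ _) (hH.mono hball) (Metric.mem_ball_self hε) hp
      fun i _ y hy => smooth_congr (hK i) ⟨y, hball hy⟩
  have hS := h.mono hball
  obtain ⟨-, h2⟩ := (solvesOriginal_iff W z).mp hS
  have hKm : ((k : ℂ) ^ 2 + ((K - k ^ 2 : ℝ) : ℂ)) = K := by push_cast; ring
  have e1 : ∀ p ∈ W, partialD 0 (partialD 0 (partialD 0 (partialD 0 z))) p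
      = 2 * Complex.I * k * partialD 0 (partialD 0 (partialD 0 z)) p
        + K * partialD 0 (partialD 0 z) p := fun p hp => by
    rw [← hFk p hp, ← hHK p hp]
    exact smooth_congr f1 ⟨p, hball hp⟩
  have eD : ∀ p ∈ W, denomC (smoothCalculus W) k z (conjFun z) p
      = Complex.I * (partialD 0 (partialD 0 z) p * conjFun (partialD 0 (partialD 0 (partialD 0 z))) p)
      - Complex.I * (conjFun (partialD 0 (partialD 0 z)) p * partialD 0 (partialD 0 (partialD 0 z)) p)
      - 2 * F p * (partialD 0 (partialD 0 z) p * conjFun (partialD 0 (partialD 0 z)) p) :=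
    fun p hp => by
      rw [hFk p hp]
      simp only [denomC, smoothCalculus_t, partialD_conjFun]
      rfl
  have hD : ∀ p ∈ W, denomC (smoothCalculus W) k z (conjFun z) p ≠ 0 := by
    intro p hp h0
    obtain ⟨w, hw⟩ := hDu.exists_right_inv
    rw [eD p hp] at h0
    have h1 := smooth_congr hw ⟨p, hball hp⟩
    have h3 := (congrArg (· * (w : O → ℂ) ⟨p, hball hp⟩) h0).symm.trans h1
    simp at h3
  refine ⟨W, hWo, ⟨x, Metric.mem_ball_self hε⟩, hball, k, K - k ^ 2,
    ⟨fun p hp => z_tt_ne_zero (h2 p hp), hD⟩, hS.schrodingerPair, hS.solvedConjEta,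
    fun p hp => ?_, fun p hp => ?_, fun p hp => ?_⟩
  · rw [hKm]
    exact e1 p hp
  · rw [hKm]
    simp only [smoothCalculus_t, partialD_conjFun, Pi.smul_apply, Pi.add_apply, Pi.neg_apply,
      smul_eq_mul, conjFun_apply]
    rw [e1 p hp]
    simp [map_ofNat]
  · rw [hKm]
    have h3 : partialD 2 (partialD 0 z) p * partialD 0 (partialD 0 z) p
        * denomC (smoothCalculus W) k z (conjFun z) p
        = partialD 2 z p * partialD 0 (partialD 0 (partialD 0 z)) p
          * denomC (smoothCalculus W) k z (conjFun z) p
        - 2 * Complex.I * (partialD 0 (partialD 0 (partialD 0 z)) p ^ 2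
          - 2 * Complex.I * k * (partialD 0 (partialD 0 z) p
            * partialD 0 (partialD 0 (partialD 0 z)) p)
          - K * partialD 0 (partialD 0 z) p ^ 2) := by
      rw [eD p hp, ← hHK p hp]
      conv in (k : ℂ) => rw [← hFk p hp]
      exact smooth_congr f2 ⟨p, hball hp⟩
    have hu := z_tt_ne_zero (h2 p hp)
    have hDp := hD p hp
    simp only [smoothCalculus_t, smoothCalculus_eta, Pi.smul_apply, Pi.mul_apply, smul_eq_mul,
      Pi.neg_apply, Pi.sub_apply, Pi.inv_apply, Pi.pow_apply]
    generalize denomC (smoothCalculus W) k z (conjFun z) p = D at *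
    field_simp
    linear_combination h3

/-- Locally, in general position, the solutions are those of the three systems. -/
theorem solvesOriginal_iff_locally {U : Set Pt} {z : Pt → ℂ} (hU : IsOpen U)
    (hz : ContDiffOn ℝ ∞ z U) : SolvesOriginal U z ↔
      ∃ V : Set Pt, IsOpen V ∧ V ⊆ U ∧ U ⊆ closure V ∧
        ∀ p ∈ V, ∃ W : Set Pt, IsOpen W ∧ p ∈ W ∧ W ⊆ V ∧
          (SolvesA W z ∨ (∃ N : ℝ → ℝ, SolvesB W N z) ∨ ∃ k m : ℝ, SolvesC W k m z) := by
  constructor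
  · intro h
    let P : Set Pt → Prop := fun W => IsOpen W ∧ W ⊆ U ∧
      (SolvesA W z ∨ (∃ N : ℝ → ℝ, SolvesB W N z) ∨ ∃ k m : ℝ, SolvesC W k m z)
    refine ⟨⋃₀ {W | P W}, isOpen_sUnion fun W hW => hW.1, Set.sUnion_subset fun W hW => hW.2.1,
      fun p hp => ?_, ?_⟩
    · rw [mem_closure_iff]
      intro T hT hpT
      -- Density: a normal form is found inside an arbitrary neighbourhood of a point of U.
      let O : Opens Pt := ⟨T ∩ U, hT.inter hU⟩
      have hOU : (O : Set Pt) ⊆ U := Set.inter_subset_right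
      have hzO := hz.mono hOU
      obtain ⟨h1, h2⟩ := (solvesOriginal_iff O z).mp (h.mono hOU)
      obtain ⟨al, be, rho, s, B, hpol⟩ := exists_polarForm (smoothMk z hzO)
        (by
          simp only [pd_smoothMk_partialD]
          exact smooth_ext fun x => h1 x x.2)
        (by
          simp only [pd_smoothMk_partialD, smoothConj_smoothMk]
          exact smooth_ext fun x => h2 x x.2)
      obtain ⟨O', hO', ⟨x⟩, hform⟩ := hpol.exists_normalForm ⟨p, hpT, hp⟩
      have hzO' := hzO.mono hO'
      have hr : smoothRestrict hO' (smoothMk z hzO) = smoothMk z hzO' := rfl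
      rw [hr] at hform
      have hS : SolvesOriginal O' z := h.mono (Set.Subset.trans hO' hOU)
      have hO'T : (O' : Set Pt) ⊆ T := fun y hy => (hO' hy).1
      have hO'U : (O' : Set Pt) ⊆ U := fun y hy => (hO' hy).2
      rcases hform with hA | hB | hC
      · exact ⟨x, hO'T x.2, O', ⟨O'.isOpen, hO'U, Or.inl (solvesA_of_stationaryForm hzO' hS hA)⟩, x.2⟩
      · obtain ⟨W, hWo, ⟨y, hy⟩, hW, hN⟩ := exists_solvesB_of_rotatingForm hzO' hS hB x
        exact ⟨y, hO'T (hW hy), W, ⟨hWo, hW.trans hO'U, Or.inr (Or.inl hN)⟩, hy⟩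
      · obtain ⟨W, hWo, ⟨y, hy⟩, hW, hN⟩ := exists_solvesC_of_linearForm hzO' hS hC x
        exact ⟨y, hO'T (hW hy), W, ⟨hWo, hW.trans hO'U, Or.inr (Or.inr hN)⟩, hy⟩
    · rintro p ⟨W, hW, hp⟩
      exact ⟨W, hW.1, hp, Set.subset_sUnion_of_mem hW, hW.2.2⟩
  · rintro ⟨V, hVo, hVU, hUV, hV⟩
    have hSV : SolvesOriginal V z := by
      have key : ∀ p ∈ V, ∃ W : Set Pt, p ∈ W ∧ SolvesOriginal W z := by
        intro p hp
        obtain ⟨W, -, hpW, -, hA | ⟨N, hB⟩ | ⟨k, m, hC⟩⟩ := hV p hp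
        · exact ⟨W, hpW, solvesOriginal_of_pair hA.1 hA.2.1 hA.2.2.1⟩
        · exact ⟨W, hpW, solvesOriginal_of_pair hB.2.1.1 hB.2.2.1 hB.2.2.2.1⟩
        · exact ⟨W, hpW, solvesOriginal_of_pair hC.1.1 hC.2.1 hC.2.2.1⟩
      constructor
      · intro p hp
        obtain ⟨W, hpW, hW⟩ := key p hp
        exact hW.1 p hpW
      · intro p hp
        obtain ⟨W, hpW, hW⟩ := key p hp
        exact hW.2 p hpW
    rw [solvesOriginal_iff] at hSV ⊢
    -- Both sides of each equation of (S) are continuous on U, so equality on the dense subset V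
    -- extends to U.
    have c0 := (contDiffOn_partialD hU (contDiffOn_partialD hU hz 0) 0).continuousOn
    have c1 := (contDiffOn_partialD hU hz 1).continuousOn
    have c2 := (contDiffOn_partialD hU hz 2).continuousOn
    have hcj : ∀ {f : Pt → ℂ}, ContinuousOn f U →
        ContinuousOn (fun p => (starRingEnd ℂ) (f p)) U :=
      fun hf => Complex.continuous_conj.comp_continuousOn hf
    exact ⟨Set.EqOn.of_subset_closure (t := U) hSV.1 c1 (continuousOn_const.mul c0) hVU hUV,
      Set.EqOn.of_subset_closure (t := U) hSV.2 ((c0.mul (hcj c2)).add ((hcj c0).mul c2))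
        continuousOn_const hVU hUV⟩

end LocalSolutions

/-! ### Recursive solution of the formal Cauchy problem -/

section FormalCauchyProblem

open MvPowerSeries

/-- The partial derivatives of formal power series. -/
noncomputable abbrev fd (i : Fin 3) : Derivation ℂ Formal Formal := pderiv ℂ i

theorem fd_comm (i k : Fin 3) (f : Formal) : fd i (fd k f) = fd k (fd i f) := by
  ext a
  simp only [coeff_pderiv]
  by_cases h : i = k
  · subst h; rfl
  · rw [add_right_comm]
    simp [Finsupp.single_apply, h, Ne.symm h]
    ring

/-- The ideal of the series whose coefficients vanish on a lower set of multi-indices. -/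
noncomputable def vanishingIdeal (L : LowerSet (Fin 3 →₀ ℕ)) : Ideal Formal where
  carrier := {f | ∀ a ∈ L, coeff a f = 0}
  add_mem' := fun hf hg a ha => by rw [map_add, hf a ha, hg a ha, add_zero]
  zero_mem' := fun a _ => map_zero _
  smul_mem' := fun g f hf a ha => by
    classical
    rw [smul_eq_mul, coeff_mul]
    refine Finset.sum_eq_zero fun p hp => ?_
    have hle : p.2 ≤ a := by rw [← Finset.HasAntidiagonal.mem_antidiagonal.mp hp]; exact le_add_self
    rw [hf p.2 (L.lower hle ha), mul_zero]

theorem smul_mem_vanishingIdeal {L : LowerSet (Fin 3 →₀ ℕ)} {f : Formal} (c : ℂ)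
    (hf : f ∈ vanishingIdeal L) : c • f ∈ vanishingIdeal L := fun a ha => by
  rw [map_smul, hf a ha, smul_zero]

/-- The condition 0 ∈ L makes the constant terms agree, so f and g are both invertible or both have
the inverse 0 by convention. -/
theorem inv_sub_inv_mem {L : LowerSet (Fin 3 →₀ ℕ)} (hL : 0 ∈ L) {f g : Formal}
    (h : f - g ∈ vanishingIdeal L) : f⁻¹ - g⁻¹ ∈ vanishingIdeal L := by
  have h0 : constantCoeff f = constantCoeff g := by
    have := h 0 hL
    rwa [map_sub, sub_eq_zero] at this
  by_cases hf : constantCoeff f = 0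
  · rw [MvPowerSeries.inv_eq_zero.mpr hf, MvPowerSeries.inv_eq_zero.mpr (h0 ▸ hf), sub_zero]
    exact Ideal.zero_mem _
  · have hg : constantCoeff g ≠ 0 := h0 ▸ hf
    have : f⁻¹ - g⁻¹ = (-(f⁻¹ * g⁻¹)) * (f - g) := by
      linear_combination g⁻¹ * MvPowerSeries.mul_inv_cancel f hf
        - f⁻¹ * MvPowerSeries.mul_inv_cancel g hg
    rw [this]
    exact Ideal.mul_mem_left _ _ h

/-- `D` is, up to nonzero factors, the shift of the coefficients by `l`. -/
def IsShift (l : Fin 3 →₀ ℕ) (D : Formal → Formal) : Prop :=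
  ∃ s : (Fin 3 →₀ ℕ) → ℂ, (∀ a, s a ≠ 0) ∧ ∀ a f, coeff a (D f) = s a * coeff (a + l) f

theorem isShift_id : IsShift 0 id := ⟨fun _ => 1, fun _ => one_ne_zero, fun a f => by simp⟩

theorem isShift_fd (i : Fin 3) : IsShift (Finsupp.single i 1) (fd i) :=
  ⟨fun a => a i + 1, fun a => Nat.cast_add_one_ne_zero _, fun a f => by rw [coeff_pderiv, mul_comm]⟩

theorem IsShift.comp {l l' : Fin 3 →₀ ℕ} {D D' : Formal → Formal} (h : IsShift l D)
    (h' : IsShift l' D') : IsShift (l + l') (fun f => D (D' f)) := by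
  obtain ⟨s, hs, h⟩ := h
  obtain ⟨s', hs', h'⟩ := h'
  refine ⟨fun a => s a * s' (a + l), fun a => mul_ne_zero (hs _) (hs' _), fun a f => ?_⟩
  rw [h, h', add_assoc, mul_assoc]

theorem isShift_iterate (i : Fin 3) (k : ℕ) : IsShift (Finsupp.single i k) (fd i)^[k] := by
  induction k with
  | zero => simpa using isShift_id
  | succ k ih =>
    rw [Function.iterate_succ', Finsupp.single_add, add_comm]
    exact (isShift_fd i).comp ih

theorem IsShift.coeff_eq_iff {l : Fin 3 →₀ ℕ} {D : Formal → Formal} (h : IsShift l D)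
    (a : Fin 3 →₀ ℕ) (f g : Formal) :
    coeff a (D f) = coeff a (D g) ↔ coeff (a + l) f = coeff (a + l) g := by
  obtain ⟨s, hs, h⟩ := h
  rw [h, h, mul_right_inj' (hs a)]

/-- The order in which the coefficients of two series `z` (tag `false`) and `w` (tag `true`) are
determined: by the degree in `ξ`, then in `η`, then in `t`. -/
def Precedes (i k : (Fin 3 →₀ ℕ) × Bool) : Prop :=
  i.1 1 < k.1 1 ∨ i.1 1 = k.1 1 ∧ (i.1 2 < k.1 2 ∨ i.1 2 = k.1 2 ∧
    (i.1 0 < k.1 0 ∨ i.1 0 = k.1 0 ∧ i.2.toNat < k.2.toNat))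

theorem precedes_wf : WellFounded Precedes := by
  have h : WellFounded (Prod.Lex (· < ·) (Prod.Lex (· < ·) (Prod.Lex (· < ·) (· < ·))) :
      ℕ × ℕ × ℕ × ℕ → ℕ × ℕ × ℕ × ℕ → Prop) :=
    WellFounded.prod_lex wellFounded_lt (WellFounded.prod_lex wellFounded_lt
      (WellFounded.prod_lex wellFounded_lt wellFounded_lt))
  refine Subrelation.wf ?_ (InvImage.wf (fun i : (Fin 3 →₀ ℕ) × Bool =>
    (i.1 1, i.1 2, i.1 0, i.2.toNat)) h)
  intro i k hik
  simpa only [InvImage, Prod.lex_def, Precedes] using hik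

theorem existsUnique_fixedPoint {ι α : Type*} [Inhabited α] {r : ι → ι → Prop} (hr : WellFounded r)
    (T : (ι → α) → ι → α) (hT : ∀ x y i, (∀ k, r k i → x k = y k) → T x i = T y i) :
    ∃! x, ∀ i, x i = T x i := by
  classical
  -- The value `default` is immaterial: T x i depends only on x at the predecessors of i.
  refine ⟨hr.fix fun i x => T (fun k => if h : r k i then x k h else default) i, ?_, ?_⟩
  · intro i
    rw [hr.fix_eq]
    exact hT _ _ _ fun k hk => by simp [hk]
  · intro y hy
    funext i
    induction i using hr.induction with
    | _ i ih =>
      rw [hr.fix_eq, hy]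
      exact hT _ _ _ fun k hk => by simp [hk, ih k hk]

/-- The equation `op f = rhs` which determines the coefficient `a` of `f` by its coefficient
`a - shift`. -/
structure CoefficientRule where
  /-- the multi-index of the leading derivative -/
  shift : Fin 3 →₀ ℕ
  /-- the leading derivative -/
  op : Formal → Formal
  /-- the right-hand side -/
  rhs : Formal → Formal → Formal

/-- The rule holds at the coefficient `a` of `f`. -/
def CoefficientRule.Holds (R : CoefficientRule) (a : Fin 3 →₀ ℕ) (f z w : Formal) : Prop :=
  coeff (a - R.shift) (R.op f) = coeff (a - R.shift) (R.rhs z w)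

/-- Each rule prescribes one coefficient by means of preceding ones, because its leading operator is
a shift with nonzero factors; this is well-founded recursion. -/
theorem existsUnique_of_rules (R : Bool → (Fin 3 →₀ ℕ) → CoefficientRule)
    (hs : ∀ s a, IsShift (R s a).shift (R s a).op) (hle : ∀ s a, (R s a).shift ≤ a)
    (hc : ∀ s a z w z' w', (∀ b, Precedes (b, false) (a, s) → coeff b z = coeff b z') →
      (∀ b, Precedes (b, true) (a, s) → coeff b w = coeff b w') →
      coeff (a - (R s a).shift) ((R s a).rhs z w) = coeff (a - (R s a).shift) ((R s a).rhs z' w')) :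
    ∃! q : Formal × Formal, (∀ a, (R false a).Holds a q.1 q.1 q.2) ∧
      ∀ a, (R true a).Holds a q.2 q.1 q.2 := by
  choose σ hσ hop using hs
  let fz : ((Fin 3 →₀ ℕ) × Bool → ℂ) → Formal := fun x a => x (a, false)
  let fw : ((Fin 3 →₀ ℕ) × Bool → ℂ) → Formal := fun x a => x (a, true)
  let T : ((Fin 3 →₀ ℕ) × Bool → ℂ) → (Fin 3 →₀ ℕ) × Bool → ℂ := fun x i =>
    (σ i.2 i.1 (i.1 - (R i.2 i.1).shift))⁻¹ *
      coeff (i.1 - (R i.2 i.1).shift) ((R i.2 i.1).rhs (fz x) (fw x))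
  have key : ∀ s a f z w, (R s a).Holds a f z w ↔ coeff a f =
      (σ s a (a - (R s a).shift))⁻¹ * coeff (a - (R s a).shift) ((R s a).rhs z w) := by
    intro s a f z w
    rw [CoefficientRule.Holds, hop, tsub_add_cancel_of_le (hle s a), eq_inv_mul_iff_mul_eq₀ (hσ _ _ _)]
  obtain ⟨x, hx, hu⟩ := existsUnique_fixedPoint precedes_wf T fun x y i h => by
    simp only [T]
    congr 1
    exact hc _ _ _ _ _ _ (fun b hb => h _ hb) (fun b hb => h _ hb)
  refine ⟨(fz x, fw x), ⟨fun a => (key _ _ _ _ _).mpr (hx (a, false)),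
    fun a => (key _ _ _ _ _).mpr (hx (a, true))⟩, ?_⟩
  rintro ⟨z, w⟩ ⟨hz, hw⟩
  have := hu (fun i => cond i.2 (coeff i.1 w) (coeff i.1 z)) fun i => by
    obtain ⟨a, s⟩ := i
    cases s
    · exact (key _ _ _ _ _).mp (hz a)
    · exact (key _ _ _ _ _).mp (hw a)
  rw [← this]
  rfl

/-- `F z w` involves only `z_η` and derivatives of `z`, `w` with respect to `t`. -/
def Causal (F : Formal → Formal → Formal) : Prop :=
  ∀ L : LowerSet (Fin 3 →₀ ℕ), 0 ∈ L → ∀ z w z' w' : Formal, fd 2 z - fd 2 z' ∈ vanishingIdeal L →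
    (∀ k, (fd 0)^[k] z - (fd 0)^[k] z' ∈ vanishingIdeal L) →
    (∀ k, (fd 0)^[k] w - (fd 0)^[k] w' ∈ vanishingIdeal L) →
    F z w - F z' w' ∈ vanishingIdeal L

/-- `P z` involves only derivatives of `z` with respect to `t` of order less than `n`. -/
def CausalBelow (n : ℕ) (P : Formal → Formal) : Prop :=
  ∀ L : LowerSet (Fin 3 →₀ ℕ), 0 ∈ L → ∀ z z' : Formal,
    (∀ k < n, (fd 0)^[k] z - (fd 0)^[k] z' ∈ vanishingIdeal L) → P z - P z' ∈ vanishingIdeal L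

/-- The equations that determine `z` and `w` recursively from their parametric coefficients:
`z_ξ = i z_tt`, `w_ξ = - i w_tt`, the equation for `∂_t^r z_η` and `w_η` at `ξ = 0`, and the equations
for `∂_t^n z` and `∂_t^n w` at `ξ = η = 0`. -/
structure Recursion (n r : ℕ) (F H : Formal → Formal → Formal) (P Q : Formal → Formal)
    (z₀ w₀ z w : Formal) : Prop where
  z_xi : fd 1 z = Complex.I • fd 0 (fd 0 z)
  w_xi : fd 1 w = -(Complex.I • fd 0 (fd 0 w))
  z_eta : ∀ a, a 1 = 0 → coeff a (fd 2 ((fd 0)^[r] z)) = coeff a (F z w)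
  w_eta : ∀ a, a 1 = 0 → coeff a (fd 2 w) = coeff a (H z w)
  z_t : ∀ a, a 1 = 0 → a 2 = 0 → coeff a ((fd 0)^[n] z) = coeff a (P z)
  w_t : ∀ a, a 1 = 0 → a 2 = 0 → coeff a ((fd 0)^[n] w) = coeff a (Q w)
  z_param : ∀ a, a 1 = 0 → (a 2 = 0 → a 0 < n) → (a 2 ≠ 0 → a 0 < r) → coeff a z = coeff a z₀
  w_param : ∀ a, a 1 = 0 → a 2 = 0 → a 0 < n → coeff a w = coeff a w₀

/-- The rules for the coefficients of `z`. -/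
noncomputable def zRule (n r : ℕ) (F : Formal → Formal → Formal) (P : Formal → Formal)
    (z₀ : Formal) (a : Fin 3 →₀ ℕ) : CoefficientRule :=
  if a 1 ≠ 0 then ⟨Finsupp.single 1 1, fd 1, fun z _ => Complex.I • fd 0 (fd 0 z)⟩
  else if a 2 ≠ 0 then
    if r ≤ a 0 then ⟨Finsupp.single 2 1 + Finsupp.single 0 r, fun f => fd 2 ((fd 0)^[r] f), F⟩
    else ⟨0, id, fun _ _ => z₀⟩
  else if n ≤ a 0 then ⟨Finsupp.single 0 n, (fd 0)^[n], fun z _ => P z⟩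
  else ⟨0, id, fun _ _ => z₀⟩

/-- The rules for the coefficients of `w`. -/
noncomputable def wRule (n : ℕ) (H : Formal → Formal → Formal) (Q : Formal → Formal)
    (w₀ : Formal) (a : Fin 3 →₀ ℕ) : CoefficientRule :=
  if a 1 ≠ 0 then ⟨Finsupp.single 1 1, fd 1, fun _ w => -(Complex.I • fd 0 (fd 0 w))⟩
  else if a 2 ≠ 0 then ⟨Finsupp.single 2 1, fd 2, H⟩
  else if n ≤ a 0 then ⟨Finsupp.single 0 n, (fd 0)^[n], fun _ w => Q w⟩
  else ⟨0, id, fun _ _ => w₀⟩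

theorem index_le_iff {a b : Fin 3 →₀ ℕ} : a ≤ b ↔ a 0 ≤ b 0 ∧ a 1 ≤ b 1 ∧ a 2 ≤ b 2 := by
  rw [Finsupp.le_def, Fin.forall_fin_succ, Fin.forall_fin_two]
  rfl

theorem coeff_fd_eq {f g : Formal} {i : Fin 3} {a : Fin 3 →₀ ℕ}
    (h : coeff (a + Finsupp.single i 1) f = coeff (a + Finsupp.single i 1) g) :
    coeff a (fd i f) = coeff a (fd i g) := ((isShift_fd i).coeff_eq_iff a f g).mpr h

theorem iterate_sub_mem {L : LowerSet (Fin 3 →₀ ℕ)} {z z' : Formal} (k : ℕ)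
    (h : ∀ a ∈ L, coeff (a + Finsupp.single 0 k) z = coeff (a + Finsupp.single 0 k) z') :
    (fd 0)^[k] z - (fd 0)^[k] z' ∈ vanishingIdeal L := fun a ha => by
  rw [map_sub, sub_eq_zero, (isShift_iterate 0 k).coeff_eq_iff]
  exact h a ha

theorem fd_sub_mem {L : LowerSet (Fin 3 →₀ ℕ)} {z z' : Formal} (i : Fin 3)
    (h : ∀ a ∈ L, coeff (a + Finsupp.single i 1) z = coeff (a + Finsupp.single i 1) z') :
    fd i z - fd i z' ∈ vanishingIdeal L := fun a ha => by
  rw [map_sub, sub_eq_zero, (isShift_fd i).coeff_eq_iff]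
  exact h a ha

variable {n r : ℕ} {F H : Formal → Formal → Formal} {P Q : Formal → Formal}

theorem recursion_iff (z₀ w₀ z w : Formal) : Recursion n r F H P Q z₀ w₀ z w ↔
    (∀ a, (zRule n r F P z₀ a).Holds a z z w) ∧ ∀ a, (wRule n H Q w₀ a).Holds a w z w := by
  constructor
  · intro h
    constructor
    · intro a
      unfold zRule
      split_ifs with h1 h2 h3 h4
      · exact congrArg _ h.z_xi
      · exact h.z_eta _ (by simp at h1 ⊢; exact h1)
      · simpa [CoefficientRule.Holds] using h.z_param a (by simpa using h1) (fun h => absurd h h2)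
          (fun _ => not_le.mp h3)
      · exact h.z_t _ (by simp at h1 ⊢; exact h1) (by simp at h2 ⊢; exact h2)
      · simpa [CoefficientRule.Holds] using h.z_param a (by simpa using h1) (fun _ => not_le.mp h4)
          (fun h => absurd h h2)
    · intro a
      unfold wRule
      split_ifs with h1 h2 h4
      · exact congrArg _ h.w_xi
      · exact h.w_eta _ (by simp at h1 ⊢; exact h1)
      · exact h.w_t _ (by simp at h1 ⊢; exact h1) (by simp at h2 ⊢; exact h2)
      · simpa [CoefficientRule.Holds] using h.w_param a (by simpa using h1) (by simpa using h2)
          (not_le.mp h4)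
  · rintro ⟨hz, hw⟩
    refine ⟨?_, ?_, fun a h1 => ?_, fun a h1 => ?_, fun a h1 h2 => ?_, fun a h1 h2 => ?_,
      fun a h1 h2 h3 => ?_, fun a h1 h2 h3 => ?_⟩
    · ext a
      have := hz (a + Finsupp.single 1 1)
      rw [zRule, if_pos (by simp)] at this
      simpa [CoefficientRule.Holds] using this
    · ext a
      have := hw (a + Finsupp.single 1 1)
      rw [wRule, if_pos (by simp)] at this
      simpa [CoefficientRule.Holds] using this
    · have := hz (a + (Finsupp.single 2 1 + Finsupp.single 0 r))
      rw [zRule, if_neg (by simp [h1]), if_pos (by simp), if_pos (by simp)] at this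
      simpa only [CoefficientRule.Holds, add_tsub_cancel_right] using this
    · have := hw (a + Finsupp.single 2 1)
      rw [wRule, if_neg (by simp [h1]), if_pos (by simp)] at this
      simpa only [CoefficientRule.Holds, add_tsub_cancel_right] using this
    · have := hz (a + Finsupp.single 0 n)
      rw [zRule, if_neg (by simp [h1]), if_neg (by simp [h2]), if_pos (by simp)] at this
      simpa only [CoefficientRule.Holds, add_tsub_cancel_right] using this
    · have := hw (a + Finsupp.single 0 n)
      rw [wRule, if_neg (by simp [h1]), if_neg (by simp [h2]), if_pos (by simp)] at this
      simpa only [CoefficientRule.Holds, add_tsub_cancel_right] using this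
    · have := hz a
      by_cases h4 : a 2 = 0
      · rw [zRule, if_neg (by simp [h1]), if_neg (by simp [h4]), if_neg (not_le.mpr (h2 h4))] at this
        simpa [CoefficientRule.Holds] using this
      · rw [zRule, if_neg (by simp [h1]), if_pos h4, if_neg (not_le.mpr (h3 h4))] at this
        simpa [CoefficientRule.Holds] using this
    · have := hw a
      rw [wRule, if_neg (by simp [h1]), if_neg (by simp [h2]), if_neg (not_le.mpr h3)] at this
      simpa [CoefficientRule.Holds] using this

/-- Lowering the ξ-degree pays for two t-derivatives, and lowering the η-degree for any number of
them. The term z_η in the equation for ∂_t^r z_η is admissible because r > 0; in the equation for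
w_η it has the same multi-index as the unknown and is admissible because z precedes w. -/
theorem existsUnique_recursion (hr : 0 < r) (hF : Causal F) (hH : Causal H) (hP : CausalBelow n P)
    (hQ : CausalBelow n Q) (z₀ w₀ : Formal) :
    ∃! q : Formal × Formal, Recursion n r F H P Q z₀ w₀ q.1 q.2 := by
  simp only [recursion_iff]
  refine existsUnique_of_rules (fun s a => cond s (wRule n H Q w₀ a) (zRule n r F P z₀ a)) ?_ ?_ ?_
  · rintro (_ | _) a
    · simp only [cond_false, zRule]
      split_ifs
      · exact isShift_fd 1
      · exact (isShift_fd 2).comp (isShift_iterate 0 r)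
      · exact isShift_id
      · exact isShift_iterate 0 n
      · exact isShift_id
    · simp only [cond_true, wRule]
      split_ifs
      · exact isShift_fd 1
      · exact isShift_fd 2
      · exact isShift_iterate 0 n
      · exact isShift_id
  · rintro (_ | _) a
    · simp only [cond_false, zRule]
      split_ifs <;> simp [index_le_iff] <;> omega
    · simp only [cond_true, wRule]
      split_ifs <;> simp [index_le_iff] <;> omega
  · intro s a z w z' w' hz hw
    have eq_of_mem : ∀ {b : Fin 3 →₀ ℕ} {f g : Formal},
        f - g ∈ vanishingIdeal (LowerSet.Iic b) → coeff b f = coeff b g := fun {b f g} h => by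
      have := h b (LowerSet.mem_Iic_iff.mpr le_rfl)
      rwa [map_sub, sub_eq_zero] at this
    have h0 : ∀ b : Fin 3 →₀ ℕ, 0 ∈ LowerSet.Iic b := fun b => LowerSet.mem_Iic_iff.mpr zero_le
    simp only [Precedes] at hz hw
    rcases s with _ | _
    · simp only [cond_false, zRule]
      split_ifs with h1 h2 h3 h4
      · simp only [map_smul]
        congr 1
        refine coeff_fd_eq (coeff_fd_eq (hz _ ?_))
        simp; omega
      · refine eq_of_mem (hF _ (h0 _) _ _ _ _ (fd_sub_mem 2 fun b hb => hz _ ?_)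
          (fun k => iterate_sub_mem k fun b hb => hz _ ?_)
          (fun k => iterate_sub_mem k fun b hb => hw _ ?_)) <;>
        · rw [LowerSet.mem_Iic_iff, index_le_iff] at hb
          simp at hb h1 ⊢
          omega
      · rfl
      · refine eq_of_mem (hP _ (h0 _) _ _ fun k hk => iterate_sub_mem k fun b hb => hz _ ?_)
        rw [LowerSet.mem_Iic_iff, index_le_iff] at hb
        simp at hb h1 h2 ⊢
        omega
      · rfl
    · simp only [cond_true, wRule]
      split_ifs with h1 h2 h4
      · simp only [map_smul, map_neg]
        congr 2
        refine coeff_fd_eq (coeff_fd_eq (hw _ ?_))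
        simp; omega
      · refine eq_of_mem (hH _ (h0 _) _ _ _ _ (fd_sub_mem 2 fun b hb => hz _ ?_)
          (fun k => iterate_sub_mem k fun b hb => hz _ ?_)
          (fun k => iterate_sub_mem k fun b hb => hw _ ?_)) <;>
        · rw [LowerSet.mem_Iic_iff, index_le_iff] at hb
          simp at hb h1 ⊢
          omega
      · refine eq_of_mem (hQ _ (h0 _) _ _ fun k hk => iterate_sub_mem k fun b hb => hw _ ?_)
        rw [LowerSet.mem_Iic_iff, index_le_iff] at hb
        simp at hb h1 h2 ⊢
        omega
      · rfl

end FormalCauchyProblem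

/-! ### Vanishing of defects that satisfy evolution equations -/

section ErrorPropagation

open MvPowerSeries

/-- The multi-indices of degree at most `n` in `ξ`. -/
def xiLevel (n : ℕ) : LowerSet (Fin 3 →₀ ℕ) := ⟨{a | a 1 ≤ n}, fun _ _ h h' => (h 1).trans h'⟩

/-- The multi-indices of degree zero in `ξ` and at most `n` in `η`. -/
def etaLevel (n : ℕ) : LowerSet (Fin 3 →₀ ℕ) :=
  ⟨{a | a 1 = 0 ∧ a 2 ≤ n}, fun _ _ h h' => ⟨Nat.le_zero.mp ((h 1).trans h'.1.le), (h 2).trans h'.2⟩⟩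

theorem mem_xiLevel {n : ℕ} {a : Fin 3 →₀ ℕ} : a ∈ xiLevel n ↔ a 1 ≤ n := Iff.rfl

theorem mem_etaLevel {n : ℕ} {a : Fin 3 →₀ ℕ} : a ∈ etaLevel n ↔ a 1 = 0 ∧ a 2 ≤ n := Iff.rfl

theorem fd_mem_vanishingIdeal {L : LowerSet (Fin 3 →₀ ℕ)} {i : Fin 3}
    (hL : ∀ a ∈ L, a + Finsupp.single i 1 ∈ L) {f : Formal} (hf : f ∈ vanishingIdeal L) :
    fd i f ∈ vanishingIdeal L := fun a ha => by rw [coeff_pderiv, hf _ (hL a ha), zero_mul]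

theorem fd_mem_xiLevel {n : ℕ} {f : Formal} (hf : f ∈ vanishingIdeal (xiLevel n)) :
    fd 0 f ∈ vanishingIdeal (xiLevel n) :=
  fd_mem_vanishingIdeal (fun a ha => by rw [mem_xiLevel] at ha ⊢; simpa using ha) hf

theorem fd_mem_etaLevel {n : ℕ} {f : Formal} (hf : f ∈ vanishingIdeal (etaLevel n)) :
    fd 0 f ∈ vanishingIdeal (etaLevel n) :=
  fd_mem_vanishingIdeal (fun a ha => by rw [mem_etaLevel] at ha ⊢; simpa using ha) hf

theorem mem_etaLevel_of_mem_xiLevel {n : ℕ} {f : Formal} (hf : f ∈ vanishingIdeal (xiLevel 0)) :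
    f ∈ vanishingIdeal (etaLevel n) := fun a ha => hf a (by rw [mem_xiLevel, ha.1])

theorem coeff_eq_zero_of_fd {f : Formal} {i : Fin 3} {a : Fin 3 →₀ ℕ} (ha : a i ≠ 0)
    (h : coeff (a - Finsupp.single i 1) (fd i f) = 0) : coeff a f = 0 := by
  obtain ⟨s, hs, hD⟩ := isShift_fd i
  rw [hD, tsub_add_cancel_of_le (Finsupp.single_le_iff.mpr (Nat.one_le_iff_ne_zero.mpr ha))] at h
  exact (mul_eq_zero.mp h).resolve_left (hs _)

/-- A series vanishing at `ξ = 0` vanishes if its `ξ`-derivative vanishes to the order to which it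
vanishes itself. -/
theorem eq_zero_of_xi_evolution {f : Formal} (h0 : f ∈ vanishingIdeal (xiLevel 0))
    (h : ∀ n, f ∈ vanishingIdeal (xiLevel n) → fd 1 f ∈ vanishingIdeal (xiLevel n)) : f = 0 := by
  have key : ∀ n, f ∈ vanishingIdeal (xiLevel n) := by
    intro n
    induction n with
    | zero => exact h0
    | succ n ih =>
      intro a ha
      by_cases h1 : a 1 ≤ n
      · exact ih a h1
      · refine coeff_eq_zero_of_fd (i := 1) (by omega) (h n ih _ ?_)
        rw [mem_xiLevel] at ha ⊢
        simpa using ha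
  ext a
  exact key (a 1) a (mem_xiLevel.mpr le_rfl)

theorem eq_zero_of_heat {f : Formal} (c : ℂ) (h0 : f ∈ vanishingIdeal (xiLevel 0))
    (h : fd 1 f = c • fd 0 (fd 0 f)) : f = 0 :=
  eq_zero_of_xi_evolution h0 fun n hn => by
    rw [h]
    exact smul_mem_vanishingIdeal c (fd_mem_xiLevel (fd_mem_xiLevel hn))

/-- Two series vanishing at `ξ = η = 0` vanish at `ξ = 0` if their `η`-derivatives there vanish to the
order to which they vanish themselves. -/
theorem mem_xiLevel_of_eta_evolution {f g : Formal} (hf : f ∈ vanishingIdeal (etaLevel 0))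
    (hg : g ∈ vanishingIdeal (etaLevel 0))
    (h : ∀ n, f ∈ vanishingIdeal (etaLevel n) → g ∈ vanishingIdeal (etaLevel n) →
      fd 2 f ∈ vanishingIdeal (etaLevel n) ∧ fd 2 g ∈ vanishingIdeal (etaLevel n)) :
    f ∈ vanishingIdeal (xiLevel 0) ∧ g ∈ vanishingIdeal (xiLevel 0) := by
  have step : ∀ {f : Formal} {n : ℕ}, f ∈ vanishingIdeal (etaLevel n) →
      fd 2 f ∈ vanishingIdeal (etaLevel n) → f ∈ vanishingIdeal (etaLevel (n + 1)) := by
    intro f n ih h' a ha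
    by_cases h1 : a 2 ≤ n
    · exact ih a ⟨ha.1, h1⟩
    · refine coeff_eq_zero_of_fd (i := 2) (by omega) (h' _ ?_)
      rw [mem_etaLevel] at ha ⊢
      simpa using ha
  have key : ∀ n, f ∈ vanishingIdeal (etaLevel n) ∧ g ∈ vanishingIdeal (etaLevel n) := by
    intro n
    induction n with
    | zero => exact ⟨hf, hg⟩
    | succ n ih => exact ⟨step ih.1 (h n ih.1 ih.2).1, step ih.2 (h n ih.1 ih.2).2⟩
  exact ⟨fun a ha => (key (a 2)).1 a ⟨Nat.le_zero.mp ha, le_rfl⟩,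
    fun a ha => (key (a 2)).2 a ⟨Nat.le_zero.mp ha, le_rfl⟩⟩

/-- The defects of the two t-equations are handled jointly since their η-evolution may be coupled:
first they vanish at ξ = 0, then everywhere by the Schrödinger equations. -/
theorem eq_zero_of_eta_evolution {f g : Formal} (hf : f ∈ vanishingIdeal (etaLevel 0))
    (hg : g ∈ vanishingIdeal (etaLevel 0))
    (h : ∀ n, f ∈ vanishingIdeal (etaLevel n) → g ∈ vanishingIdeal (etaLevel n) →
      fd 2 f ∈ vanishingIdeal (etaLevel n) ∧ fd 2 g ∈ vanishingIdeal (etaLevel n))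
    (hf' : fd 1 f = Complex.I • fd 0 (fd 0 f)) (hg' : fd 1 g = -(Complex.I • fd 0 (fd 0 g))) :
    f = 0 ∧ g = 0 := by
  obtain ⟨h1, h2⟩ := mem_xiLevel_of_eta_evolution hf hg h
  exact ⟨eq_zero_of_heat _ h1 hf', eq_zero_of_heat (-Complex.I) h2 (by rw [hg', neg_smul])⟩

/-- Series modulo the ideal of a lower set of multi-indices. -/
noncomputable abbrev jet (L : LowerSet (Fin 3 →₀ ℕ)) : Formal →ₐ[ℂ] Formal ⧸ vanishingIdeal L :=
  Ideal.Quotient.mkₐ ℂ (vanishingIdeal L)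

theorem jet_eq_iff {L : LowerSet (Fin 3 →₀ ℕ)} {f g : Formal} :
    jet L f = jet L g ↔ f - g ∈ vanishingIdeal L := Ideal.Quotient.eq

theorem jet_eq_zero_iff {L : LowerSet (Fin 3 →₀ ℕ)} {f : Formal} :
    jet L f = 0 ↔ f ∈ vanishingIdeal L := Ideal.Quotient.eq_zero_iff_mem

theorem jet_inv_congr {L : LowerSet (Fin 3 →₀ ℕ)} (hL : 0 ∈ L) {f g : Formal}
    (h : jet L f = jet L g) : jet L f⁻¹ = jet L g⁻¹ :=
  jet_eq_iff.mpr (inv_sub_inv_mem hL (jet_eq_iff.mp h))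

/-- The derivation with respect to `t` modulo the ideal of `etaLevel n`. -/
noncomputable def jetT (n : ℕ) : Derivation ℂ (Formal ⧸ vanishingIdeal (etaLevel n))
    (Formal ⧸ vanishingIdeal (etaLevel n)) :=
  Derivation.liftOfSurjective (f := jet (etaLevel n)) (d := fd 0)
    (Ideal.Quotient.mkₐ_surjective _ _) fun _ hf =>
      jet_eq_zero_iff.mpr (fd_mem_etaLevel (jet_eq_zero_iff.mp hf))

theorem jetT_jet (n : ℕ) (f : Formal) : jetT n (jet (etaLevel n) f) = jet (etaLevel n) (fd 0 f) :=
  Derivation.liftOfSurjective_apply _ (fun _ hf =>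
    jet_eq_zero_iff.mpr (fd_mem_etaLevel (jet_eq_zero_iff.mp hf))) f

end ErrorPropagation

/-! ### Compatibility identities for (A) and (B) -/

section Identities

variable {S : Type*} [CommRing S] [Algebra ℂ S] {dt dx : Derivation ℂ S S}

attribute [local simp] Derivation.leibniz Derivation.leibniz_pow derivation_ofNat

theorem derivation_inverse (d : Derivation ℂ S S) {u ui : S} (h : u * ui = 1) :
    d ui = -(ui * ui * d u) := by
  have h1 := congrArg d h
  rw [Derivation.leibniz, Derivation.map_one_eq_zero, smul_eq_mul, smul_eq_mul] at h1
  linear_combination ui * h1 - d ui * h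

theorem stationary_conj_eta {u v p r ui : S} (hui : u * ui = 1) (u_t : dt u = 0) (v_t : dt v = 0)
    (p_tt : dt (dt p) = 0) (hr : r = (-(p * v) - 2) * ui) : dt (dt r) = 0 := by
  have ui_t := derivation_inverse dt hui
  rw [u_t, mul_zero, neg_zero] at ui_t
  rw [hr]
  simp [u_t, v_t, ui_t, p_tt]

/-- With p_tt = u_η and r_tt = v_η, the last two conclusions are the η-derivatives of u_t = iNu and
v_t = -iNv. The coefficient N_η/N² of z_tη is the one that makes them hold. -/
theorem rotating_eta {u v p r ui j N N' kap : S} (hj : j * j = -1) (j_t : dt j = 0) (N_t : dt N = 0)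
    (kap_t : dt kap = 0) (hkap : kap * N ^ 2 = N') (hui : u * ui = 1) (u_t : dt u = j * (N * u))
    (v_t : dt v = -(j * (N * v))) (p_t : dt p = j * (N * p) - j * (kap * u))
    (hr : r = (-(p * v) - 2) * ui) :
    dt r = j * (kap * v) - j * (N * r) ∧
    dt (dt (dt p)) = j * (N * dt (dt p)) + j * (N' * u) ∧
    dt (dt (dt r)) = -(j * (N * dt (dt r))) - j * (N' * v) := by
  have ui_t := derivation_inverse dt hui
  have r_t : dt r = j * (kap * v) - j * (N * r) := by
    rw [hr]
    simp only [Derivation.leibniz, smul_eq_mul, map_sub, map_neg, derivation_ofNat, ui_t, u_t, v_t,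
      p_t]
    linear_combination (j * v * kap + (p * v + 2) * ui * j * N) * hui
  refine ⟨r_t, ?_, ?_⟩
  · rw [p_t]
    simp only [Derivation.leibniz, smul_eq_mul, map_sub, j_t, N_t, kap_t, u_t, map_add, mul_zero,
      add_zero, zero_add, p_t]
    linear_combination (-j * N ^ 2 * kap * u) * hj + j * u * hkap
  · rw [r_t]
    simp only [Derivation.leibniz, smul_eq_mul, map_sub, j_t, N_t, kap_t, v_t, map_add, mul_zero,
      map_neg, add_zero, zero_add, r_t]
    linear_combination (j * N ^ 2 * kap * v) * hj - j * v * hkap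

theorem stationary_conj_evolution {u v p r ui j : S} (hui : u * ui = 1) (u_t : dt u = 0)
    (v_t : dt v = 0) (p_tt : dt (dt p) = 0) (u_x : dx u = j * dt (dt u))
    (v_x : dx v = -(j * dt (dt v))) (p_x : dx p = j * dt (dt p)) (r_x : dx r = -(j * dt (dt r))) :
    dx (r - (-(p * v) - 2) * ui) = -(j * dt (dt (r - (-(p * v) - 2) * ui))) := by
  have ui_t := derivation_inverse dt hui
  have ui_x := derivation_inverse dx hui
  simp only [Derivation.leibniz, smul_eq_mul, map_sub, map_neg, map_add, derivation_ofNat, ui_t,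
    ui_x, u_t, v_t, p_tt, u_x, v_x, p_x, r_x, map_zero, mul_zero, neg_zero, add_zero, sub_zero]

/-- The expression (-(p v) - 2)/u itself solves q_ξ = -i q_tt, like r, and hence so does the defect.
-/
theorem rotating_conj_evolution {u v p r ui j N kap : S} (hj : j * j = -1) (j_t : dt j = 0)
    (N_t : dt N = 0) (kap_t : dt kap = 0) (hui : u * ui = 1) (u_t : dt u = j * (N * u))
    (v_t : dt v = -(j * (N * v))) (p_t : dt p = j * (N * p) - j * (kap * u))
    (u_x : dx u = j * dt (dt u)) (v_x : dx v = -(j * dt (dt v))) (p_x : dx p = j * dt (dt p))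
    (r_x : dx r = -(j * dt (dt r))) :
    dx (r - (-(p * v) - 2) * ui) = -(j * dt (dt (r - (-(p * v) - 2) * ui))) := by
  have ui_x := derivation_inverse dx hui
  obtain ⟨q, hq⟩ : ∃ q, q = (-(p * v) - 2) * ui := ⟨_, rfl⟩
  have q_t := (rotating_eta hj j_t N_t kap_t rfl hui u_t v_t p_t hq).1
  rw [← hq, map_sub, map_sub, map_sub, r_x, q_t]
  rw [u_t] at u_x
  rw [v_t] at v_x
  rw [p_t] at p_x
  simp only [Derivation.leibniz, smul_eq_mul, map_sub, j_t, N_t, kap_t, u_t, v_t, p_t, map_add,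
    mul_zero, map_neg, add_zero, zero_add] at u_x v_x p_x
  have q_x : dx q = -(j * (j * (kap * dt v) - j * (N * dt q))) := by
    rw [q_t, v_t, hq]
    simp only [Derivation.leibniz, smul_eq_mul, map_sub, map_neg, derivation_ofNat, ui_x, u_x, v_x,
      p_x]
    linear_combination (j ^ 3 * (2 * N * kap * v + (p * v + 2) * N ^ 2 * ui)) * hui
  rw [q_x]
  simp only [Derivation.leibniz, smul_eq_mul, map_sub, j_t, N_t, kap_t, mul_zero, add_zero]
  ring

end Identities

/-! ### Compatibility identities for (C): the modified Wronskian -/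

section LinearIdentities

variable {S : Type*} [CommRing S] [Algebra ℂ S] {dt dx : Derivation ℂ S S}

/-- For `u`, `v` satisfying conjugate linear equations of second order, the equations for `p_t` and `r`
in terms of the quotient `q` and the inverse `Oi` of a Wronskian. -/
theorem exists_wronskian_form {u v p ui D Di j k K : S} (hj : j * j = -1) (j_t : dt j = 0)
    (k_t : dt k = 0) (hui : u * ui = 1)
    (hD : D = j * (u * dt v) - j * (v * dt u) - 2 * k * (u * v)) (hDi : u * D * Di = 1)
    (u_tt : dt (dt u) = 2 * j * k * dt u + K * u)
    (v_tt : dt (dt v) = -(2 * j * k * dt v) + K * v) :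
    ∃ q Oi, dt Oi = 0 ∧ (dt u * v - u * dt v - 2 * j * k * (u * v)) * Oi = 1 ∧
      p = q * u - 2 * (dt u - j * k * u) * Oi ∧
      dt p - (p * dt u * ui - 2 * j * ((dt u ^ 2 - 2 * j * k * (u * dt u) - K * u ^ 2) * Di))
        = u * dt q ∧
      (-(p * v) - 2) * ui = -(q * v) + 2 * (dt v + j * k * v) * Oi := by
  have hDOi : (j * D) * (-(j * u * Di)) = 1 := by linear_combination hDi - u * D * Di * hj
  have hO : j * D = dt u * v - u * dt v - 2 * j * k * (u * v) := by
    rw [hD]; linear_combination (u * dt v - v * dt u) * hj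
  -- jD = u_t v - u v_t - 2jk u v is constant in t: the term with k compensates the first-order
  -- terms of the two linear equations.
  have O_t : dt (j * D) = 0 := by
    rw [hO]
    simp only [Derivation.leibniz, smul_eq_mul, map_sub, derivation_ofNat, j_t, k_t, u_tt, v_tt]
    ring
  have Oi_t := derivation_inverse dt hDOi
  rw [O_t, mul_zero, neg_zero] at Oi_t
  obtain ⟨Oi, hOi⟩ : ∃ Oi, Oi = -(j * u * Di) := ⟨_, rfl⟩
  rw [← hOi] at Oi_t hDOi
  rw [hO] at hDOi
  -- Variation of constants: p is q u plus a particular solution, so that the equation for p_t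
  -- becomes q_t = 0 and the one for r becomes its counterpart with v.
  obtain ⟨q, hq⟩ : ∃ q, q = (p + 2 * (dt u - j * k * u) * Oi) * ui := ⟨_, rfl⟩
  have hp : p = q * u - 2 * (dt u - j * k * u) * Oi := by
    rw [hq]; linear_combination -(p + 2 * (dt u - j * k * u) * Oi) * hui
  refine ⟨q, Oi, Oi_t, hDOi, hp, ?_, ?_⟩
  · have hu : IsUnit u := IsUnit.of_mul_eq_one _ hui
    refine hu.mul_left_cancel ?_
    have p_t := congrArg dt hp
    simp only [Derivation.leibniz, smul_eq_mul, map_sub, derivation_ofNat, j_t, k_t, u_tt,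
      Oi_t] at p_t
    linear_combination u * p_t - dt u * hp - p * dt u * hui
      + 2 * (dt u ^ 2 - 2 * j * k * (u * dt u) - K * u ^ 2) * hOi
  · rw [hq]
    linear_combination (2 * ui) * hDOi + (2 * (dt v + j * k * v) * Oi) * hui

/-- For q_t = 0, p is a combination of u and u_t with coefficients independent of t, so it solves
the linear equation of u; likewise r and v. -/
theorem linear_eta {u v p r q Oi j k K : S} (j_t : dt j = 0) (k_t : dt k = 0)
    (K_t : dt K = 0) (u_tt : dt (dt u) = 2 * j * k * dt u + K * u)
    (v_tt : dt (dt v) = -(2 * j * k * dt v) + K * v) (Oi_t : dt Oi = 0) (q_t : dt q = 0)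
    (hp : p = q * u - 2 * (dt u - j * k * u) * Oi)
    (hr : r = -(q * v) + 2 * (dt v + j * k * v) * Oi) :
    dt (dt p) = 2 * j * k * dt p + K * p ∧ dt (dt r) = -(2 * j * k * dt r) + K * r := by
  rw [hp, hr]
  simp only [Derivation.leibniz, smul_eq_mul, map_sub, map_add, map_neg, derivation_ofNat, j_t,
    k_t, K_t, u_tt, v_tt, Oi_t, q_t, mul_zero, zero_mul, add_zero, zero_add, map_zero]
  constructor <;> ring

/-- The Wronskian is also constant in ξ, so the particular solution obeys the Schrödinger equation
of p. The remaining q u does too, which yields an evolution equation for q containing only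
derivatives of q. -/
theorem linear_xi {u v p q Oi ui j k K : S} (comm : ∀ f, dx (dt f) = dt (dx f)) (hui : u * ui = 1)
    (j_t : dt j = 0) (k_t : dt k = 0) (K_t : dt K = 0) (j_x : dx j = 0) (k_x : dx k = 0)
    (u_tt : dt (dt u) = 2 * j * k * dt u + K * u)
    (v_tt : dt (dt v) = -(2 * j * k * dt v) + K * v)
    (u_x : dx u = j * dt (dt u)) (v_x : dx v = -(j * dt (dt v))) (p_x : dx p = j * dt (dt p))
    (Oi_t : dt Oi = 0) (hOi : (dt u * v - u * dt v - 2 * j * k * (u * v)) * Oi = 1)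
    (hp : p = q * u - 2 * (dt u - j * k * u) * Oi) :
    dx Oi = 0 ∧ dx q = j * (dt (dt q) + 2 * dt q * (dt u * ui)) := by
  rw [u_tt] at u_x
  rw [v_tt] at v_x
  have ut_x : dx (dt u) = j * (2 * j * k * dt (dt u) + K * dt u) := by
    rw [comm, u_x]
    simp only [Derivation.leibniz, smul_eq_mul, map_add, derivation_ofNat, j_t, k_t, K_t]
    ring
  have vt_x : dx (dt v) = -(j * (-(2 * j * k * dt (dt v)) + K * dt v)) := by
    rw [comm, v_x]
    simp only [Derivation.leibniz, smul_eq_mul, map_add, map_neg, derivation_ofNat, j_t, k_t, K_t]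
    ring
  have Oi_x : dx Oi = 0 := by
    rw [derivation_inverse dx hOi]
    simp only [Derivation.leibniz, smul_eq_mul, map_sub, derivation_ofNat, j_x, k_x, ut_x, vt_x,
      u_x, v_x, u_tt, v_tt]
    ring
  refine ⟨Oi_x, ?_⟩
  have hu : IsUnit u := IsUnit.of_mul_eq_one _ hui
  refine hu.mul_left_cancel ?_
  have h := p_x
  rw [hp] at h
  simp only [Derivation.leibniz, smul_eq_mul, map_sub, map_add, derivation_ofNat, j_t, k_t, K_t,
    j_x, k_x, u_x, ut_x, u_tt, Oi_t, Oi_x, mul_zero, zero_mul, add_zero, zero_add, map_zero] at h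
  linear_combination h - 2 * j * dt q * dt u * hui

theorem linear_conj_evolution {v r q Oi j k K : S} (comm : ∀ f, dx (dt f) = dt (dx f))
    (j_t : dt j = 0) (k_t : dt k = 0) (K_t : dt K = 0) (j_x : dx j = 0) (k_x : dx k = 0)
    (v_tt : dt (dt v) = -(2 * j * k * dt v) + K * v) (v_x : dx v = -(j * dt (dt v)))
    (r_x : dx r = -(j * dt (dt r))) (Oi_t : dt Oi = 0) (Oi_x : dx Oi = 0) (q_t : dt q = 0)
    (q_x : dx q = 0) :
    dx (r - (-(q * v) + 2 * (dt v + j * k * v) * Oi))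
      = -(j * dt (dt (r - (-(q * v) + 2 * (dt v + j * k * v) * Oi)))) := by
  rw [v_tt] at v_x
  have vt_x : dx (dt v) = -(j * (-(2 * j * k * dt (dt v)) + K * dt v)) := by
    rw [comm, v_x]
    simp only [Derivation.leibniz, smul_eq_mul, map_add, map_neg, derivation_ofNat, j_t, k_t, K_t]
    ring
  simp only [Derivation.leibniz, smul_eq_mul, map_sub, map_add, map_neg, derivation_ofNat, j_t,
    k_t, K_t, j_x, k_x, v_x, vt_x, v_tt, Oi_t, Oi_x, q_t, q_x, r_x, mul_zero, zero_mul, add_zero,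
    zero_add, map_zero]
  ring

end LinearIdentities

/-! ### Passivity of (A) and (B) -/

section Passivity

open MvPowerSeries

variable {n r : ℕ} {F H : Formal → Formal → Formal} {P Q : Formal → Formal}

/-- The recursion uses only part of the equations, so uniqueness is immediate. Existence requires
`hrec`, that the remaining equations follow, and `hreg`, that nonvanishing denominators depend only
on the prescribed data. -/
theorem isPassive_of_recursion {leadZ leadW : Set (Fin 3 →₀ ℕ)}
    {regular equations : Formal → Formal → Prop} (hr : 0 < r) (hF : Causal F) (hH : Causal H)
    (hP : CausalBelow n P) (hQ : CausalBelow n Q)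
    (hZ : ∀ a, (∀ l ∈ leadZ, ¬ l ≤ a) ↔
      a 1 = 0 ∧ (a 2 = 0 → a 0 < n) ∧ (a 2 ≠ 0 → a 0 < r))
    (hW : ∀ a, (∀ l ∈ leadW, ¬ l ≤ a) ↔ a 1 = 0 ∧ a 2 = 0 ∧ a 0 < n)
    (hreg : ∀ z w z' w',
      (∀ k < n, constantCoeff ((fd 0)^[k] z) = constantCoeff ((fd 0)^[k] z')) →
      (∀ k < n, constantCoeff ((fd 0)^[k] w) = constantCoeff ((fd 0)^[k] w')) →
      regular z w → regular z' w')
    (heq : ∀ z w, equations z w → Recursion n r F H P Q z w z w)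
    (hrec : ∀ z w, regular z w → Recursion n r F H P Q z w z w → equations z w) :
    IsPassive leadZ leadW regular equations := by
  intro z₀ w₀ h₀
  obtain ⟨⟨z, w⟩, h, hu⟩ := existsUnique_recursion (n := n) hr hF hH hP hQ z₀ w₀
  refine ⟨(z, w), ⟨hrec z w (hreg z₀ w₀ z w (fun k hk => ?_) (fun k hk => ?_) h₀)
    { h with z_param := fun _ _ _ _ => rfl, w_param := fun _ _ _ _ => rfl },
    fun a ha => ?_, fun a ha => ?_⟩, ?_⟩
  · refine ((isShift_iterate 0 k).coeff_eq_iff 0 z₀ z).mpr (h.z_param _ ?_ ?_ ?_).symm <;> simp [hk]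
  · refine ((isShift_iterate 0 k).coeff_eq_iff 0 w₀ w).mpr (h.w_param _ ?_ ?_ ?_).symm <;> simp [hk]
  · obtain ⟨h1, h2, h3⟩ := (hZ a).mp ha
    exact h.z_param a h1 h2 h3
  · obtain ⟨h1, h2, h3⟩ := (hW a).mp ha
    exact h.w_param a h1 h2 h3
  · rintro ⟨z', w'⟩ ⟨he, hz, hw⟩
    exact hu _ { heq z' w' he with
      z_param := fun a h1 h2 h3 => hz a ((hZ a).mpr ⟨h1, h2, h3⟩)
      w_param := fun a h1 h2 h3 => hw a ((hW a).mpr ⟨h1, h2, h3⟩) }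

theorem multiIndex_le_iff (a b c : ℕ) (l : Fin 3 →₀ ℕ) :
    multiIndex a b c ≤ l ↔ a ≤ l 0 ∧ b ≤ l 1 ∧ c ≤ l 2 := index_le_iff

theorem mem_xiLevel_of_coeff {f g : Formal} (h : ∀ a, a 1 = 0 → coeff a f = coeff a g) :
    f - g ∈ vanishingIdeal (xiLevel 0) := fun a ha => by
  rw [map_sub, h a (Nat.le_zero.mp ha), sub_self]

theorem mem_etaLevel_of_coeff {f g : Formal} (h : ∀ a, a 1 = 0 → a 2 = 0 → coeff a f = coeff a g) :
    f - g ∈ vanishingIdeal (etaLevel 0) := fun a ha => by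
  rw [map_sub, h a ha.1 (Nat.le_zero.mp ha.2), sub_self]

/-- The right-hand side of the equation solved for `w_η`. -/
noncomputable def conjEta (z w : Formal) : Formal :=
  (-(fd 2 z * fd 0 (fd 0 w)) - 2) * (fd 0 (fd 0 z))⁻¹

theorem causal_conjEta : Causal conjEta := by
  intro L h0 z w z' w' hp hz hw
  have hu : jet L (fd 0 (fd 0 z)) = jet L (fd 0 (fd 0 z')) := jet_eq_iff.mpr (hz 2)
  have hv : jet L (fd 0 (fd 0 w)) = jet L (fd 0 (fd 0 w')) := jet_eq_iff.mpr (hw 2)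
  rw [← jet_eq_iff] at hp ⊢
  simp only [conjEta, map_mul, map_sub, map_neg, hp, hv, jet_inv_congr h0 hu]

theorem I_smul_eq (f : Formal) : Complex.I • f = algebraMap ℂ Formal Complex.I * f :=
  Algebra.smul_def _ _

theorem algebraMap_I_mul_self :
    algebraMap ℂ Formal Complex.I * algebraMap ℂ Formal Complex.I = -1 := by
  rw [← map_mul, Complex.I_mul_I, map_neg, map_one]

/-- Derivatives with respect to `ξ` of a solution of `z_ξ = i z_tt`. -/
theorem fd_xi_eq {z : Formal} {c : ℂ} (h : fd 1 z = c • fd 0 (fd 0 z)) :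
    fd 1 (fd 0 (fd 0 z)) = algebraMap ℂ Formal c * fd 0 (fd 0 (fd 0 (fd 0 z))) ∧
    fd 1 (fd 2 z) = algebraMap ℂ Formal c * fd 0 (fd 0 (fd 2 z)) := by
  constructor
  · rw [fd_comm 1 0, fd_comm 1 0, h, Derivation.map_smul, Derivation.map_smul, Algebra.smul_def]
  · rw [fd_comm 1 2, h, Derivation.map_smul, fd_comm 2 0, fd_comm 2 0, Algebra.smul_def]

theorem Recursion.xi_equations {z₀ w₀ z w : Formal} (h : Recursion n r F H P Q z₀ w₀ z w) {j : Formal}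
    (hj : j = algebraMap ℂ Formal Complex.I) :
    fd 1 (fd 0 (fd 0 z)) = j * fd 0 (fd 0 (fd 0 (fd 0 z))) ∧
    fd 1 (fd 0 (fd 0 w)) = -(j * fd 0 (fd 0 (fd 0 (fd 0 w)))) ∧
    fd 1 (fd 2 z) = j * fd 0 (fd 0 (fd 2 z)) ∧ fd 1 (fd 2 w) = -(j * fd 0 (fd 0 (fd 2 w))) := by
  have h' : fd 1 w = (-Complex.I) • fd 0 (fd 0 w) := by rw [h.w_xi, neg_smul]
  obtain ⟨h1, h2⟩ := fd_xi_eq h.z_xi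
  obtain ⟨h3, h4⟩ := fd_xi_eq h'
  rw [map_neg, ← hj, neg_mul] at h3 h4
  rw [← hj] at h1 h2
  exact ⟨h1, h3, h2, h4⟩

theorem Recursion.jet_conjEta {z₀ w₀ z w : Formal}
    (h : Recursion n r F conjEta P Q z₀ w₀ z w) (m : ℕ) :
    jet (etaLevel m) (fd 2 w) = (-(jet (etaLevel m) (fd 2 z) * jet (etaLevel m) (fd 0 (fd 0 w))) - 2)
      * jet (etaLevel m) (fd 0 (fd 0 z))⁻¹ := by
  have h1 : jet (etaLevel m) (fd 2 w) = jet (etaLevel m) (conjEta z w) :=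
    jet_eq_iff.mpr (mem_etaLevel_of_mem_xiLevel (mem_xiLevel_of_coeff h.w_eta))
  rw [h1]
  simp only [conjEta, map_mul, map_sub, map_neg, map_ofNat]

theorem jet_mul_inv {L : LowerSet (Fin 3 →₀ ℕ)} {u : Formal} (hu : constantCoeff u ≠ 0) :
    jet L u * jet L u⁻¹ = 1 := by
  rw [← map_mul, MvPowerSeries.mul_inv_cancel u hu, map_one]

theorem passiveA : PassiveA := by
  have causal0 : CausalBelow 3 (fun _ => 0) := fun L _ z z' _ => by
    rw [sub_zero]; exact Ideal.zero_mem _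
  refine isPassive_of_recursion (n := 3) (r := 2) (F := fun _ _ => 0) (H := conjEta)
    (P := fun _ => 0) (Q := fun _ => 0) two_pos (fun L _ z w z' w' _ _ _ => ?_) causal_conjEta causal0
    causal0 (fun a => ?_) (fun a => ?_) ?_ ?_ ?_
  · rw [sub_zero]; exact Ideal.zero_mem _
  · simp only [Set.mem_insert_iff, Set.mem_singleton_iff, forall_eq_or_imp, forall_eq,
      multiIndex_le_iff]
    omega
  · simp only [Set.mem_insert_iff, Set.mem_singleton_iff, forall_eq_or_imp, forall_eq,
      multiIndex_le_iff]
    omega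
  · intro z w z' w' hz _ h
    have h2 := hz 2 (by norm_num)
    exact fun h0 => h (h2.trans h0)
  · rintro z w ⟨⟨h1, h2⟩, h3, h4, h5, h6⟩
    exact ⟨h1, h2, fun a _ => congrArg (coeff a) h4, fun a _ => congrArg (coeff a) h3,
      fun a _ _ => congrArg (coeff a) h5, fun a _ _ => congrArg (coeff a) h6,
      fun _ _ _ _ => rfl, fun _ _ _ _ => rfl⟩
  · intro z w hreg h
    have hu : constantCoeff (fd 0 (fd 0 z)) ≠ 0 := hreg
    obtain ⟨j, hj⟩ : ∃ j, j = algebraMap ℂ Formal Complex.I := ⟨_, rfl⟩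
    have hI : ∀ f : Formal, Complex.I • f = j * f := fun f => by rw [I_smul_eq, hj]
    obtain ⟨u_x, v_x, p_x, r_x⟩ := h.xi_equations hj
    have hE := mem_xiLevel_of_coeff h.z_eta
    rw [sub_zero] at hE
    have hFe := mem_xiLevel_of_coeff h.w_eta
    have hT := mem_etaLevel_of_coeff h.z_t
    have hT' := mem_etaLevel_of_coeff h.w_t
    rw [sub_zero] at hT hT'
    have E0 : fd 2 (fd 0 (fd 0 z)) = 0 := by
      refine eq_zero_of_heat Complex.I hE ?_
      rw [fd_comm 1 2, u_x, ← hI, Derivation.map_smul, fd_comm 2 0, fd_comm 2 0]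
    have p_tt : fd 0 (fd 0 (fd 2 z)) = 0 := by rw [← E0, fd_comm 2 0, fd_comm 2 0]
    -- The equation for w_η is known only at ξ = 0, so the argument runs modulo `etaLevel m`, where
    -- ∂_t still acts; η-derivatives enter through z_η and w_η as separate elements.
    obtain ⟨T0, T0'⟩ : fd 0 (fd 0 (fd 0 z)) = 0 ∧ fd 0 (fd 0 (fd 0 w)) = 0 := by
      refine eq_zero_of_eta_evolution hT hT' (fun m hm hm' => ⟨?_, ?_⟩) ?_ ?_
      · rw [fd_comm 2 0, E0, map_zero]
        exact Ideal.zero_mem _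
      · rw [fd_comm 2 0, fd_comm 2 0, fd_comm 2 0]
        refine fd_mem_etaLevel (jet_eq_zero_iff.mp ?_)
        rw [← jetT_jet, ← jetT_jet]
        have e1 : jet (etaLevel m) (fd 0 (fd 0 (fd 0 z))) = 0 := jet_eq_zero_iff.mpr hm
        have e2 : jet (etaLevel m) (fd 0 (fd 0 (fd 0 w))) = 0 := jet_eq_zero_iff.mpr hm'
        refine stationary_conj_eta (jet_mul_inv hu) ?_ ?_ ?_ (h.jet_conjEta m)
        · rw [jetT_jet, e1]
        · rw [jetT_jet, e2]
        · rw [jetT_jet, jetT_jet, p_tt, map_zero]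
      · rw [fd_comm 1 0, u_x, ← hI, Derivation.map_smul]
      · rw [fd_comm 1 0, v_x, ← hI, map_neg, Derivation.map_smul]
    refine ⟨⟨h.z_xi, h.w_xi⟩, ?_, E0, T0, T0'⟩
    have hf := stationary_conj_evolution (dt := fd 0) (dx := fd 1) (MvPowerSeries.mul_inv_cancel _ hu)
      T0 T0' p_tt u_x v_x p_x r_x
    refine sub_eq_zero.mp (eq_zero_of_heat (-Complex.I) hFe ?_)
    rw [neg_smul, hI]
    exact hf

theorem fd_algebraMap (i : Fin 3) (c : ℂ) : fd i (algebraMap ℂ Formal c) = 0 :=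
  Derivation.map_algebraMap _ _

theorem passiveB {N : Formal} (hN : IsRealSeriesInEta N) (hN0 : constantCoeff N ≠ 0) :
    PassiveB N := by
  have N_t : fd 0 N = 0 := by
    ext a
    rw [coeff_pderiv, (hN _).2 (Or.inl (by simp)), zero_mul, map_zero]
  have N_x : fd 1 N = 0 := by
    ext a
    rw [coeff_pderiv, (hN _).2 (Or.inr (by simp)), zero_mul, map_zero]
  have hN2 : N ^ 2 * (N ^ 2)⁻¹ = 1 := MvPowerSeries.mul_inv_cancel _ (by simp [hN0])
  obtain ⟨kap, hkap⟩ : ∃ kap, kap = (N ^ 2)⁻¹ * fd 2 N := ⟨_, rfl⟩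
  have kap_t : fd 0 kap = 0 := by
    rw [hkap]
    simp [derivation_inverse (fd 0) hN2, N_t, fd_comm 0 2]
  have kap_x : fd 1 kap = 0 := by
    rw [hkap]
    simp [derivation_inverse (fd 1) hN2, N_x, fd_comm 1 2]
  have kap_N : kap * N ^ 2 = fd 2 N := by rw [hkap]; linear_combination fd 2 N * hN2
  obtain ⟨j, hj⟩ : ∃ j, j = algebraMap ℂ Formal Complex.I := ⟨_, rfl⟩
  have hI : ∀ f : Formal, Complex.I • f = j * f := fun f => by rw [I_smul_eq, hj]
  have hjj : j * j = -1 := by rw [hj, algebraMap_I_mul_self]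
  have hjd : ∀ i, fd i j = 0 := fun i => by rw [hj, fd_algebraMap]
  refine isPassive_of_recursion (n := 3) (r := 1)
    (F := fun z w => Complex.I • (N * fd 2 z) - Complex.I • ((N ^ 2)⁻¹ * fd 2 N * fd 0 (fd 0 z)))
    (H := conjEta) (P := fun z => Complex.I • (N * fd 0 (fd 0 z)))
    (Q := fun w => -(Complex.I • (N * fd 0 (fd 0 w)))) one_pos
    (fun L h0 z w z' w' hp hz hw => ?_) causal_conjEta (fun L h0 z z' hz => ?_)
    (fun L h0 w w' hw => ?_) (fun a => ?_) (fun a => ?_) ?_ ?_ ?_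
  · have hu : jet L (fd 0 (fd 0 z)) = jet L (fd 0 (fd 0 z')) := jet_eq_iff.mpr (hz 2)
    rw [← jet_eq_iff] at hp ⊢
    simp only [map_mul, map_sub, map_smul, hp, hu]
  · have hu : jet L (fd 0 (fd 0 z)) = jet L (fd 0 (fd 0 z')) := jet_eq_iff.mpr (hz 2 (by norm_num))
    rw [← jet_eq_iff]
    simp only [map_mul, map_smul, hu]
  · have hu : jet L (fd 0 (fd 0 w)) = jet L (fd 0 (fd 0 w')) := jet_eq_iff.mpr (hw 2 (by norm_num))
    rw [← jet_eq_iff]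
    simp only [map_mul, map_smul, map_neg, hu]
  · simp only [Set.mem_insert_iff, Set.mem_singleton_iff, forall_eq_or_imp, forall_eq,
      multiIndex_le_iff]
    omega
  · simp only [Set.mem_insert_iff, Set.mem_singleton_iff, forall_eq_or_imp, forall_eq,
      multiIndex_le_iff]
    omega
  · intro z w z' w' hz _ h
    have h2 := hz 2 (by norm_num)
    exact ⟨fun h0 => h.1 (h2.trans h0), hN0⟩
  · rintro z w ⟨⟨h1, h2⟩, h3, h4, h5, h6⟩
    exact ⟨h1, h2, fun a _ => congrArg (coeff a) h6, fun a _ => congrArg (coeff a) h3,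
      fun a _ _ => congrArg (coeff a) h4, fun a _ _ => congrArg (coeff a) h5,
      fun _ _ _ _ => rfl, fun _ _ _ _ => rfl⟩
  · intro z w hreg h
    have hu : constantCoeff (fd 0 (fd 0 z)) ≠ 0 := hreg.1
    obtain ⟨u_x, v_x, p_x, r_x⟩ := h.xi_equations hj
    have hE := mem_xiLevel_of_coeff h.z_eta
    have hFe := mem_xiLevel_of_coeff h.w_eta
    have hT := mem_etaLevel_of_coeff h.z_t
    have hT' := mem_etaLevel_of_coeff h.w_t
    simp only [← hkap, hI, Function.iterate_succ, Function.iterate_zero, Function.comp_apply,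
      id_eq] at hE hT hT'
    -- The equation is linear in z with coefficients independent of t and ξ, so its defect satisfies
    -- the Schrödinger equation directly.
    have E0 : fd 2 (fd 0 z) = j * (N * fd 2 z) - j * (kap * fd 0 (fd 0 z)) := by
      refine sub_eq_zero.mp (eq_zero_of_heat Complex.I hE ?_)
      rw [fd_comm 2 0, hI, map_sub, fd_comm 1 0, p_x]
      simp only [Derivation.leibniz, smul_eq_mul, map_sub, hjd, N_t, N_x, kap_t, kap_x, u_x, p_x,
        mul_zero, add_zero]
      ring
    have p_t : fd 0 (fd 2 z) = j * (N * fd 2 z) - j * (kap * fd 0 (fd 0 z)) := by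
      rw [← E0, fd_comm 2 0]
    have T0 : fd 0 (fd 0 (fd 0 z)) - j * (N * fd 0 (fd 0 z)) = 0 ∧
        fd 0 (fd 0 (fd 0 w)) - -(j * (N * fd 0 (fd 0 w))) = 0 := by
      refine eq_zero_of_eta_evolution hT hT' (fun m hm hm' => ?_) ?_ ?_
      · rw [← jet_eq_iff] at hm hm'
        simp only [map_mul, map_neg] at hm hm'
        obtain ⟨-, e1, e2⟩ := rotating_eta (dt := jetT m) (u := jet (etaLevel m) (fd 0 (fd 0 z)))
          (v := jet (etaLevel m) (fd 0 (fd 0 w))) (p := jet (etaLevel m) (fd 2 z))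
          (j := jet (etaLevel m) j) (N := jet (etaLevel m) N) (kap := jet (etaLevel m) kap)
          (N' := jet (etaLevel m) (fd 2 N))
          (by rw [← map_mul, hjj, map_neg, map_one]) (by rw [jetT_jet, hjd, map_zero])
          (by rw [jetT_jet, N_t, map_zero]) (by rw [jetT_jet, kap_t, map_zero])
          (by rw [← map_pow, ← map_mul, kap_N]) (jet_mul_inv hu) (by rw [jetT_jet, hm])
          (by rw [jetT_jet, hm'])
          (by rw [jetT_jet, p_t]; simp only [map_mul, map_sub]) (h.jet_conjEta m)
        simp only [jetT_jet] at e1 e2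
        constructor
        · rw [← jet_eq_zero_iff]
          simp only [map_sub, map_mul, Derivation.leibniz, smul_eq_mul, hjd, fd_comm 2 0, e1,
            map_add, map_zero, mul_zero, add_zero]
          ring
        · rw [← jet_eq_zero_iff]
          simp only [map_sub, map_mul, map_neg, Derivation.leibniz, smul_eq_mul, hjd, fd_comm 2 0, e2,
            map_add, map_zero, mul_zero, add_zero]
          ring
      · simp only [map_sub, Derivation.leibniz, smul_eq_mul, hjd, N_x, N_t, fd_comm 1 0 (fd 0 (fd 0 z)),
          u_x, hI, mul_zero, add_zero, map_add, map_zero]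
        ring
      · simp only [map_sub, map_neg, Derivation.leibniz, smul_eq_mul, hjd, N_x, N_t,
          fd_comm 1 0 (fd 0 (fd 0 w)), v_x, hI, mul_zero, add_zero, map_add, map_zero]
        ring
    obtain ⟨T0, T0'⟩ := T0
    rw [sub_eq_zero] at T0 T0'
    refine ⟨⟨h.z_xi, h.w_xi⟩, ?_, ?_, ?_, ?_⟩
    · have hf := rotating_conj_evolution (dt := fd 0) (dx := fd 1) hjj (hjd 0) N_t kap_t
        (MvPowerSeries.mul_inv_cancel _ hu) T0 T0' p_t u_x v_x p_x r_x
      refine sub_eq_zero.mp (eq_zero_of_heat (-Complex.I) hFe ?_)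
      rw [neg_smul, hI]
      exact hf
    · rw [← hI] at T0; exact T0
    · rw [← hI] at T0'; exact T0'
    · rw [← hI, ← hI, hkap] at E0; exact E0

end Passivity

/-! ### Passivity of (C) -/

section PassivityLinear

open MvPowerSeries

theorem denomC_formal (k : ℝ) (z w : Formal) {j κ : Formal} (hj : j = algebraMap ℂ Formal Complex.I)
    (hκ : κ = algebraMap ℂ Formal k) : denomC formalCalculus k z w =
      j * (fd 0 (fd 0 z) * fd 0 (fd 0 (fd 0 w))) - j * (fd 0 (fd 0 w) * fd 0 (fd 0 (fd 0 z)))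
        - 2 * κ * (fd 0 (fd 0 z) * fd 0 (fd 0 w)) := by
  rw [denomC, Algebra.smul_def, Algebra.smul_def, Algebra.smul_def, map_mul, map_ofNat, hj, hκ]
  rfl

/-- The right-hand side of the equation of system (C) solved for `z_tη`. -/
noncomputable def etaC (k m : ℝ) (z w : Formal) : Formal :=
  fd 2 z * fd 0 (fd 0 (fd 0 z)) * (fd 0 (fd 0 z))⁻¹ -
    (2 * Complex.I) • (((fd 0 (fd 0 (fd 0 z))) ^ 2
      - (2 * Complex.I * (k : ℂ)) • (fd 0 (fd 0 z) * fd 0 (fd 0 (fd 0 z)))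
      - ((k : ℂ) ^ 2 + (m : ℂ)) • (fd 0 (fd 0 z)) ^ 2)
      * (fd 0 (fd 0 z) * denomC formalCalculus k z w)⁻¹)

theorem etaC_eq (k m : ℝ) (z w : Formal) {j κ K : Formal} (hj : j = algebraMap ℂ Formal Complex.I)
    (hκ : κ = algebraMap ℂ Formal k) (hK : K = algebraMap ℂ Formal ((k : ℂ) ^ 2 + (m : ℂ))) :
    etaC k m z w = fd 2 z * fd 0 (fd 0 (fd 0 z)) * (fd 0 (fd 0 z))⁻¹ -
      2 * j * ((fd 0 (fd 0 (fd 0 z)) ^ 2 - 2 * j * κ * (fd 0 (fd 0 z) * fd 0 (fd 0 (fd 0 z)))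
        - K * fd 0 (fd 0 z) ^ 2) * (fd 0 (fd 0 z) * denomC formalCalculus k z w)⁻¹) := by
  rw [etaC, Algebra.smul_def, Algebra.smul_def, Algebra.smul_def, map_mul, map_mul, map_mul,
    map_ofNat, ← hj, ← hκ, ← hK]

theorem causal_etaC (k m : ℝ) : Causal (etaC k m) := by
  intro L h0 z w z' w' hp hz hw
  have hu : jet L (fd 0 (fd 0 z)) = jet L (fd 0 (fd 0 z')) := jet_eq_iff.mpr (hz 2)
  have hv : jet L (fd 0 (fd 0 w)) = jet L (fd 0 (fd 0 w')) := jet_eq_iff.mpr (hw 2)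
  have hut : jet L (fd 0 (fd 0 (fd 0 z))) = jet L (fd 0 (fd 0 (fd 0 z'))) := jet_eq_iff.mpr (hz 3)
  have hvt : jet L (fd 0 (fd 0 (fd 0 w))) = jet L (fd 0 (fd 0 (fd 0 w'))) := jet_eq_iff.mpr (hw 3)
  have hD : jet L (fd 0 (fd 0 z) * denomC formalCalculus k z w)
      = jet L (fd 0 (fd 0 z') * denomC formalCalculus k z' w') := by
    simp only [denomC_formal k _ _ rfl rfl, map_mul, map_sub, hu, hv, hut, hvt]
  rw [← jet_eq_iff] at hp ⊢
  simp only [etaC, map_mul, map_sub, map_smul, map_pow, hp, hu, hut, jet_inv_congr h0 hu,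
    jet_inv_congr h0 hD]

theorem passiveC (k m : ℝ) : PassiveC k m := by
  obtain ⟨j, hj⟩ : ∃ j, j = algebraMap ℂ Formal Complex.I := ⟨_, rfl⟩
  obtain ⟨κ, hκ⟩ : ∃ κ, κ = algebraMap ℂ Formal k := ⟨_, rfl⟩
  obtain ⟨K, hK⟩ : ∃ K, K = algebraMap ℂ Formal ((k : ℂ) ^ 2 + (m : ℂ)) := ⟨_, rfl⟩
  have hI : ∀ f : Formal, Complex.I • f = j * f := fun f => by rw [I_smul_eq, hj]
  have hIk : ∀ f : Formal, (2 * Complex.I * (k : ℂ)) • f = 2 * j * κ * f := fun f => by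
    rw [Algebra.smul_def, map_mul, map_mul, map_ofNat, hj, hκ]
  have hKs : ∀ f : Formal, ((k : ℂ) ^ 2 + (m : ℂ)) • f = K * f := fun f => by
    rw [Algebra.smul_def, hK]
  have hjj : j * j = -1 := by rw [hj, algebraMap_I_mul_self]
  have hjd : ∀ i, fd i j = 0 := fun i => by rw [hj, fd_algebraMap]
  have hκd : ∀ i, fd i κ = 0 := fun i => by rw [hκ, fd_algebraMap]
  have hKd : ∀ i, fd i K = 0 := fun i => by rw [hK, fd_algebraMap]
  refine isPassive_of_recursion (n := 4) (r := 1) (F := etaC k m) (H := conjEta)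
    (P := fun z => (2 * Complex.I * (k : ℂ)) • fd 0 (fd 0 (fd 0 z))
      + ((k : ℂ) ^ 2 + (m : ℂ)) • fd 0 (fd 0 z))
    (Q := fun w => -((2 * Complex.I * (k : ℂ)) • fd 0 (fd 0 (fd 0 w)))
      + ((k : ℂ) ^ 2 + (m : ℂ)) • fd 0 (fd 0 w)) one_pos
    (causal_etaC k m) causal_conjEta (fun L h0 z z' hz => ?_)
    (fun L h0 w w' hw => ?_) (fun a => ?_) (fun a => ?_) ?_ ?_ ?_
  · have hu : jet L (fd 0 (fd 0 z)) = jet L (fd 0 (fd 0 z')) := jet_eq_iff.mpr (hz 2 (by norm_num))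
    have hut : jet L (fd 0 (fd 0 (fd 0 z))) = jet L (fd 0 (fd 0 (fd 0 z'))) :=
      jet_eq_iff.mpr (hz 3 (by norm_num))
    rw [← jet_eq_iff]
    simp only [map_add, map_smul, hu, hut]
  · have hu : jet L (fd 0 (fd 0 w)) = jet L (fd 0 (fd 0 w')) := jet_eq_iff.mpr (hw 2 (by norm_num))
    have hut : jet L (fd 0 (fd 0 (fd 0 w))) = jet L (fd 0 (fd 0 (fd 0 w'))) :=
      jet_eq_iff.mpr (hw 3 (by norm_num))
    rw [← jet_eq_iff]
    simp only [map_add, map_smul, map_neg, hu, hut]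
  · simp only [Set.mem_insert_iff, Set.mem_singleton_iff, forall_eq_or_imp, forall_eq,
      multiIndex_le_iff]
    omega
  · simp only [Set.mem_insert_iff, Set.mem_singleton_iff, forall_eq_or_imp, forall_eq,
      multiIndex_le_iff]
    omega
  · intro z w z' w' hz hw h
    have hu : constantCoeff (fd 0 (fd 0 z)) = constantCoeff (fd 0 (fd 0 z')) := hz 2 (by norm_num)
    have hut : constantCoeff (fd 0 (fd 0 (fd 0 z))) = constantCoeff (fd 0 (fd 0 (fd 0 z'))) :=
      hz 3 (by norm_num)
    have hv : constantCoeff (fd 0 (fd 0 w)) = constantCoeff (fd 0 (fd 0 w')) := hw 2 (by norm_num)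
    have hvt : constantCoeff (fd 0 (fd 0 (fd 0 w))) = constantCoeff (fd 0 (fd 0 (fd 0 w'))) :=
      hw 3 (by norm_num)
    refine ⟨fun h0 => h.1 (hu.trans h0), fun h0 => h.2 ?_⟩
    change constantCoeff (denomC formalCalculus k z' w') = 0 at h0
    change constantCoeff (denomC formalCalculus k z w) = 0
    rw [← h0, denomC_formal k _ _ hj hκ, denomC_formal k _ _ hj hκ]
    simp only [map_mul, map_sub, hu, hut, hv, hvt]
  · rintro z w ⟨⟨h1, h2⟩, h3, h4, h5, h6⟩
    exact ⟨h1, h2, fun a _ => congrArg (coeff a) h6, fun a _ => congrArg (coeff a) h3,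
      fun a _ _ => congrArg (coeff a) h4, fun a _ _ => congrArg (coeff a) h5,
      fun _ _ _ _ => rfl, fun _ _ _ _ => rfl⟩
  · intro z w hreg h
    have hu : constantCoeff (fd 0 (fd 0 z)) ≠ 0 := hreg.1
    have hD0 : constantCoeff (denomC formalCalculus k z w) ≠ 0 := hreg.2
    have hDi := MvPowerSeries.mul_inv_cancel (fd 0 (fd 0 z) * denomC formalCalculus k z w)
      (by rw [map_mul]; exact mul_ne_zero hu hD0)
    have hui := MvPowerSeries.mul_inv_cancel _ hu
    have hDe := denomC_formal k z w hj hκ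
    obtain ⟨u_x, v_x, p_x, r_x⟩ := h.xi_equations hj
    have hE := mem_xiLevel_of_coeff h.z_eta
    have hFe := mem_xiLevel_of_coeff h.w_eta
    have hT := mem_etaLevel_of_coeff h.z_t
    have hT' := mem_etaLevel_of_coeff h.w_t
    simp only [hIk, hKs, Function.iterate_succ, Function.iterate_zero, Function.comp_apply,
      id_eq] at hE hT hT'
    have hF := etaC_eq k m z w hj hκ hK
    -- The equation for z_tη is nonlinear, and its propagation in ξ needs the linear equations for u
    -- and v. These therefore come first, using the former only at ξ = 0.
    obtain ⟨T0, T0'⟩ : fd 0 (fd 0 (fd 0 (fd 0 z))) - (2 * j * κ * fd 0 (fd 0 (fd 0 z))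
          + K * fd 0 (fd 0 z)) = 0 ∧
        fd 0 (fd 0 (fd 0 (fd 0 w))) - (-(2 * j * κ * fd 0 (fd 0 (fd 0 w)))
          + K * fd 0 (fd 0 w)) = 0 := by
      refine eq_zero_of_eta_evolution hT hT' (fun n hn hn' => ?_) ?_ ?_
      · rw [← jet_eq_iff] at hn hn'
        simp only [map_mul, map_neg, map_add, map_ofNat] at hn hn'
        have hπ : ∀ f, fd 0 f = 0 → jetT n (jet (etaLevel n) f) = 0 := fun f hf => by
          rw [jetT_jet, hf, map_zero]
        obtain ⟨q, Oi, Oi_t, -, hp, hq, hr⟩ := exists_wronskian_form (dt := jetT n)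
          (u := jet (etaLevel n) (fd 0 (fd 0 z))) (v := jet (etaLevel n) (fd 0 (fd 0 w)))
          (p := jet (etaLevel n) (fd 2 z)) (j := jet (etaLevel n) j) (k := jet (etaLevel n) κ)
          (K := jet (etaLevel n) K) (D := jet (etaLevel n) (denomC formalCalculus k z w))
          (Di := jet (etaLevel n) (fd 0 (fd 0 z) * denomC formalCalculus k z w)⁻¹)
          (by rw [← map_mul, hjj, map_neg, map_one]) (hπ _ (hjd 0)) (hπ _ (hκd 0)) (jet_mul_inv hu)
          (by rw [hDe]; simp only [jetT_jet, map_sub, map_mul, map_ofNat])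
          (by rw [← map_mul, ← map_mul, hDi, map_one])
          (by simp only [jetT_jet, hn]) (by simp only [jetT_jet, hn'])
        have hE' := jet_eq_iff.mpr (mem_etaLevel_of_mem_xiLevel (n := n) hE)
        rw [hF, fd_comm 2 0] at hE'
        simp only [map_sub, map_mul, map_pow, map_ofNat] at hE'
        simp only [jetT_jet] at hq
        rw [hE', sub_self] at hq
        have q_t : jetT n q = 0 :=
          (IsUnit.of_mul_eq_one _ (jet_mul_inv (L := etaLevel n) hu)).mul_left_cancel
            (by rw [← hq, mul_zero])
        rw [← h.jet_conjEta] at hr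
        obtain ⟨e1, e2⟩ := linear_eta (K := jet (etaLevel n) K) (hπ _ (hjd 0)) (hπ _ (hκd 0))
          (hπ _ (hKd 0)) (by simp only [jetT_jet, hn]) (by simp only [jetT_jet, hn']) Oi_t q_t hp hr
        have e1' := congrArg (fun x => jetT n (jetT n x)) e1
        have e2' := congrArg (fun x => jetT n (jetT n x)) e2
        simp only [jetT_jet, map_add, map_neg, Derivation.leibniz, smul_eq_mul, hjd, hκd, hKd,
          derivation_ofNat, map_zero, mul_zero, add_zero] at e1' e2'
        constructor
        · rw [← jet_eq_zero_iff]
          simp only [map_sub, map_mul, map_add, Derivation.leibniz, smul_eq_mul, hjd, hκd, hKd,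
            fd_comm 2 0, e1', derivation_ofNat, map_ofNat, map_zero, mul_zero, add_zero]
          ring
        · rw [← jet_eq_zero_iff]
          simp only [map_sub, map_mul, map_add, map_neg, Derivation.leibniz, smul_eq_mul, hjd, hκd,
            hKd, fd_comm 2 0, e2', derivation_ofNat, map_ofNat, map_zero, mul_zero, add_zero]
          ring
      · simp only [map_sub, map_add, Derivation.leibniz, smul_eq_mul, hjd, hκd, hKd,
          fd_comm 1 0 (fd 0 (fd 0 z)), fd_comm 1 0 (fd 0 (fd 0 (fd 0 z))), u_x, hI,
          derivation_ofNat, mul_zero, add_zero, map_zero]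
        ring
      · simp only [map_sub, map_add, map_neg, Derivation.leibniz, smul_eq_mul, hjd, hκd, hKd,
          fd_comm 1 0 (fd 0 (fd 0 w)), fd_comm 1 0 (fd 0 (fd 0 (fd 0 w))), v_x, hI,
          derivation_ofNat, mul_zero, add_zero, map_zero]
        ring
    rw [sub_eq_zero] at T0 T0'
    obtain ⟨q, Oi, Oi_t, hOi, hp, hq, hr⟩ := exists_wronskian_form (dt := fd 0) (p := fd 2 z) hjj
      (hjd 0) (hκd 0) hui hDe hDi T0 T0'
    obtain ⟨Oi_x, q_x⟩ := linear_xi (dt := fd 0) (dx := fd 1) (fd_comm 1 0) hui (hjd 0) (hκd 0)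
      (hKd 0) (hjd 1) (hκd 1) T0 T0' u_x v_x p_x Oi_t hOi hp
    rw [← hF, ← fd_comm 2 0] at hq
    -- The defect of the equation for z_tη is u q_t. It vanishes at ξ = 0, and q_tξ is the
    -- t-derivative of an expression linear in q_t and q_tt, so the vanishing propagates.
    have q_t : fd 0 q = 0 := by
      refine eq_zero_of_xi_evolution ?_ fun n hn => ?_
      · have : fd 0 q = (fd 0 (fd 0 z))⁻¹ * (fd 2 (fd 0 z) - etaC k m z w) := by
          rw [hq]; linear_combination -fd 0 q * hui
        rw [this]
        exact Ideal.mul_mem_left _ _ hE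
      · rw [fd_comm 1 0, q_x]
        refine fd_mem_xiLevel (Ideal.mul_mem_left _ _ (Ideal.add_mem _ (fd_mem_xiLevel hn) ?_))
        exact Ideal.mul_mem_right _ _ (Ideal.mul_mem_left _ _ hn)
    rw [q_t, map_zero, mul_zero, zero_mul, add_zero, mul_zero] at q_x
    rw [q_t, mul_zero, sub_eq_zero] at hq
    have hf := linear_conj_evolution (dt := fd 0) (dx := fd 1) (r := fd 2 w) (fd_comm 1 0) (hjd 0)
      (hκd 0) (hKd 0) (hjd 1) (hκd 1) T0' v_x r_x Oi_t Oi_x q_t q_x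
    rw [← hr] at hf
    refine ⟨⟨h.z_xi, h.w_xi⟩, ?_, ?_, ?_, hq⟩
    · refine sub_eq_zero.mp (eq_zero_of_heat (-Complex.I) hFe ?_)
      rw [neg_smul, hI]
      exact hf
    · rw [← hIk, ← hKs] at T0; exact T0
    · rw [← hIk, ← hKs] at T0'; exact T0'

end PassivityLinear

theorem mainTheorem1 :
    (∀ (U : Set Pt) (z : Pt → ℂ), IsOpen U → ContDiffOn ℝ ∞ z U →
      (SolvesOriginal U z ↔
        ∃ V : Set Pt, IsOpen V ∧ V ⊆ U ∧ U ⊆ closure V ∧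
          ∀ p ∈ V, ∃ W : Set Pt, IsOpen W ∧ p ∈ W ∧ W ⊆ V ∧
            (SolvesA W z ∨ (∃ N : ℝ → ℝ, SolvesB W N z) ∨ ∃ k m : ℝ, SolvesC W k m z))) ∧
    PassiveA ∧
    (∀ N : Formal, IsRealSeriesInEta N → MvPowerSeries.constantCoeff N ≠ 0 → PassiveB N) ∧
    (∀ k m : ℝ, PassiveC k m) := by
  exact ⟨fun U z hU hz => solvesOriginal_iff_locally hU hz, passiveA,
    fun N hN hN0 => passiveB hN hN0, passiveC⟩
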